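/- \textbf{Setting.} Let $\Omega\subset\mathbb{R}^d$, $d\in\{1,2,3\}$, be a convex polyhedral domain (the nonempty interior of the convex hull of finitely many points), $T>0$, $\alpha\in(0,1)$, $0<c_0<c_1<\infty$, $u_0\in L^2(\Omega)$ and $f\in L^2(0,T;H^{-1}(\Omega))$. Let $$\mathcal{A}=\{q\in L^\infty(\Omega\times(0,T)):\ c_0\le q\le c_1\ \text{a.e. in }\Omega\times(0,T)\}.$$ For $q\in\mathcal{A}$ let $u(q)$ be the unique weak solution of $\partial_t^\alpha u-\nabla\cdot(q\nabla u)=f$ in $\Omega\times(0,T)$, $u=0$ on $\partial\Omega\times(0,T)$, $u(0)=u_0$, that is, $u(q)=u\in L^2(0,T;H_0^1(\Omega))$ with ${_0I_t^{1-\alpha}}(u-u_0)\in{_0H^1}(0,T;H^{-1}(\Omega))$ (the functions in $H^1(0,T;H^{-1}(\Omega))$ vanishing at $t=0$), where ${_0I_t^{1-\alpha}}v(t)=\frac{1}{\Gamma(1-\alpha)}\int_0^t(t-s)^{-\alpha}v(s)\,\mathrm{d}s$, and, with $\partial_t^\alpha u:=\frac{\mathrm d}{\mathrm dt}\,{_0I_t^{1-\alpha}}(u-u_0)$,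 $$(\partial_t^\alpha u(t),\phi)+(q(t)\nabla u(t),\nabla\phi)=(f(t),\phi)\qquad\text{for all }\phi\in H_0^1(\Omega)\text{ and a.e. }t\in(0,T).$$ For $\gamma>0$ and $z\in L^2(0,T;L^2(\Omega))$ put $$J_\gamma(q;z)=\tfrac12\|u(q)-z\|_{L^2(0,T;L^2(\Omega))}^2+\tfrac{\gamma}{2}\|\nabla_{x,t}q\|_{L^2(0,T;L^2(\Omega))}^2,\qquad q\in\mathcal{A},$$ where $\nabla_{x,t}$ is the space-time gradient and $\|\nabla_{x,t}q\|=\infty$ if $q\notin H^1(\Omega\times(0,T))$. \textbf{Theorem.} (i) Let $\gamma>0$, let $z_j\to z^*$ in $L^2(0,T;L^2(\Omega))$, and for each $j$ let $q_j^*\in\mathcal{A}$ be a minimizer of $J_\gamma(\cdot;z_j)$ over $\mathcal{A}$. Then $\{q_j^*\}$ contains a subsequence converging in $H^1(\Omega\times(0,T))$ to a minimizer of $J_\gamma(\cdot;z^*)$ over $\mathcal{A}$. (ii) Let $z^*$ be exact data, i.e. $z^*=u(q^\dag)$ for some $q^\dag\in\mathcal{A}\cap H^1(\Omega\times(0,T))$.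 Let $\delta_j\ge0$ with $\delta_j\to0$, let $z^{\delta_j}\in L^2(0,T;L^2(\Omega))$ satisfy $\|z^{\delta_j}-z^*\|_{L^2(0,T;L^2(\Omega))}=\delta_j$, let $\gamma_j>0$ satisfy $\gamma_j\to0$ and $\delta_j^2/\gamma_j\to0$, and for each $j$ let $q_j^*$ be a minimizer of $J_{\gamma_j}(\cdot;z^{\delta_j})$ over $\mathcal{A}$. Then $\{q_j^*\}$ contains a subsequence that converges in $H^1(\Omega\times(0,T))$, and the limit of every subsequence that converges in $H^1(\Omega\times(0,T))$ is a minimum-$H^1(\Omega\times(0,T))$-seminorm solution, i.e. an element of $\{q\in\mathcal{A}\cap H^1(\Omega\times(0,T)):\ u(q)=z^*\}$ at which $\|\nabla_{x,t}q\|_{L^2(0,T;L^2(\Omega))}$ is minimal. -/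

import Mathlib

open MeasureTheory Filter Topology Set
open scoped ENNReal ContDiff

namespace Subdiffusion

noncomputable section

/-- The Euclidean space `ℝ^d`. -/
abbrev E (d : ℕ) : Type := EuclideanSpace ℝ (Fin d)

/-- Convex polyhedral domains: nonempty interiors of convex hulls of finitely many points. -/
def IsConvexPolyhedralDomain {d : ℕ} (Ω : Set (E d)) : Prop :=
  Ω.Nonempty ∧ ∃ S : Finset (E d), Ω = interior (convexHull ℝ (S : Set (E d)))

/-- Lebesgue measure on the time interval `(0,T)`. -/
abbrev timeMeasure (T : ℝ) : Measure ℝ := volume.restrict (Ioo 0 T)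

/-- Lebesgue measure on the space-time cylinder `Ω × (0,T)`. -/
abbrev cylMeasure {d : ℕ} (Ω : Set (E d)) (T : ℝ) : Measure (E d × ℝ) :=
  volume.restrict (Ω ×ˢ Ioo 0 T)

/-! ### The spaces `L²(Ω)`, `H₀¹(Ω)`, `H⁻¹(Ω)` -/

/-- `L²(Ω)`. -/
abbrev L2 {d : ℕ} (Ω : Set (E d)) : Type := Lp ℝ 2 (volume.restrict Ω)

/-- `L²(Ω; ℝ^d)`. -/
abbrev L2Vec {d : ℕ} (Ω : Set (E d)) : Type := Lp (E d) 2 (volume.restrict Ω)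

/-- Smooth functions on a normed space with compact support inside the set `U`. -/
structure IsTestFunction {V : Type*} [NormedAddCommGroup V] [NormedSpace ℝ V]
    (U : Set V) (φ : V → ℝ) : Prop where
  smooth : ContDiff ℝ ∞ φ
  compact : HasCompactSupport φ
  support : tsupport φ ⊆ U

/-- The space `H₀¹(Ω)` as a set of pairs `(v, ∇v)` in `L²(Ω) × L²(Ω; ℝ^d)` (with the Hilbert norm
`(‖v‖² + ‖∇v‖²)^{1/2}`): the closure of the pairs `(φ, ∇φ)` with `φ ∈ C_c^∞(Ω)`. -/
def h01 {d : ℕ} (Ω : Set (E d)) : Submodule ℝ (WithLp 2 (L2 Ω × L2Vec Ω)) :=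
  (Submodule.span ℝ {w | ∃ φ : E d → ℝ, IsTestFunction Ω φ ∧
    (w.fst : E d → ℝ) =ᵐ[volume.restrict Ω] φ ∧
    (w.snd : E d → E d) =ᵐ[volume.restrict Ω] gradient φ}).topologicalClosure

/-- The Hilbert space `H₀¹(Ω)`. -/
abbrev H01 {d : ℕ} (Ω : Set (E d)) : Type := h01 Ω

/-- The embedding `H₀¹(Ω) → L²(Ω)`. -/
def H01.val {d : ℕ} {Ω : Set (E d)} : H01 Ω →L[ℝ] L2 Ω :=
  (WithLp.fstL 2 ℝ (L2 Ω) (L2Vec Ω)).comp (h01 Ω).subtypeL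

/-- The weak gradient `H₀¹(Ω) → L²(Ω; ℝ^d)`. -/
def H01.grad {d : ℕ} {Ω : Set (E d)} : H01 Ω →L[ℝ] L2Vec Ω :=
  (WithLp.sndL 2 ℝ (L2 Ω) (L2Vec Ω)).comp (h01 Ω).subtypeL

/-- `H⁻¹(Ω)`, the dual space of `H₀¹(Ω)`. -/
abbrev HMinusOne {d : ℕ} (Ω : Set (E d)) : Type := H01 Ω →L[ℝ] ℝ

/-- The embedding `L²(Ω) → H⁻¹(Ω)`, `v ↦ (v, ·)`. -/
def toHMinusOne {d : ℕ} {Ω : Set (E d)} (v : L2 Ω) : HMinusOne Ω :=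
  (innerSL ℝ v).comp H01.val

/-! ### The forward problem -/

/-- The Riemann-Liouville fractional integral
`(₀I_t^β v)(t) = Γ(β)⁻¹ ∫_0^t (t-s)^{β-1} v(s) ds`. -/
def fracIntegral {X : Type*} [NormedAddCommGroup X] [NormedSpace ℝ X]
    (β : ℝ) (v : ℝ → X) (t : ℝ) : X :=
  (Real.Gamma β)⁻¹ • ∫ s in (0 : ℝ)..t, (t - s) ^ (β - 1) • v s

/-- `v` belongs to `₀H¹(0,T;X)`, the functions in `H¹(0,T;X)` that vanish at `t = 0`, and has the
derivative `g ∈ L²(0,T;X)`. -/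
structure HasZeroH1Deriv {X : Type*} [NormedAddCommGroup X] [NormedSpace ℝ X]
    (T : ℝ) (v g : ℝ → X) : Prop where
  memLp_deriv : MemLp g 2 (timeMeasure T)
  eq_integral : ∀ᵐ t ∂(timeMeasure T), v t = ∫ s in (0 : ℝ)..t, g s

/-- The form `(q(t)∇v, ∇φ)`. -/
def diffusionForm {d : ℕ} {Ω : Set (E d)} (q : E d × ℝ → ℝ) (t : ℝ) (v φ : H01 Ω) : ℝ :=
  ∫ x in Ω, q (x, t) * inner ℝ ((H01.grad v : L2Vec Ω) x) ((H01.grad φ : L2Vec Ω) x)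

/-- `u` is a weak solution of `∂_t^α u - ∇·(q∇u) = f` in `Ω × (0,T)`, `u = 0` on `∂Ω × (0,T)`,
`u(0) = u₀`: one has `u ∈ L²(0,T;H₀¹(Ω))`, `₀I_t^{1-α}(u - u₀) ∈ ₀H¹(0,T;H⁻¹(Ω))`, and, with
`∂_t^α u = (₀I_t^{1-α}(u - u₀))'`, the identity `(∂_t^α u(t), φ) + (q(t)∇u(t), ∇φ) = (f(t), φ)`
holds for a.e. `t` and all `φ ∈ H₀¹(Ω)`. -/
def IsWeakSolution {d : ℕ} (Ω : Set (E d)) (T α : ℝ) (u₀ : L2 Ω) (f : ℝ → HMinusOne Ω)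
    (q : E d × ℝ → ℝ) (u : ℝ → H01 Ω) : Prop :=
  MemLp u 2 (timeMeasure T) ∧
  ∃ g : ℝ → HMinusOne Ω,
    HasZeroH1Deriv T
      (fun t => toHMinusOne (fracIntegral (1 - α) (fun s => H01.val (u s) - u₀) t)) g ∧
    ∀ᵐ t ∂(timeMeasure T), ∀ φ : H01 Ω, g t φ + diffusionForm q t (u t) φ = f t φ

open Classical in
/-- The forward map `q ↦ u(q)`: the weak solution for the coefficient `q`. -/
def forwardMap {d : ℕ} (Ω : Set (E d)) (T α : ℝ) (u₀ : L2 Ω) (f : ℝ → HMinusOne Ω)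
    (q : E d × ℝ → ℝ) : ℝ → H01 Ω :=
  if h : ∃ u, IsWeakSolution Ω T α u₀ f q u then h.choose else 0

/-- The observation `t ↦ u(q)(t) ∈ L²(Ω)`. -/
def observation {d : ℕ} (Ω : Set (E d)) (T α : ℝ) (u₀ : L2 Ω) (f : ℝ → HMinusOne Ω)
    (q : E d × ℝ → ℝ) (t : ℝ) : L2 Ω :=
  H01.val (forwardMap Ω T α u₀ f q t)

/-! ### Coefficients -/

/-- The admissible set `𝒜` of measurable `q` with `c₀ ≤ q ≤ c₁` a.e. in `Ω × (0,T)`. -/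
def admissibleSet {d : ℕ} (Ω : Set (E d)) (T c₀ c₁ : ℝ) : Set (E d × ℝ → ℝ) :=
  {q | AEStronglyMeasurable q (cylMeasure Ω T) ∧
    ∀ᵐ p ∂(cylMeasure Ω T), c₀ ≤ q p ∧ q p ≤ c₁}

/-- `q ∈ H¹(Ω × (0,T))`, with weak space gradient `Gx` and weak time derivative `Gt`. -/
structure HasWeakGradient {d : ℕ} (Ω : Set (E d)) (T : ℝ) (q : E d × ℝ → ℝ)
    (Gx : E d × ℝ → E d) (Gt : E d × ℝ → ℝ) : Prop where
  memLp : MemLp q 2 (cylMeasure Ω T)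
  memLp_x : MemLp Gx 2 (cylMeasure Ω T)
  memLp_t : MemLp Gt 2 (cylMeasure Ω T)
  deriv_x : ∀ φ : E d × ℝ → ℝ, IsTestFunction (Ω ×ˢ Ioo 0 T) φ → ∀ v : E d,
    ∫ p, q p * fderiv ℝ φ p (v, 0) ∂(cylMeasure Ω T) =
      -∫ p, inner ℝ (Gx p) v * φ p ∂(cylMeasure Ω T)
  deriv_t : ∀ φ : E d × ℝ → ℝ, IsTestFunction (Ω ×ˢ Ioo 0 T) φ →
    ∫ p, q p * fderiv ℝ φ p (0, 1) ∂(cylMeasure Ω T) =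
      -∫ p, Gt p * φ p ∂(cylMeasure Ω T)

/-- `q ∈ H¹(Ω × (0,T))`. -/
def MemH1 {d : ℕ} (Ω : Set (E d)) (T : ℝ) (q : E d × ℝ → ℝ) : Prop :=
  ∃ Gx Gt, HasWeakGradient Ω T q Gx Gt

/-- The squared seminorm `‖∇_{x,t} q‖²` in `L²(0,T;L²(Ω))`, equal to `∞` if `q ∉ H¹(Ω × (0,T))`.
(The weak gradient is unique a.e., so that the infimum is over at most one value.) -/
def h1SeminormSq {d : ℕ} (Ω : Set (E d)) (T : ℝ) (q : E d × ℝ → ℝ) : ℝ≥0∞ :=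
  ⨅ (Gx : E d × ℝ → E d) (Gt : E d × ℝ → ℝ) (_ : HasWeakGradient Ω T q Gx Gt),
    ∫⁻ p, (‖Gx p‖ₑ ^ 2 + ‖Gt p‖ₑ ^ 2) ∂(cylMeasure Ω T)

/-- Convergence `q_j → q` in `H¹(Ω × (0,T))`. -/
def TendstoH1 {d : ℕ} (Ω : Set (E d)) (T : ℝ) (qs : ℕ → E d × ℝ → ℝ) (q : E d × ℝ → ℝ) : Prop :=
  (∀ j, MemH1 Ω T (qs j)) ∧ MemH1 Ω T q ∧
    Tendsto (fun j => eLpNorm (qs j - q) 2 (cylMeasure Ω T) ^ 2 + h1SeminormSq Ω T (qs j - q))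
      atTop (𝓝 0)

/-! ### The regularized problem -/

/-- `J_γ(q;z) = ½ ‖u(q) - z‖² + (γ/2) ‖∇_{x,t} q‖²`, with values in `[0,∞]`. -/
def J {d : ℕ} (Ω : Set (E d)) (T α : ℝ) (u₀ : L2 Ω) (f : ℝ → HMinusOne Ω) (γ : ℝ)
    (z : ℝ → L2 Ω) (q : E d × ℝ → ℝ) : ℝ≥0∞ :=
  2⁻¹ * eLpNorm (observation Ω T α u₀ f q - z) 2 (timeMeasure T) ^ 2 +
    ENNReal.ofReal (γ / 2) * h1SeminormSq Ω T q

/-- `q` is a minimizer of `J_γ(·;z)` over the admissible set. -/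
def IsMinimizer {d : ℕ} (Ω : Set (E d)) (T α c₀ c₁ : ℝ) (u₀ : L2 Ω) (f : ℝ → HMinusOne Ω) (γ : ℝ)
    (z : ℝ → L2 Ω) (q : E d × ℝ → ℝ) : Prop :=
  q ∈ admissibleSet Ω T c₀ c₁ ∧ IsMinOn (J Ω T α u₀ f γ z) (admissibleSet Ω T c₀ c₁) q

/-- `q` solves the inverse problem for the data `z`: it is admissible and `u(q) = z`. -/
def IsSolution {d : ℕ} (Ω : Set (E d)) (T α c₀ c₁ : ℝ) (u₀ : L2 Ω) (f : ℝ → HMinusOne Ω)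
    (z : ℝ → L2 Ω) (q : E d × ℝ → ℝ) : Prop :=
  q ∈ admissibleSet Ω T c₀ c₁ ∧ observation Ω T α u₀ f q =ᵐ[timeMeasure T] z

/-- `q` is a solution of the inverse problem in `H¹(Ω × (0,T))` whose `H¹`-seminorm is minimal
among all solutions. -/
def IsMinSeminormSolution {d : ℕ} (Ω : Set (E d)) (T α c₀ c₁ : ℝ) (u₀ : L2 Ω)
    (f : ℝ → HMinusOne Ω) (z : ℝ → L2 Ω) (q : E d × ℝ → ℝ) : Prop :=
  IsSolution Ω T α c₀ c₁ u₀ f z q ∧ MemH1 Ω T q ∧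
    ∀ q', IsSolution Ω T α c₀ c₁ u₀ f z q' → h1SeminormSq Ω T q ≤ h1SeminormSq Ω T q'

end

end Subdiffusion

/-! Both parts follow the direct method. Comparing a minimizer `q_j` with a fixed competitor `p ∈ 𝒜
∩ H¹` bounds `‖∇q_j‖²` by a number `a_j(p)`. In (i) this is `(‖u(p) - z_j‖² - ‖u(q_j) - z_j‖²)/γ +
‖∇p‖²`. In (ii), where `p` is an exact solution, it is `δ_j²/γ_j + ‖∇p‖²`. Hence a subsequence
converges strongly in `L²`, with weakly convergent gradients, to some `q ∈ 𝒜`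
(`exists_subseq_tendstoH1`), and `u(q_j) → u(q)` (`tendsto_observation`), so `a_j(p)` converges
along it. Weak lower semicontinuity for every `p` gives optimality of `q`. The choice `p = q` gives
`a_j(q) → ‖∇q‖²`, so no norm is lost in the limit and the gradients converge strongly
(`WeakTendsto.norm_le_and_tendsto`).

The forward problem is an operator equation in `L²(0,T;V)` with `V = H₀¹ ≅ V'`: `L*(a K(Lu - u₀)) =
I(f - Bu)`. Here `L` is the embedding into `L²(0,T;L²(Ω))`, `a = Γ(1-α)⁻¹`, `K` is convolution with
`r^(-α)`, `I` is integration in time and `B` is the diffusion operator. Both `K` and `I` are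
integrals of the right shifts `S_r`, a contraction semigroup that vanishes for `r ≥ T`. For `w = Iη`
one has `∫_0^r ⟪w, S_ρ η⟫ dρ = ⟪w, w - S_r w⟫ ≥ 0`, and integration by parts against the decreasing
weight gives `⟪Kη, Iη⟫ ≥ T^(-α) ‖Iη‖²`. This positivity yields stability
(`norm_le_of_fractional_eq`). In its adjoint form it yields existence by a Lions-type duality
argument (`exists_fractional_eq`). Stability reduces continuity of `q ↦ u(q)` to strong convergence
of the multiplication operators, which is dominated convergence once `q_j → q` almost everywhere.

Compactness in `L²` combines a Rellich argument in the interior, by cutoff and mollification, with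
the bound `c₀ ≤ q ≤ c₁`, which makes the contribution of a thin boundary layer small. -/

namespace Subdiffusion

set_option linter.unusedSectionVars false

/-! ### Positivity of the singular kernel -/

/-- A weighted integral against the decreasing weight `r ^ (-α)` is controlled from below by the
primitive, if the primitive is nonnegative. -/
theorem rpow_neg_mul_integral_le {c : ℝ → ℝ} (hc : Continuous c) {T α : ℝ} (hT : 0 < T)
    (hα0 : 0 < α) (hα1 : α < 1) (h : ∀ r ∈ Icc 0 T, 0 ≤ ∫ x in (0 : ℝ)..r, c x) :
    T ^ (-α) * ∫ x in (0 : ℝ)..T, c x ≤ ∫ r in (0 : ℝ)..T, r ^ (-α) * c r := by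
  set C : ℝ → ℝ := fun r => ∫ x in (0 : ℝ)..r, c x with hC
  have hCd : ∀ r, HasDerivAt C (c r) r := fun r =>
    intervalIntegral.integral_hasDerivAt_right (hc.intervalIntegrable _ _)
      hc.stronglyMeasurable.stronglyMeasurableAtFilter hc.continuousAt
  have hkint : IntervalIntegrable (fun r : ℝ => r ^ (-α) * c r) volume 0 T :=
    (intervalIntegral.intervalIntegrable_rpow' (by linarith)).mul_continuousOn hc.continuousOn
  -- Integration by parts is done on `[ε, T]`, away from the singularity of the weight.
  have key : ∀ ε ∈ Ioo 0 T,
      T ^ (-α) * C T - ε ^ (-α) * C ε ≤ ∫ r in ε..T, r ^ (-α) * c r := by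
    intro ε hε
    have hpos : ∀ x ∈ uIcc ε T, 0 < x := by
      intro x hx
      rw [uIcc_of_le hε.2.le] at hx
      exact hε.1.trans_le hx.1
    have hcont : ContinuousOn (fun x : ℝ => -α * x ^ (-α - 1)) (uIcc ε T) :=
      continuousOn_const.mul
        (continuousOn_id.rpow_const fun x hx => Or.inl (hpos x hx).ne')
    have := intervalIntegral.integral_mul_deriv_eq_deriv_mul (a := ε) (b := T)
      (u := fun x => x ^ (-α)) (u' := fun x => -α * x ^ (-α - 1)) (v := C) (v' := c)
      (fun x hx => Real.hasDerivAt_rpow_const (Or.inl (hpos x hx).ne'))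
      (fun x _ => hCd x) hcont.intervalIntegrable (hc.intervalIntegrable _ _)
    rw [this]
    -- The weight decreases and the primitive is nonnegative, so the remaining integral has a sign.
    have h0 : 0 ≤ ∫ x in ε..T, -(-α * x ^ (-α - 1) * C x) := by
      refine intervalIntegral.integral_nonneg hε.2.le fun x hx => ?_
      have h1 : 0 ≤ x ^ (-α - 1) := Real.rpow_nonneg (hε.1.le.trans hx.1) _
      have h2 : 0 ≤ C x := h x ⟨hε.1.le.trans hx.1, hx.2⟩
      have : 0 ≤ α * x ^ (-α - 1) * C x := by positivity
      linarith
    rw [intervalIntegral.integral_neg] at h0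
    linarith
  have hlim1 : Tendsto (fun ε => ∫ r in ε..T, r ^ (-α) * c r) (𝓝[>] 0)
      (𝓝 (∫ r in (0 : ℝ)..T, r ^ (-α) * c r)) := by
    have := intervalIntegral.continuousOn_primitive_interval_left (f := fun r => r ^ (-α) * c r)
      (μ := volume) (a := 0) (b := T)
      (by rw [uIcc_of_le hT.le]; exact (intervalIntegrable_iff_integrableOn_Icc_of_le hT.le).1 hkint)
    have := this 0 left_mem_uIcc
    rw [uIcc_of_le hT.le] at this
    refine this.mono_left ?_
    rw [← nhdsWithin_Ioc_eq_nhdsGT hT]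
    exact nhdsWithin_mono _ Ioc_subset_Icc_self
  -- The boundary term vanishes because `ε^(-α) C(ε) = ε^(1-α) · (C(ε)/ε)`, where the quotient tends
  -- to `c 0`.
  have hlim2 : Tendsto (fun ε => T ^ (-α) * C T - ε ^ (-α) * C ε) (𝓝[>] 0)
      (𝓝 (T ^ (-α) * C T - 0)) := by
    refine tendsto_const_nhds.sub ?_
    have h1 : Tendsto (fun ε : ℝ => ε⁻¹ * C ε) (𝓝[>] 0) (𝓝 (c 0)) := by
      have := (hCd 0).tendsto_slope_zero_right
      simpa [hC] using this
    have h2 : Tendsto (fun ε : ℝ => ε ^ (1 - α)) (𝓝[>] 0) (𝓝 0) := by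
      have := (Real.continuousAt_rpow_const 0 (1 - α) (Or.inr (by linarith))).tendsto
      rw [Real.zero_rpow (by linarith)] at this
      exact this.mono_left nhdsWithin_le_nhds
    have h3 := h2.mul h1
    rw [zero_mul] at h3
    refine h3.congr' ?_
    filter_upwards [self_mem_nhdsWithin] with ε hε
    have hε : 0 < ε := hε
    rw [← mul_assoc, sub_eq_neg_add, Real.rpow_add hε, Real.rpow_one, mul_assoc (ε ^ (-α)),
      mul_inv_cancel₀ hε.ne', mul_one]
  rw [sub_zero] at hlim2
  refine le_of_tendsto_of_tendsto hlim2 hlim1 ?_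
  filter_upwards [Ioo_mem_nhdsGT hT] with ε hε using key ε hε

/-! ### Nilpotent contraction semigroups and their convolution operators -/

section Semigroup

variable {X Y : Type*} [NormedAddCommGroup X] [InnerProductSpace ℝ X] [CompleteSpace X]
  [NormedAddCommGroup Y] [InnerProductSpace ℝ Y] [CompleteSpace Y]

/-- A strongly continuous contraction semigroup that vanishes from the time `T` on. -/
structure IsNilpotentSemigroup (T : ℝ) (S : ℝ → X →L[ℝ] X) : Prop where
  norm_le : ∀ r x, ‖S r x‖ ≤ ‖x‖
  cont : ∀ x, Continuous fun r => S r x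
  zero : ∀ x, S 0 x = x
  add : ∀ r s, 0 ≤ r → 0 ≤ s → ∀ x, S r (S s x) = S (r + s) x
  eq_zero : ∀ r, T ≤ r → ∀ x, S r x = 0

namespace IsNilpotentSemigroup

variable {T : ℝ} {S : ℝ → X →L[ℝ] X} {S' : ℝ → Y →L[ℝ] Y} {k l : ℝ → ℝ}

theorem intervalIntegrable (hS : IsNilpotentSemigroup T S)
    (hk : IntervalIntegrable k volume 0 T) (x : X) :
    IntervalIntegrable (fun r => k r • S r x) volume 0 T :=
  hk.smul_continuousOn (hS.cont x).continuousOn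

/-- The operator `∫_0^T k(r) S_r dr`. -/
noncomputable def conv (hS : IsNilpotentSemigroup T S) (hk : IntervalIntegrable k volume 0 T) :
    X →L[ℝ] X :=
  LinearMap.mkContinuous
    { toFun := fun x => ∫ r in (0 : ℝ)..T, k r • S r x
      map_add' := fun x y => by
        simp only [map_add, smul_add]
        exact intervalIntegral.integral_add (hS.intervalIntegrable hk x)
          (hS.intervalIntegrable hk y)
      map_smul' := fun a x => by
        simp only [map_smul, RingHom.id_apply, ← intervalIntegral.integral_smul]
        exact intervalIntegral.integral_congr fun r _ => smul_comm _ _ _ }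
    (abs (∫ r in (0 : ℝ)..T, abs (k r))) fun x => by
      refine (intervalIntegral.norm_integral_le_abs_of_norm_le (g := fun r => abs (k r) * ‖x‖)
        (Eventually.of_forall fun r => ?_) (hk.abs.mul_const _)).trans ?_
      · rw [norm_smul, Real.norm_eq_abs]
        exact mul_le_mul_of_nonneg_left (hS.norm_le r x) (abs_nonneg _)
      · rw [intervalIntegral.integral_mul_const, abs_mul, abs_norm]

theorem conv_apply (hS : IsNilpotentSemigroup T S) (hk : IntervalIntegrable k volume 0 T) (x : X) :
    hS.conv hk x = ∫ r in (0 : ℝ)..T, k r • S r x := rfl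

/-- A bounded operator passes under the integral. This is applied to the semigroup operators
themselves, to the embedding `L` and to its adjoint. -/
theorem map_conv (hT : 0 ≤ T) (hS : IsNilpotentSemigroup T S) (hS' : IsNilpotentSemigroup T S')
    (hk : IntervalIntegrable k volume 0 T) (A : X →L[ℝ] Y)
    (hA : ∀ r, 0 ≤ r → ∀ x, A (S r x) = S' r (A x)) (x : X) :
    A (hS.conv hk x) = hS'.conv hk (A x) := by
  rw [conv_apply, conv_apply, ← A.intervalIntegral_comp_comm (hS.intervalIntegrable hk x)]
  refine intervalIntegral.integral_congr fun r hr => ?_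
  rw [uIcc_of_le hT] at hr
  simp only [map_smul, hA r hr.1]

theorem inner_conv (hS : IsNilpotentSemigroup T S) (hk : IntervalIntegrable k volume 0 T)
    (x y : X) : inner ℝ y (hS.conv hk x) = ∫ r in (0 : ℝ)..T, k r * inner ℝ y (S r x) := by
  rw [conv_apply]
  have := (innerSL ℝ y).intervalIntegral_comp_comm (hS.intervalIntegrable hk x)
  simpa [inner_smul_right] using this.symm

theorem conv_comm_apply (hT : 0 ≤ T) (hS : IsNilpotentSemigroup T S)
    (hk : IntervalIntegrable k volume 0 T) {s : ℝ} (hs : 0 ≤ s) (x : X) :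
    S s (hS.conv hk x) = hS.conv hk (S s x) :=
  map_conv hT hS hS hk (S s) (fun r hr x => by rw [hS.add _ _ hs hr, hS.add _ _ hr hs, add_comm]) x

/-- The primitive `∫_0^T S_r dr`. -/
noncomputable def prim (hS : IsNilpotentSemigroup T S) : X →L[ℝ] X :=
  hS.conv (k := fun _ => 1) intervalIntegrable_const

theorem prim_apply (hS : IsNilpotentSemigroup T S) (x : X) :
    hS.prim x = ∫ r in (0 : ℝ)..T, S r x := by
  simp [prim, conv_apply]

/-- `S r` turns the integral over `(0, T)` into one over `(r, T + r)`, and orbits vanish from `T`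
on. So `prim` inverts the negative generator. -/
theorem prim_sub (hS : IsNilpotentSemigroup T S) {r : ℝ} (hr : 0 ≤ r) (hrT : r ≤ T) (x : X) :
    hS.prim x - S r (hS.prim x) = ∫ ρ in (0 : ℝ)..r, S ρ x := by
  have hi : ∀ a b, IntervalIntegrable (fun r => S r x) volume a b := fun a b =>
    (hS.cont x).intervalIntegrable a b
  have h1 : S r (hS.prim x) = ∫ ρ in r..T, S ρ x := by
    rw [prim_apply, ← (S r).intervalIntegral_comp_comm (hi 0 T)]
    have h2 : ∫ ρ in (0 : ℝ)..T, S r (S ρ x) = ∫ ρ in (0 : ℝ)..T, S (ρ + r) x := by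
      refine intervalIntegral.integral_congr fun ρ hρ => ?_
      rw [uIcc_of_le (hr.trans hrT)] at hρ
      exact (hS.add _ _ hr hρ.1 x).trans (by rw [add_comm])
    rw [h2, intervalIntegral.integral_comp_add_right (fun ρ => S ρ x), zero_add,
      ← intervalIntegral.integral_add_adjacent_intervals (hi r T) (hi T (T + r))]
    have h3 : ∫ ρ in T..(T + r), S ρ x = 0 := by
      rw [intervalIntegral.integral_congr (g := fun _ => 0)]
      · simp
      · intro ρ hρ
        rw [uIcc_of_le (by linarith)] at hρ
        exact hS.eq_zero ρ hρ.1 x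
    rw [h3, add_zero]
  rw [h1, prim_apply, sub_eq_iff_eq_add, intervalIntegral.integral_add_adjacent_intervals
    (hi 0 r) (hi r T)]

/-- The averages `r⁻¹ ∫_0^r S_ρ x dρ` converge to `x`. -/
theorem tendsto_average (hS : IsNilpotentSemigroup T S) (x : X) :
    Tendsto (fun r : ℝ => r⁻¹ • ∫ ρ in (0 : ℝ)..r, S ρ x) (𝓝[>] 0) (𝓝 x) := by
  have h : HasDerivAt (fun r => ∫ ρ in (0 : ℝ)..r, S ρ x) (S 0 x) 0 :=
    intervalIntegral.integral_hasDerivAt_right ((hS.cont x).intervalIntegrable _ _)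
      (hS.cont x).stronglyMeasurable.stronglyMeasurableAtFilter (hS.cont x).continuousAt
  have := h.tendsto_slope_zero_right
  simpa [hS.zero x] using this

/-- Expanding the square, this is `‖S r x‖ ≤ ‖x‖`. It is the only source of positivity in the time
variable. -/
theorem norm_sub_sq_le (hS : IsNilpotentSemigroup T S) (r : ℝ) (x : X) :
    ‖x - S r x‖ ^ 2 ≤ 2 * inner ℝ x (x - S r x) := by
  have h1 := hS.norm_le r x
  have h2 : ‖S r x‖ ^ 2 ≤ ‖x‖ ^ 2 := by gcongr
  rw [norm_sub_sq_real, inner_sub_right, real_inner_self_eq_norm_sq]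
  linarith

/-- The kernel `r ^ (-α)` is integrable. -/
theorem _root_.Subdiffusion.intervalIntegrable_rpow_neg {α : ℝ} (hα : α < 1) (T : ℝ) :
    IntervalIntegrable (fun r : ℝ => r ^ (-α)) volume 0 T :=
  intervalIntegral.intervalIntegrable_rpow' (by linarith)

/-- The hypothesis says that `ψ` is the adjoint primitive of `η`; the identity is `prim_sub`
transported to the adjoint side. -/
theorem integral_inner_eq (hS : IsNilpotentSemigroup T S) {η ψ : X}
    (hψ : ∀ y, inner ℝ η (hS.prim y) = inner ℝ ψ y) {r : ℝ} (hr : r ∈ Icc 0 T) (y : X) :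
    ∫ ρ in (0 : ℝ)..r, inner ℝ η (S ρ y) = inner ℝ ψ (y - S r y) := by
  have h1 := (innerSL ℝ η).intervalIntegral_comp_comm (μ := volume)
    ((hS.cont y).intervalIntegrable 0 r)
  simp only [innerSL_apply_apply] at h1
  rw [h1, ← hS.prim_sub hr.1 hr.2, prim, conv_comm_apply (hr.1.trans hr.2) hS _ hr.1, ← map_sub]
  exact hψ _

/-- Positivity of the fractional derivative, backward version. -/
theorem rpow_mul_norm_sq_le_inner_backward (hT : 0 < T) (hS : IsNilpotentSemigroup T S) {α : ℝ}
    (hα0 : 0 < α) (hα1 : α < 1) {η ψ : X} (hψ : ∀ y, inner ℝ η (hS.prim y) = inner ℝ ψ y) :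
    T ^ (-α) * ‖ψ‖ ^ 2 ≤ inner ℝ η (hS.conv (intervalIntegrable_rpow_neg hα1 T) ψ) := by
  have h := rpow_neg_mul_integral_le (c := fun r => inner ℝ η (S r ψ))
    (continuous_const.inner (hS.cont ψ)) hT hα0 hα1 fun r hr => by
      rw [hS.integral_inner_eq hψ hr]
      have := hS.norm_sub_sq_le r ψ
      nlinarith [sq_nonneg ‖ψ - S r ψ‖]
  rw [hS.integral_inner_eq hψ (right_mem_Icc.2 hT.le), hS.eq_zero T le_rfl, sub_zero,
    real_inner_self_eq_norm_sq, ← inner_conv hS (intervalIntegrable_rpow_neg hα1 T)] at h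
  exact h

/-- Positivity of the fractional derivative, forward version. -/
theorem rpow_mul_norm_sq_le_inner_forward (hT : 0 < T) (hS : IsNilpotentSemigroup T S) {α : ℝ}
    (hα0 : 0 < α) (hα1 : α < 1) (η : X) :
    T ^ (-α) * ‖hS.prim η‖ ^ 2 ≤
      inner ℝ (hS.conv (intervalIntegrable_rpow_neg hα1 T) η) (hS.prim η) := by
  set w := hS.prim η with hw
  have hint : ∀ r ∈ Icc 0 T, ∫ ρ in (0 : ℝ)..r, inner ℝ w (S ρ η) = inner ℝ w (w - S r w) := by
    intro r hr
    have h1 := (innerSL ℝ w).intervalIntegral_comp_comm (μ := volume)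
      ((hS.cont η).intervalIntegrable 0 r)
    simp only [innerSL_apply_apply] at h1
    rw [h1, ← hS.prim_sub hr.1 hr.2]
  have h := rpow_neg_mul_integral_le (c := fun r => inner ℝ w (S r η))
    (continuous_const.inner (hS.cont η)) hT hα0 hα1 fun r hr => by
      rw [hint r hr]
      have := hS.norm_sub_sq_le r w
      nlinarith [sq_nonneg ‖w - S r w‖]
  rw [hint T (right_mem_Icc.2 hT.le), hS.eq_zero T le_rfl, sub_zero, real_inner_self_eq_norm_sq,
    ← inner_conv hS (intervalIntegrable_rpow_neg hα1 T)] at h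
  rwa [real_inner_comm]

/-- The contribution of the initial value is controlled by the energy. -/
theorem inner_conv_sq_le (hT : 0 < T) (hS : IsNilpotentSemigroup T S) {α : ℝ}
    (hα0 : 0 < α) (hα1 : α < 1) {η ψ : X} (hψ : ∀ y, inner ℝ η (hS.prim y) = inner ℝ ψ y)
    {x : X} {m : ℝ} (horth : ∀ r ∈ Icc 0 T, ∀ y, inner ℝ (x - S r x) (S r y) = 0)
    (hx : ∀ r ∈ Icc 0 T, ‖x - S r x‖ ^ 2 ≤ r * m) :
    inner ℝ η (hS.conv (intervalIntegrable_rpow_neg hα1 T) x) ^ 2 ≤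
      2 * m * (∫ r in (0 : ℝ)..T, r ^ (-α)) *
        inner ℝ η (hS.conv (intervalIntegrable_rpow_neg hα1 T) ψ) := by
  set κ := ∫ r in (0 : ℝ)..T, r ^ (-α)
  set k := intervalIntegrable_rpow_neg hα1 T
  set E := inner ℝ η (hS.conv k ψ)
  set F := inner ℝ η (hS.conv k x)
  -- A quadratic polynomial in `t` that is nonnegative everywhere has nonpositive discriminant,
  -- which is the claim. Nonnegativity comes from the kernel inequality for `⟪η, S_ρ ψ⟫ + t ⟪η, S_ρ
  -- x⟫ + t² m / 2`.
  have key : ∀ t : ℝ, 0 ≤ (m * κ / 2) * (t * t) + F * t + E := by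
    intro t
    have c1 : Continuous fun r => inner ℝ η (S r ψ) := continuous_const.inner (hS.cont ψ)
    have c2 : Continuous fun r => inner ℝ η (S r x) := continuous_const.inner (hS.cont x)
    have hC : ∀ r ∈ Icc 0 T, 0 ≤ ∫ ρ in (0 : ℝ)..r,
        (inner ℝ η (S ρ ψ) + t * inner ℝ η (S ρ x) + t ^ 2 * m / 2) := by
      intro r hr
      have c3 : Continuous fun r => t * inner ℝ η (S r x) := c2.const_mul t
      have c4 : Continuous fun r => inner ℝ η (S r ψ) + t * inner ℝ η (S r x) := c1.add c3
      rw [intervalIntegral.integral_add (c4.intervalIntegrable _ _)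
        intervalIntegrable_const, intervalIntegral.integral_add (c1.intervalIntegrable _ _)
        (c3.intervalIntegrable _ _), intervalIntegral.integral_const_mul,
        hS.integral_inner_eq hψ hr, hS.integral_inner_eq hψ hr, intervalIntegral.integral_const]
      have h1 := hS.norm_sub_sq_le r ψ
      -- Orthogonality replaces `ψ` by `ψ - S r ψ`. The primitive then dominates half of `‖(ψ - S r
      -- ψ) + t (x - S r x)‖²`; the term `r t² m / 2` pays for `‖x - S r x‖²`.
      have h2 : inner ℝ ψ (x - S r x) = inner ℝ (ψ - S r ψ) (x - S r x) := by
        rw [inner_sub_left, real_inner_comm _ (S r ψ), horth r hr, sub_zero]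
      have h3 := hx r hr
      have h4 : 0 ≤ ‖(ψ - S r ψ) + t • (x - S r x)‖ ^ 2 := sq_nonneg _
      rw [norm_add_sq_real, norm_smul, inner_smul_right, mul_pow, Real.norm_eq_abs, sq_abs] at h4
      have h5 : t ^ 2 * ‖x - S r x‖ ^ 2 ≤ t ^ 2 * (r * m) :=
        mul_le_mul_of_nonneg_left h3 (sq_nonneg t)
      rw [h2, smul_eq_mul]
      linarith
    have h := rpow_neg_mul_integral_le (((c1.add (c2.const_mul t)).add continuous_const))
      hT hα0 hα1 hC
    have h0 : 0 ≤ T ^ (-α) * ∫ ρ in (0 : ℝ)..T,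
        (inner ℝ η (S ρ ψ) + t * inner ℝ η (S ρ x) + t ^ 2 * m / 2) :=
      mul_nonneg (Real.rpow_nonneg hT.le _) (hC T (right_mem_Icc.2 hT.le))
    have h1 : ∫ r in (0 : ℝ)..T, r ^ (-α) *
        (inner ℝ η (S r ψ) + t * inner ℝ η (S r x) + t ^ 2 * m / 2) =
        E + t * F + κ * (t ^ 2 * m / 2) := by
      have e1 : E = _ := hS.inner_conv k ψ η
      have e2 : F = _ := hS.inner_conv k x η
      rw [e1, e2, ← intervalIntegral.integral_const_mul, ← intervalIntegral.integral_mul_const,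
        ← intervalIntegral.integral_add (k.mul_continuousOn c1.continuousOn)
          ((k.mul_continuousOn c2.continuousOn).const_mul t),
        ← intervalIntegral.integral_add ((k.mul_continuousOn c1.continuousOn).add
          ((k.mul_continuousOn c2.continuousOn).const_mul t)) (k.mul_const _)]
      exact intervalIntegral.integral_congr fun r _ => by ring
    have := h0.trans h
    simp only [Pi.add_apply] at this
    rw [h1] at this
    linarith
  have := discrim_le_zero key
  rw [discrim] at this
  linarith

end IsNilpotentSemigroup

end Semigroup

/-! ### Solvability by duality -/

section Lions

variable {X : Type*} [NormedAddCommGroup X] [InnerProductSpace ℝ X] [CompleteSpace X]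

/-- A vector `y` belongs to the range of `M` if `⟪y, ·⟫` is dominated by `‖M† ·‖`. -/
theorem mem_range_of_inner_le_adjoint (M : X →L[ℝ] X) (y : X) (C : ℝ)
    (h : ∀ x, |inner ℝ y x| ≤ C * ‖ContinuousLinearMap.adjoint M x‖) : ∃ u, M u = y := by
  set A : X →ₗ[ℝ] X := (ContinuousLinearMap.adjoint M).toLinearMap with hA
  obtain ⟨s, hs⟩ := A.rangeRestrict.exists_rightInverse_of_surjective A.range_rangeRestrict
  have hs' : ∀ z : LinearMap.range A, ContinuousLinearMap.adjoint M (s z) = z := fun z => by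
    have := LinearMap.congr_fun hs z
    simpa [hA] using congrArg Subtype.val this
  -- On the range of `M†` this is the functional `M† x ↦ ⟪y, x⟫`. The section `s` is only algebraic;
  -- boundedness comes from the hypothesis. After a Hahn-Banach extension the Riesz representative
  -- solves `M u = y`.
  let ℓ : LinearMap.range A →L[ℝ] ℝ :=
    LinearMap.mkContinuous ((innerSL ℝ y : X →L[ℝ] ℝ).toLinearMap.comp s) C fun z => by
      have := h (s z)
      rw [hs'] at this
      simpa using this
  obtain ⟨g, hg, -⟩ := exists_extension_norm_eq _ ℓ
  refine ⟨(InnerProductSpace.toDual ℝ X).symm g, ?_⟩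
  refine ext_inner_right ℝ fun x => ?_
  rw [← ContinuousLinearMap.adjoint_inner_right, InnerProductSpace.toDual_symm_apply]
  have h1 := hg ⟨A x, LinearMap.mem_range_self A x⟩
  -- The choice of preimage is immaterial, since the hypothesis forces `⟪y, ·⟫` to vanish on the
  -- kernel of `M†`.
  have h2 : inner ℝ y (s ⟨A x, LinearMap.mem_range_self A x⟩) = inner ℝ y x := by
    rw [← sub_eq_zero, ← inner_sub_right, ← abs_nonpos_iff]
    refine (h _).trans ?_
    rw [map_sub, hs']
    simp [hA]
  rw [← h2]
  exact h1

end Lions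

/-! ### Stability and existence for the abstract fractional equation -/

section Solver

variable {V H : Type*} [NormedAddCommGroup V] [InnerProductSpace ℝ V] [CompleteSpace V]
  [NormedAddCommGroup H] [InnerProductSpace ℝ H] [CompleteSpace H]
  {T : ℝ} {S : ℝ → V →L[ℝ] V} {S' : ℝ → H →L[ℝ] H}

open ContinuousLinearMap (adjoint)

/-- Positivity of the fractional derivative in the weak setting. -/
theorem rpow_mul_norm_sq_le_inner (hT : 0 < T) (hS : IsNilpotentSemigroup T S)
    (hS' : IsNilpotentSemigroup T S') {α : ℝ} (hα0 : 0 < α) (hα1 : α < 1) (L : V →L[ℝ] H)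
    (hL : ∀ r, 0 ≤ r → ∀ v, L (S r v) = S' r (L v))
    (hL' : ∀ r, 0 ≤ r → ∀ x, adjoint L (S' r x) = S r (adjoint L x)) {w g : V}
    (h : adjoint L (hS'.conv (intervalIntegrable_rpow_neg hα1 T) (L w)) = hS.prim g) :
    T ^ (-α) * ‖L w‖ ^ 2 ≤ inner ℝ g w := by
  set k := intervalIntegrable_rpow_neg hα1 T
  let A : ℝ → V → V := fun r v => r⁻¹ • ∫ ρ in (0 : ℝ)..r, S ρ v
  have key : ∀ r ∈ Ioo 0 T, T ^ (-α) * ‖L (A r w)‖ ^ 2 ≤ inner ℝ (A r g) (A r w) := by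
    intro r hr
    -- The vector `w` need not be a primitive, but its average `A r w` is the primitive of this
    -- difference quotient. Averaging the equation in the same way puts `A r g` on the right, and
    -- then `r → 0`.
    set η : V := r⁻¹ • (w - S r w)
    have h1 : hS.prim η = A r w := by
      simp only [η, A, map_smul, map_sub]
      rw [← hS.prim_sub hr.1.le hr.2.le w]
      simp only [IsNilpotentSemigroup.prim]
      rw [hS.conv_comm_apply hT.le _ hr.1.le]
    have h2 : hS'.prim (L η) = L (A r w) := by
      rw [← h1]
      exact (IsNilpotentSemigroup.map_conv hT.le hS hS' _ L hL η).symm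
    have h3 : adjoint L (hS'.conv k (L η)) = A r g := by
      simp only [η, A, map_smul, map_sub]
      rw [h, hL r hr.1.le, ← hS'.conv_comm_apply hT.le _ hr.1.le, hL' r hr.1.le, h,
        ← hS.prim_sub hr.1.le hr.2.le g]
    have h4 := hS'.rpow_mul_norm_sq_le_inner_forward hT hα0 hα1 (L η)
    rwa [h2, ← ContinuousLinearMap.adjoint_inner_left, h3] at h4
  have t1 := hS.tendsto_average w
  have t2 := hS.tendsto_average g
  refine le_of_tendsto_of_tendsto ((((L.continuous.tendsto w).comp t1).norm.pow 2).const_mul _)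
    (t2.inner t1) ?_
  filter_upwards [Ioo_mem_nhdsGT hT] with r hr using key r hr

/-- The stability estimate. -/
theorem norm_le_of_fractional_eq (hT : 0 < T) (hS : IsNilpotentSemigroup T S)
    (hS' : IsNilpotentSemigroup T S') {α : ℝ} (hα0 : 0 < α) (hα1 : α < 1) (L : V →L[ℝ] H)
    (hL : ∀ r, 0 ≤ r → ∀ v, L (S r v) = S' r (L v))
    (hL' : ∀ r, 0 ≤ r → ∀ x, adjoint L (S' r x) = S r (adjoint L x)) {a c₀ : ℝ} (ha : 0 < a)
    (hc₀ : 0 < c₀) {B : V →L[ℝ] V} (hB0 : ∀ v, 0 ≤ inner ℝ (B v) v)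
    (hB : ∀ v, c₀ * ‖v‖ ^ 2 ≤ inner ℝ (B v) v + c₀ * ‖L v‖ ^ 2) {w e : V}
    (h : adjoint L (a • hS'.conv (intervalIntegrable_rpow_neg hα1 T) (L w)) =
      hS.prim (e - B w)) :
    min c₀ (a * T ^ (-α)) * ‖w‖ ≤ ‖e‖ := by
  set c := min c₀ (a * T ^ (-α))
  have h1 : T ^ (-α) * ‖L w‖ ^ 2 ≤ inner ℝ (a⁻¹ • (e - B w)) w := by
    refine rpow_mul_norm_sq_le_inner hT hS hS' hα0 hα1 L hL hL' ?_
    rw [map_smul, ← h, ← map_smul, smul_smul, inv_mul_cancel₀ ha.ne', one_smul]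
  rw [real_inner_smul_left, inner_sub_left, ← div_eq_inv_mul, le_div_iff₀ ha] at h1
  have h2 : inner ℝ e w ≤ ‖e‖ * ‖w‖ := real_inner_le_norm _ _
  have hcpos : 0 < c := lt_min hc₀ (mul_pos ha (Real.rpow_pos_of_pos hT _))
  -- The coercivity estimate is scaled by `c / c₀ ≤ 1`; since `B` is nonnegative its term may be
  -- kept in full.
  have h3 : c * ‖w‖ ^ 2 ≤ inner ℝ (B w) w + c * ‖L w‖ ^ 2 := by
    have h4 : c / c₀ ≤ 1 := (div_le_one hc₀).2 (min_le_left _ _)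
    have h5 := mul_le_mul_of_nonneg_left (hB w) (div_pos hcpos hc₀).le
    have h6 := mul_le_mul_of_nonneg_right h4 (hB0 w)
    rw [mul_add, ← mul_assoc, ← mul_assoc, div_mul_cancel₀ _ hc₀.ne'] at h5
    linarith
  have h4 : c * ‖L w‖ ^ 2 ≤ a * T ^ (-α) * ‖L w‖ ^ 2 :=
    mul_le_mul_of_nonneg_right (min_le_right _ _) (sq_nonneg _)
  have h5 : c * ‖w‖ * ‖w‖ ≤ ‖e‖ * ‖w‖ := by nlinarith
  rcases (norm_nonneg w).eq_or_lt with h6 | h6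
  · rw [← h6, mul_zero]
    exact norm_nonneg e
  · exact le_of_mul_le_mul_right h5 h6

/-- Existence for the abstract fractional evolution equation. -/
theorem exists_fractional_eq (hT : 0 < T) (hS : IsNilpotentSemigroup T S)
    (hS' : IsNilpotentSemigroup T S') {α : ℝ} (hα0 : 0 < α) (hα1 : α < 1) (L : V →L[ℝ] H)
    (hL' : ∀ r, 0 ≤ r → ∀ x, adjoint L (S' r x) = S r (adjoint L x)) {a c₀ : ℝ} (ha : 0 < a)
    (hc₀ : 0 < c₀) {B : V →L[ℝ] V} (hB0 : ∀ v, 0 ≤ inner ℝ (B v) v)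
    (hB : ∀ v, c₀ * ‖v‖ ^ 2 ≤ inner ℝ (B v) v + c₀ * ‖L v‖ ^ 2) (f : V)
    {x : H} {m : ℝ} (hm : 0 ≤ m)
    (horth : ∀ r ∈ Icc 0 T, ∀ y, inner ℝ (x - S' r x) (S' r y) = 0)
    (hx : ∀ r ∈ Icc 0 T, ‖x - S' r x‖ ^ 2 ≤ r * m) :
    ∃ u, adjoint L (a • hS'.conv (intervalIntegrable_rpow_neg hα1 T) (L u - x)) =
      hS.prim (f - B u) := by
  set k := intervalIntegrable_rpow_neg hα1 T
  set K := hS'.conv k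
  set κ := ∫ r in (0 : ℝ)..T, r ^ (-α)
  have hκ : 0 ≤ κ := intervalIntegral.integral_nonneg hT.le fun r hr => Real.rpow_nonneg hr.1 _
  -- Half of the fractional energy `a E` is used for coercivity. The other half stays on the left to
  -- bound `E` itself.
  set c := min c₀ (a / 2 * T ^ (-α))
  have hcpos : 0 < c := lt_min hc₀ (mul_pos (half_pos ha) (Real.rpow_pos_of_pos hT _))
  let M : V →L[ℝ] V := a • (adjoint L ∘L K ∘L L) + hS.prim ∘L B
  suffices h : ∃ u, M u = hS.prim f + a • adjoint L (K x) by
    obtain ⟨u, hu⟩ := h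
    refine ⟨u, ?_⟩
    simp only [M, add_apply, smul_apply,
      ContinuousLinearMap.comp_apply] at hu
    rw [map_smul, map_sub, map_sub, map_sub, smul_sub, sub_eq_sub_iff_add_eq_add, hu]
  -- The first summand of the constant accounts for `f`, the second for the initial value.
  refine mem_range_of_inner_le_adjoint M _
    (‖f‖ * c⁻¹ + a * Real.sqrt (2 * m * κ * (2 / (a * c)))) fun h => ?_
  set D := ‖adjoint M h‖
  -- Testing `M† h` with the backward primitive of `h` produces `a E + ⟪B ψ, ψ⟫`, both of whose
  -- terms are nonnegative.
  set ψ := adjoint hS.prim h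
  set E := inner ℝ (L h) (K (L ψ))
  have hψ : ∀ y, inner ℝ (L h) (hS'.prim y) = inner ℝ (L ψ) y := by
    intro y
    rw [← ContinuousLinearMap.adjoint_inner_right, IsNilpotentSemigroup.prim,
      IsNilpotentSemigroup.map_conv hT.le hS' hS _ (adjoint L) hL',
      ← ContinuousLinearMap.adjoint_inner_right L, ContinuousLinearMap.adjoint_inner_left]
    rfl
  have hE := hS'.rpow_mul_norm_sq_le_inner_backward hT hα0 hα1 hψ
  have hF := hS'.inner_conv_sq_le hT hα0 hα1 hψ horth hx
  change T ^ (-α) * ‖L ψ‖ ^ 2 ≤ E at hE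
  change inner ℝ (L h) (K x) ^ 2 ≤ 2 * m * κ * E at hF
  have hD : inner ℝ (adjoint M h) ψ = a * E + inner ℝ (B ψ) ψ := by
    rw [ContinuousLinearMap.adjoint_inner_left]
    simp only [M, add_apply, smul_apply,
      ContinuousLinearMap.comp_apply, inner_add_right, inner_smul_right]
    rw [ContinuousLinearMap.adjoint_inner_right, real_inner_comm ψ,
      ← ContinuousLinearMap.adjoint_inner_left hS.prim]
  have hD' : inner ℝ (adjoint M h) ψ ≤ D * ‖ψ‖ := real_inner_le_norm _ _
  have hE0 : 0 ≤ E := (mul_nonneg (Real.rpow_nonneg hT.le _) (sq_nonneg _)).trans hE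
  have h3 : c * ‖ψ‖ ^ 2 ≤ inner ℝ (B ψ) ψ + c * ‖L ψ‖ ^ 2 := by
    have h4 : c / c₀ ≤ 1 := (div_le_one hc₀).2 (min_le_left _ _)
    have h5 := mul_le_mul_of_nonneg_left (hB ψ) (div_pos hcpos hc₀).le
    have h6 := mul_le_mul_of_nonneg_right h4 (hB0 ψ)
    rw [mul_add, ← mul_assoc, ← mul_assoc, div_mul_cancel₀ _ hc₀.ne'] at h5
    linarith
  have h4 : c * ‖L ψ‖ ^ 2 ≤ a / 2 * T ^ (-α) * ‖L ψ‖ ^ 2 :=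
    mul_le_mul_of_nonneg_right (min_le_right _ _) (sq_nonneg _)
  have h5 : c * ‖ψ‖ ^ 2 + a / 2 * E ≤ D * ‖ψ‖ := by nlinarith
  have hψD : ‖ψ‖ ≤ c⁻¹ * D := by
    rw [← div_eq_inv_mul, le_div_iff₀ hcpos]
    rcases (norm_nonneg ψ).eq_or_lt with h6 | h6
    · rw [← h6, zero_mul]
      exact norm_nonneg _
    · refine le_of_mul_le_mul_right ?_ h6
      nlinarith
  have hED : E ≤ 2 / (a * c) * D ^ 2 := by
    have h6 : a / 2 * E ≤ D * (c⁻¹ * D) := by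
      have := mul_le_mul_of_nonneg_left hψD (norm_nonneg (adjoint M h))
      nlinarith [mul_nonneg hcpos.le (sq_nonneg ‖ψ‖)]
    have h7 := mul_le_mul_of_nonneg_left h6 (div_pos two_pos ha).le
    calc E = 2 / a * (a / 2 * E) := by field_simp
      _ ≤ 2 / a * (D * (c⁻¹ * D)) := h7
      _ = _ := by field_simp
  -- The initial value is paired with `h`, which is not bounded by `‖M† h‖`. The pairing is
  -- therefore controlled through the energy `E`, which is at most a multiple of `D²`.
  have hFD : |inner ℝ (L h) (K x)| ≤ Real.sqrt (2 * m * κ * (2 / (a * c))) * D := by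
    refine abs_le_of_sq_le_sq ?_ (by positivity)
    rw [mul_pow, Real.sq_sqrt (by positivity)]
    refine hF.trans ?_
    rw [mul_assoc (2 * m * κ)]
    exact mul_le_mul_of_nonneg_left hED (by positivity)
  have h8 : inner ℝ (hS.prim f + a • adjoint L (K x)) h =
      inner ℝ f ψ + a * inner ℝ (L h) (K x) := by
    rw [inner_add_left, real_inner_smul_left, ContinuousLinearMap.adjoint_inner_left,
      real_inner_comm (L h), ContinuousLinearMap.adjoint_inner_right]
  rw [h8]
  calc |inner ℝ f ψ + a * inner ℝ (L h) (K x)|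
      ≤ |inner ℝ f ψ| + |a * inner ℝ (L h) (K x)| := abs_add_le _ _
    _ ≤ ‖f‖ * (c⁻¹ * D) + a * (Real.sqrt (2 * m * κ * (2 / (a * c))) * D) := by
        refine add_le_add ((abs_real_inner_le_norm _ _).trans ?_) ?_
        · exact mul_le_mul_of_nonneg_left hψD (norm_nonneg f)
        · rw [abs_mul, abs_of_pos ha]
          exact mul_le_mul_of_nonneg_left hFD ha.le
    _ = _ := by ring

end Solver

/-! ### Right shifts on `L²(0,T;X)` -/

section Shift

variable {X Y : Type*} [NormedAddCommGroup X] [InnerProductSpace ℝ X]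
  [NormedAddCommGroup Y] [InnerProductSpace ℝ Y]

/-- Extension by zero as an isometry of `L²` spaces. -/
noncomputable def zeroExtend (s : Set ℝ) (hs : MeasurableSet s) :
    Lp X 2 (volume.restrict s) →ₗᵢ[ℝ] Lp X 2 (volume : Measure ℝ) where
  toFun v := ((memLp_indicator_iff_restrict hs).2 (Lp.memLp v)).toLp (s.indicator v)
  map_add' v w := by
    rw [← MemLp.toLp_add]
    refine (MemLp.toLp_eq_toLp_iff _ _).2 ?_
    refine EventuallyEq.trans ?_ (EventuallyEq.of_eq (indicator_add _ _ _))
    exact (ae_eq_restrict_iff_indicator_ae_eq hs).1 (Lp.coeFn_add v w)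
  map_smul' a v := by
    rw [RingHom.id_apply, ← MemLp.toLp_const_smul]
    refine (MemLp.toLp_eq_toLp_iff _ _).2 ?_
    have := (ae_eq_restrict_iff_indicator_ae_eq hs).1 (Lp.coeFn_smul a v)
    rw [Pi.smul_def, indicator_const_smul] at this
    exact this
  norm_map' v := by
    change ‖((memLp_indicator_iff_restrict hs).2 (Lp.memLp v)).toLp (s.indicator v)‖ = ‖v‖
    rw [Lp.norm_toLp, eLpNorm_indicator_eq_eLpNorm_restrict hs, ← Lp.norm_def]

theorem zeroExtend_apply (s : Set ℝ) (hs : MeasurableSet s) (v : Lp X 2 (volume.restrict s)) :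
    zeroExtend s hs v = ((memLp_indicator_iff_restrict hs).2 (Lp.memLp v)).toLp (s.indicator v) :=
  rfl

theorem coeFn_zeroExtend (s : Set ℝ) (hs : MeasurableSet s) (v : Lp X 2 (volume.restrict s)) :
    zeroExtend s hs v =ᵐ[volume] s.indicator v := by
  rw [zeroExtend_apply]
  exact MemLp.coeFn_toLp _

/-- The right shift by `r` on `L²(0,T;X)`. -/
noncomputable def shift (T r : ℝ) :
    Lp X 2 (timeMeasure T) →L[ℝ] Lp X 2 (timeMeasure T) :=
  (LpToLpRestrictCLM ℝ X ℝ volume 2 (Ioo 0 T)).comp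
    ((Lp.compMeasurePreservingₗᵢ ℝ (fun t : ℝ => t - r)
      (measurePreserving_sub_right volume r)).toContinuousLinearMap.comp
      (zeroExtend (Ioo 0 T) measurableSet_Ioo).toContinuousLinearMap)

theorem coeFn_shift (T r : ℝ) (v : Lp X 2 (timeMeasure T)) :
    shift T r v =ᵐ[timeMeasure T] fun t => (Ioo 0 T).indicator v (t - r) := by
  refine (LpToLpRestrictCLM_coeFn ℝ (Ioo 0 T) _).trans (ae_restrict_of_ae ?_)
  refine (Lp.coeFn_compMeasurePreserving _ (measurePreserving_sub_right volume r)).trans ?_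
  exact (measurePreserving_sub_right volume r).quasiMeasurePreserving.ae_eq_comp
    (coeFn_zeroExtend (Ioo 0 T) measurableSet_Ioo v)

/-- Shifts are extension by zero, translation and restriction. Translation preserves the norm and is
strongly continuous in `L²`. For `r, s ≥ 0` the intermediate truncation loses nothing: mass pushed
beyond `T` never returns. -/
theorem isNilpotentSemigroup_shift (T : ℝ) :
    IsNilpotentSemigroup T (shift T : ℝ → Lp X 2 (timeMeasure T) →L[ℝ] Lp X 2 (timeMeasure T)) where
  norm_le r v := by
    change ‖LpToLpRestrictCLM ℝ X ℝ volume 2 (Ioo 0 T) (Lp.compMeasurePreserving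
      (fun t : ℝ => t - r) (measurePreserving_sub_right volume r)
      (zeroExtend (Ioo 0 T) measurableSet_Ioo v))‖ ≤ ‖v‖
    rw [← (zeroExtend (Ioo 0 T) measurableSet_Ioo).norm_map v,
      ← Lp.norm_compMeasurePreserving _ (measurePreserving_sub_right volume r)]
    exact norm_Lp_toLp_restrict_le _ _
  cont v := by
    refine (LpToLpRestrictCLM ℝ X ℝ volume 2 (Ioo 0 T)).continuous.comp ?_
    refine Continuous.compMeasurePreservingLp (f := fun _ => zeroExtend _ measurableSet_Ioo v)
      (g := fun r => (⟨fun t => t - r, by fun_prop⟩ : C(ℝ, ℝ))) continuous_const ?_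
      (fun r => measurePreserving_sub_right volume r) (by simp)
    exact ContinuousMap.continuous_of_continuous_uncurry _ (by
      simp only [Function.uncurry_def, ContinuousMap.coe_mk]; fun_prop)
  zero v := by
    refine Lp.ext ((coeFn_shift T 0 v).trans ?_)
    filter_upwards [ae_restrict_mem measurableSet_Ioo] with t ht
    rw [sub_zero, indicator_of_mem ht]
  add r s hr hs v := by
    refine Lp.ext ((coeFn_shift T r _).trans (EventuallyEq.trans ?_ (coeFn_shift T (r + s) v).symm))
    have h := (measurePreserving_sub_right volume r).quasiMeasurePreserving.ae
      ((ae_restrict_iff' measurableSet_Ioo).1 (coeFn_shift T s v))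
    filter_upwards [ae_restrict_mem measurableSet_Ioo, ae_restrict_of_ae h] with t ht h1
    by_cases h2 : t - r ∈ Ioo 0 T
    · rw [indicator_of_mem h2, h1 h2, sub_sub]
    · rw [indicator_of_notMem h2, indicator_of_notMem]
      intro h3
      exact h2 ⟨by linarith [h3.1], by linarith [ht.2]⟩
  eq_zero r hr v := by
    refine Lp.ext ((coeFn_shift T r v).trans (EventuallyEq.trans ?_ (Lp.coeFn_zero _ _ _).symm))
    filter_upwards [ae_restrict_mem measurableSet_Ioo] with t ht
    rw [indicator_of_notMem]
    · rfl
    · intro h3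
      linarith [h3.1, ht.2]

theorem compLpL_shift {T : ℝ} (L : X →L[ℝ] Y) (r : ℝ) (v : Lp X 2 (timeMeasure T)) :
    L.compLpL 2 (timeMeasure T) (shift T r v) = shift T r (L.compLpL 2 (timeMeasure T) v) := by
  refine Lp.ext ((L.coeFn_compLpL _).trans (EventuallyEq.trans ?_ (coeFn_shift T r _).symm))
  have h := (measurePreserving_sub_right volume r).quasiMeasurePreserving.ae
    ((ae_restrict_iff' measurableSet_Ioo).1 (L.coeFn_compLpL (μ := timeMeasure T) (p := 2) v))
  filter_upwards [coeFn_shift T r v, ae_restrict_of_ae h] with t h1 h2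
  rw [h1]
  by_cases h3 : t - r ∈ Ioo 0 T
  · rw [indicator_of_mem h3, indicator_of_mem h3, h2 h3]
  · rw [indicator_of_notMem h3, indicator_of_notMem h3, map_zero]

theorem adjoint_compLpL [CompleteSpace X] [CompleteSpace Y] {α : Type*} [MeasurableSpace α]
    (μ : Measure α) (L : X →L[ℝ] Y) :
    ContinuousLinearMap.adjoint (L.compLpL 2 μ) =
      (ContinuousLinearMap.adjoint L).compLpL 2 μ := by
  refine ((ContinuousLinearMap.eq_adjoint_iff _ _).2 fun y x => ?_).symm
  rw [L2.inner_def, L2.inner_def]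
  refine integral_congr_ae ?_
  filter_upwards [L.coeFn_compLpL x, (ContinuousLinearMap.adjoint L).coeFn_compLpL y] with a h1 h2
  rw [h1, h2, ContinuousLinearMap.adjoint_inner_left]

/-- The left side is an integral of `L²`-valued functions, the right side one at each fixed time.
They agree after pairing with `c · 1_A` for measurable `A`, by Fubini. -/
theorem coeFn_conv_shift [CompleteSpace X] {T : ℝ} (hT : 0 < T) {k : ℝ → ℝ}
    (hk : IntervalIntegrable k volume 0 T) (v : Lp X 2 (timeMeasure T)) :
    (isNilpotentSemigroup_shift T).conv hk v =ᵐ[timeMeasure T]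
      fun t => ∫ s in (0 : ℝ)..t, k (t - s) • v s := by
  set w : ℝ → X := (Ioo 0 T).indicator v
  have hk' : Integrable k (timeMeasure T) :=
    (intervalIntegrable_iff_integrableOn_Ioo_of_le hT.le).1 hk
  have hw : Integrable w volume :=
    (integrable_indicator_iff measurableSet_Ioo).2 ((Lp.memLp v).integrable (by norm_num))
  have hint := Integrable.convolution_integrand (ContinuousLinearMap.lsmul ℝ ℝ) hk' hw
  have hint2 : Integrable (fun p : ℝ × ℝ => k p.2 • w (p.1 - p.2))
      ((timeMeasure T).prod (timeMeasure T)) :=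
    hint.mono_measure (Measure.prod_mono Measure.restrict_le_self le_rfl)
  set F : ℝ → X := fun t => ∫ r, k r • w (t - r) ∂(timeMeasure T)
  have hF : Integrable F (timeMeasure T) := hint2.integral_prod_left
  have h1 : (isNilpotentSemigroup_shift T).conv hk v =ᵐ[timeMeasure T] F := by
    refine Integrable.ae_eq_of_forall_setIntegral_eq _ _ ((Lp.memLp _).integrable (by norm_num)) hF
      fun A hA hμA => ?_
    refine ext_inner_left ℝ fun c => ?_
    rw [← L2.inner_indicatorConstLp_eq_inner_setIntegral ℝ hA hμA.ne,
      IsNilpotentSemigroup.inner_conv]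
    have h2 : ∀ r, k r * inner ℝ (indicatorConstLp 2 hA hμA.ne c) (shift T r v) =
        inner ℝ c (∫ t in A, k r • w (t - r) ∂(timeMeasure T)) := by
      intro r
      rw [L2.inner_indicatorConstLp_eq_inner_setIntegral, integral_smul, inner_smul_right,
        setIntegral_congr_ae hA ((coeFn_shift T r v).mono fun t ht _ => ht)]
    simp only [h2]
    have hintA : Integrable (fun p : ℝ × ℝ => k p.2 • w (p.1 - p.2))
        (((timeMeasure T).restrict A).prod (timeMeasure T)) :=
      hint2.mono_measure (Measure.prod_mono Measure.restrict_le_self le_rfl)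
    rw [intervalIntegral.integral_of_le hT.le, integral_Ioc_eq_integral_Ioo]
    have h5 := integral_inner (𝕜 := ℝ) hintA.swap.integral_prod_left c
    simp only [Function.comp_apply, Prod.swap_prod_mk] at h5
    rw [h5]
    congr 1
    exact (integral_integral_swap (f := fun t r => k r • w (t - r)) hintA).symm
  refine h1.trans ?_
  filter_upwards [ae_restrict_mem measurableSet_Ioo] with t ht
  have h3 : ∫ s in (0 : ℝ)..t, k (t - s) • v s = ∫ s in (0 : ℝ)..t, k s • v (t - s) := by
    have := intervalIntegral.integral_comp_sub_left (a := 0) (b := t)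
      (fun s => k s • v (t - s)) t
    simpa using this
  rw [h3, intervalIntegral.integral_of_le ht.1.le, integral_Ioc_eq_integral_Ioo]
  change ∫ r in Ioo 0 T, k r • w (t - r) = _
  have h4 : Ioo 0 t ⊆ Ioo 0 T := Ioo_subset_Ioo_right ht.2.le
  rw [setIntegral_eq_of_subset_of_forall_sdiff_eq_zero measurableSet_Ioo h4]
  · refine setIntegral_congr_fun measurableSet_Ioo fun r hr => ?_
    simp only [w]
    rw [indicator_of_mem (s := Ioo 0 T)]
    exact ⟨by linarith [hr.2], by linarith [hr.1, ht.2]⟩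
  · intro r hr
    simp only [w]
    rw [indicator_of_notMem (s := Ioo 0 T), smul_zero]
    intro h5
    exact hr.2 ⟨hr.1.1, by linarith [h5.1]⟩

theorem coeFn_prim_shift [CompleteSpace X] {T : ℝ} (hT : 0 < T) (v : Lp X 2 (timeMeasure T)) :
    (isNilpotentSemigroup_shift T).prim v =ᵐ[timeMeasure T] fun t => ∫ s in (0 : ℝ)..t, v s := by
  have := coeFn_conv_shift hT (k := fun _ => 1) intervalIntegrable_const v
  simpa [IsNilpotentSemigroup.prim] using this

/-- A constant minus its shift lives on `t ≤ r`, while shifted functions live on `t > r`. This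
supplies the orthogonality and the bound `r ‖x‖²` needed for the initial value. -/
theorem coeFn_const_sub_shift {T r : ℝ} (hr : 0 ≤ r) (x : X) :
    (Lp.const 2 (timeMeasure T) x - shift T r (Lp.const 2 (timeMeasure T) x) :
      Lp X 2 (timeMeasure T)) =ᵐ[timeMeasure T] (Iic r).indicator fun _ => x := by
  have h := (measurePreserving_sub_right volume r).quasiMeasurePreserving.ae
    ((ae_restrict_iff' measurableSet_Ioo).1 (Lp.coeFn_const (p := 2) (μ := timeMeasure T) x))
  filter_upwards [Lp.coeFn_sub (Lp.const 2 (timeMeasure T) x)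
    (shift T r (Lp.const 2 (timeMeasure T) x)), coeFn_shift T r (Lp.const 2 (timeMeasure T) x),
    ae_restrict_of_ae h, Lp.coeFn_const (p := 2) (μ := timeMeasure T) x,
    ae_restrict_mem measurableSet_Ioo] with t h1 h2 h3 h4 ht
  rw [h1, Pi.sub_apply, h2, h4, Function.const_apply]
  by_cases h5 : t ≤ r
  · rw [indicator_of_notMem, indicator_of_mem (mem_Iic.2 h5), sub_zero]
    intro h6
    linarith [h6.1]
  · push Not at h5
    have h6 : t - r ∈ Ioo 0 T := ⟨by linarith, by linarith [ht.2]⟩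
    rw [indicator_of_mem h6, h3 h6, indicator_of_notMem (by simpa using h5), Function.const_apply,
      sub_self]

theorem inner_const_sub_shift {T r : ℝ} (hr : 0 ≤ r) (x : X) (y : Lp X 2 (timeMeasure T)) :
    inner ℝ (Lp.const 2 (timeMeasure T) x - shift T r (Lp.const 2 (timeMeasure T) x))
      (shift T r y) = 0 := by
  rw [L2.inner_def]
  refine (integral_congr_ae ?_).trans (integral_zero _ _)
  filter_upwards [coeFn_const_sub_shift (T := T) hr x, coeFn_shift T r y] with t h1 h2
  rw [h1, h2]
  by_cases h5 : t ≤ r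
  · rw [indicator_of_notMem (s := Ioo 0 T), inner_zero_right]
    intro h6
    linarith [h6.1]
  · rw [indicator_of_notMem (by simpa using h5), inner_zero_left]

theorem norm_const_sub_shift_sq_le {T r : ℝ} (hr : 0 ≤ r) (x : X) :
    ‖Lp.const 2 (timeMeasure T) x - shift T r (Lp.const 2 (timeMeasure T) x)‖ ^ 2 ≤
      r * ‖x‖ ^ 2 := by
  rw [← real_inner_self_eq_norm_sq, L2.inner_def]
  have h : ∫ t, inner ℝ
      ((Lp.const 2 (timeMeasure T) x - shift T r (Lp.const 2 (timeMeasure T) x) :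
        Lp X 2 (timeMeasure T)) t)
      ((Lp.const 2 (timeMeasure T) x - shift T r (Lp.const 2 (timeMeasure T) x) :
        Lp X 2 (timeMeasure T)) t) ∂(timeMeasure T) =
      ∫ t, (Iic r).indicator (fun _ => ‖x‖ ^ 2) t ∂(timeMeasure T) := by
    refine integral_congr_ae ?_
    filter_upwards [coeFn_const_sub_shift (T := T) hr x] with t h1
    rw [h1]
    by_cases h5 : t ≤ r
    · rw [indicator_of_mem (mem_Iic.2 h5), indicator_of_mem (mem_Iic.2 h5),
        real_inner_self_eq_norm_sq]
    · rw [indicator_of_notMem (by simpa using h5), indicator_of_notMem (by simpa using h5),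
        inner_zero_left]
  rw [h, integral_indicator measurableSet_Iic, setIntegral_const, smul_eq_mul]
  refine mul_le_mul_of_nonneg_right ?_ (sq_nonneg _)
  rw [Measure.real, Measure.restrict_apply measurableSet_Iic]
  refine ENNReal.toReal_le_of_le_ofReal hr ?_
  refine (measure_mono (t := Ioc 0 r) fun t ht => ⟨ht.2.1, ht.1⟩).trans ?_
  simp

end Shift

/-! ### Weak and strong measurability -/

section Measurability

variable {X : Type*} [NormedAddCommGroup X] [InnerProductSpace ℝ X] [SecondCountableTopology X]

/-- Weakly measurable functions with values in a separable Hilbert space are strongly measurable. -/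
theorem stronglyMeasurable_of_inner {α : Type*} [MeasurableSpace α] {F : α → X}
    (h : ∀ y, Measurable fun a => inner ℝ y (F a)) : StronglyMeasurable F := by
  borelize X
  have hnorm : ∀ a : X, Measurable fun t => ‖F t - a‖ := by
    intro a
    refine measurable_of_Iic fun r => ?_
    -- The norm is a supremum of inner products over a dense sequence. The clause `0 ≤ r` excludes
    -- negative `r`, for which testing with `F t - a = 0` gives no information.
    have h1 : (fun t => ‖F t - a‖) ⁻¹' Iic r =
        ⋂ n : ℕ, {t | inner ℝ (TopologicalSpace.denseSeq X n) (F t - a) ≤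
          r * ‖TopologicalSpace.denseSeq X n‖} ∩ {_t | 0 ≤ r} := by
      ext t
      simp only [mem_preimage, mem_Iic, mem_iInter, mem_inter_iff, mem_ofPred_eq]
      constructor
      · intro ht n
        refine ⟨(real_inner_le_norm _ _).trans ?_, (norm_nonneg _).trans ht⟩
        rw [mul_comm]
        exact mul_le_mul_of_nonneg_right ht (norm_nonneg _)
      · intro ht
        have h2 : ∀ y : X, inner ℝ y (F t - a) ≤ r * ‖y‖ := by
          intro y
          refine (TopologicalSpace.denseRange_denseSeq X).induction_on
            (p := fun y => inner ℝ y (F t - a) ≤ r * ‖y‖) y ?_ fun n => (ht n).1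
          exact isClosed_le (by fun_prop) (by fun_prop)
        have h3 := h2 (F t - a)
        rw [real_inner_self_eq_norm_sq] at h3
        by_contra! h4
        nlinarith [(ht 0).2]
    rw [h1]
    refine MeasurableSet.iInter fun n => MeasurableSet.inter ?_ (MeasurableSet.const _)
    refine measurableSet_le ?_ measurable_const
    simp only [inner_sub_right]
    exact (h _).sub_const _
  have hmeas : Measurable F := by
    refine measurable_of_isOpen fun U hU => ?_
    have h1 : F ⁻¹' U = ⋃ (n : ℕ) (m : ℕ)
        (_ : Metric.ball (TopologicalSpace.denseSeq X n) (1 / ((m : ℝ) + 1)) ⊆ U),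
        {t | ‖F t - TopologicalSpace.denseSeq X n‖ < 1 / ((m : ℝ) + 1)} := by
      ext t
      simp only [mem_preimage, mem_iUnion, mem_ofPred_eq, exists_prop]
      constructor
      · intro ht
        obtain ⟨ε, hε, hεU⟩ := Metric.isOpen_iff.1 hU _ ht
        obtain ⟨m, hm⟩ := exists_nat_one_div_lt (half_pos hε)
        obtain ⟨n, hn⟩ := (TopologicalSpace.denseRange_denseSeq X).exists_dist_lt (F t)
          (Nat.one_div_pos_of_nat (α := ℝ) (n := m))
        refine ⟨n, m, fun y hy => hεU ?_, by rwa [← dist_eq_norm]⟩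
        rw [Metric.mem_ball] at hy ⊢
        have := dist_triangle_right y (F t) (TopologicalSpace.denseSeq X n)
        linarith
      · rintro ⟨n, m, h2, h3⟩
        exact h2 (by rwa [Metric.mem_ball, dist_eq_norm])
    rw [h1]
    exact MeasurableSet.iUnion fun n => MeasurableSet.iUnion fun m => MeasurableSet.iUnion fun _ =>
      measurableSet_lt (hnorm _) measurable_const
  exact hmeas.stronglyMeasurable

end Measurability

/-! ### Multiplication by a space-time coefficient -/

section Multiplication

variable {A X : Type*} [MeasurableSpace A] {μ : Measure A} [SFinite μ]
  [NormedAddCommGroup X] [InnerProductSpace ℝ X]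

/-- Dominated convergence in `L²`. -/
theorem tendsto_L2_of_dominated {w : ℕ → Lp X 2 μ} {w' : Lp X 2 μ} {g : A → ℝ}
    (hg : MemLp g 2 μ) (hb : ∀ n, ∀ᵐ x ∂μ, ‖w n x‖ ≤ g x)
    (hlim : ∀ᵐ x ∂μ, Tendsto (fun n => w n x) atTop (𝓝 (w' x))) :
    Tendsto w atTop (𝓝 w') := by
  rw [tendsto_iff_norm_sub_tendsto_zero]
  have h1 : ∀ n, ‖w n - w'‖ ^ 2 = ∫ x, ‖w n x - w' x‖ ^ 2 ∂μ := by
    intro n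
    rw [← real_inner_self_eq_norm_sq, L2.inner_def]
    refine integral_congr_ae ?_
    filter_upwards [Lp.coeFn_sub (w n) w'] with x hx
    rw [hx, Pi.sub_apply, real_inner_self_eq_norm_sq]
  have hb' : ∀ᵐ x ∂μ, ∀ n, ‖w n x‖ ≤ g x := ae_all_iff.2 hb
  have h2 : Tendsto (fun n => ∫ x, ‖w n x - w' x‖ ^ 2 ∂μ) atTop (𝓝 (∫ _, (0 : ℝ) ∂μ)) := by
    refine tendsto_integral_of_dominated_convergence (fun x => (2 * g x) ^ 2) (fun n => ?_)
      (hg.const_mul 2).integrable_sq (fun n => ?_) ?_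
    · exact ((Lp.aestronglyMeasurable (w n)).sub (Lp.aestronglyMeasurable w')).norm.pow 2
    · filter_upwards [hb', hlim] with x hx1 hx2
      have h3 : ‖w' x‖ ≤ g x := le_of_tendsto hx2.norm (Eventually.of_forall hx1)
      rw [Real.norm_of_nonneg (sq_nonneg _)]
      have h4 := norm_sub_le (w n x) (w' x)
      have h5 := hx1 n
      gcongr
      linarith
    · filter_upwards [hlim] with x hx
      have := ((hx.sub_const (w' x)).norm).pow 2
      simpa using this
  rw [integral_zero] at h2
  simp only [← h1] at h2
  have h3 := h2.sqrt
  simpa [Real.sqrt_sq] using h3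

/-- Measurable coefficients on `A × ℝ` that are bounded by `M`. -/
structure IsBoundedCoeff (M : ℝ) (q : A × ℝ → ℝ) : Prop where
  meas : StronglyMeasurable q
  bound : ∀ p, |q p| ≤ M

namespace IsBoundedCoeff

variable {M : ℝ} {q : A × ℝ → ℝ}

theorem memLp_slice (hq : IsBoundedCoeff M q) (t : ℝ) (w : Lp X 2 μ) :
    MemLp (fun x => q (x, t) • w x) 2 μ := by
  refine MemLp.of_le_mul (c := M) (Lp.memLp w) ?_ (Eventually.of_forall fun x => ?_)
  · exact (hq.meas.comp_measurable measurable_prodMk_right).aestronglyMeasurable.smul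
      (Lp.aestronglyMeasurable w)
  · rw [norm_smul]
    exact mul_le_mul_of_nonneg_right (hq.bound _) (norm_nonneg _)

/-- Multiplication by the time slice `q(·,t)`. -/
noncomputable def slice (hq : IsBoundedCoeff M q) (t : ℝ) : Lp X 2 μ →L[ℝ] Lp X 2 μ :=
  LinearMap.mkContinuous
    { toFun := fun w => (hq.memLp_slice t w).toLp _
      map_add' := fun v w => by
        rw [← MemLp.toLp_add]
        refine (MemLp.toLp_eq_toLp_iff _ _).2 ?_
        filter_upwards [Lp.coeFn_add v w] with x hx
        rw [hx, Pi.add_apply, smul_add]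
        rfl
      map_smul' := fun a w => by
        rw [RingHom.id_apply, ← MemLp.toLp_const_smul]
        refine (MemLp.toLp_eq_toLp_iff _ _).2 ?_
        filter_upwards [Lp.coeFn_smul a w] with x hx
        rw [hx, Pi.smul_apply, Pi.smul_apply, smul_comm] }
    M fun w => by
      refine Lp.norm_le_mul_norm_of_ae_le_mul ?_
      filter_upwards [(hq.memLp_slice t w).coeFn_toLp] with x hx
      simp only [LinearMap.coe_mk, AddHom.coe_mk]
      rw [hx, norm_smul]
      exact mul_le_mul_of_nonneg_right (hq.bound _) (norm_nonneg _)

theorem coeFn_slice (hq : IsBoundedCoeff M q) (t : ℝ) (w : Lp X 2 μ) :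
    hq.slice t w =ᵐ[μ] fun x => q (x, t) • w x :=
  (hq.memLp_slice t w).coeFn_toLp

theorem norm_slice_le (hq : IsBoundedCoeff M q) (t : ℝ) (w : Lp X 2 μ) :
    ‖hq.slice t w‖ ≤ M * ‖w‖ := by
  refine Lp.norm_le_mul_norm_of_ae_le_mul ?_
  filter_upwards [hq.coeFn_slice t w] with x hx
  rw [hx, norm_smul]
  exact mul_le_mul_of_nonneg_right (hq.bound _) (norm_nonneg _)

variable [SecondCountableTopology ↥(Lp X 2 μ)]

theorem stronglyMeasurable_slice (hq : IsBoundedCoeff M q) (w : Lp X 2 μ) :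
    StronglyMeasurable fun t => hq.slice t w := by
  refine stronglyMeasurable_of_inner fun y => ?_
  have h1 : ∀ t, inner ℝ y (hq.slice t w) = ∫ x, q (x, t) * inner ℝ (y x) (w x) ∂μ := by
    intro t
    rw [L2.inner_def]
    refine integral_congr_ae ?_
    filter_upwards [hq.coeFn_slice t w] with x hx
    rw [hx, inner_smul_right]
  have hy := (Lp.aestronglyMeasurable y).inner (𝕜 := ℝ) (Lp.aestronglyMeasurable w)
  have h2 : ∀ t, inner ℝ y (hq.slice t w) = ∫ x, q (x, t) * hy.mk _ x ∂μ := by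
    intro t
    rw [h1]
    refine integral_congr_ae ?_
    filter_upwards [hy.ae_eq_mk] with x hx
    rw [← hx]
  simp only [h2]
  have h3 : StronglyMeasurable fun p : A × ℝ => q p * hy.mk _ p.1 :=
    hq.meas.mul (hy.stronglyMeasurable_mk.comp_measurable measurable_fst)
  exact (h3.integral_prod_left' (μ := μ)).measurable

/-- The map `(w, t) ↦ q(·,t) w` is continuous in `w` and measurable in `t`, a Carathéodory function,
so it can be composed with a measurable `u`. -/
theorem aestronglyMeasurable_mul (hq : IsBoundedCoeff M q) {u : ℝ → Lp X 2 μ} {ν : Measure ℝ}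
    (hu : AEStronglyMeasurable u ν) : AEStronglyMeasurable (fun t => hq.slice t (u t)) ν := by
  borelize ↥(Lp X 2 μ)
  have h1 : StronglyMeasurable (Function.uncurry fun (w : Lp X 2 μ) t => hq.slice t w) :=
    stronglyMeasurable_uncurry_of_continuous_of_stronglyMeasurable
      (fun t => (hq.slice t).continuous) hq.stronglyMeasurable_slice
  refine ⟨fun t => hq.slice t (hu.mk u t), ?_, ?_⟩
  · exact h1.comp_measurable (hu.stronglyMeasurable_mk.measurable.prodMk measurable_id)
  · filter_upwards [hu.ae_eq_mk] with t ht
    rw [ht]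

theorem memLp_mul (hq : IsBoundedCoeff M q) {ν : Measure ℝ} (u : Lp (Lp X 2 μ) 2 ν) :
    MemLp (fun t => hq.slice t (u t)) 2 ν :=
  MemLp.of_le_mul (c := M) (Lp.memLp u) (hq.aestronglyMeasurable_mul (Lp.aestronglyMeasurable u))
    (Eventually.of_forall fun t => hq.norm_slice_le t (u t))

/-- Multiplication by `q` on `L²(0,T;L²)`. -/
noncomputable def mulL (hq : IsBoundedCoeff M q) (ν : Measure ℝ) :
    Lp (Lp X 2 μ) 2 ν →L[ℝ] Lp (Lp X 2 μ) 2 ν :=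
  LinearMap.mkContinuous
    { toFun := fun u => (hq.memLp_mul u).toLp _
      map_add' := fun v w => by
        rw [← MemLp.toLp_add]
        refine (MemLp.toLp_eq_toLp_iff _ _).2 ?_
        filter_upwards [Lp.coeFn_add v w] with x hx
        rw [hx, Pi.add_apply, map_add]
        rfl
      map_smul' := fun a w => by
        rw [RingHom.id_apply, ← MemLp.toLp_const_smul]
        refine (MemLp.toLp_eq_toLp_iff _ _).2 ?_
        filter_upwards [Lp.coeFn_smul a w] with x hx
        rw [hx, Pi.smul_apply, Pi.smul_apply, map_smul] }
    M fun u => by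
      refine Lp.norm_le_mul_norm_of_ae_le_mul ?_
      filter_upwards [(hq.memLp_mul u).coeFn_toLp] with t ht
      simp only [LinearMap.coe_mk, AddHom.coe_mk]
      rw [ht]
      exact hq.norm_slice_le t (u t)

theorem coeFn_mulL (hq : IsBoundedCoeff M q) (ν : Measure ℝ) (u : Lp (Lp X 2 μ) 2 ν) :
    hq.mulL ν u =ᵐ[ν] fun t => hq.slice t (u t) :=
  (hq.memLp_mul u).coeFn_toLp

theorem inner_mulL (hq : IsBoundedCoeff M q) (ν : Measure ℝ) {c : ℝ} (hc : ∀ p, c ≤ q p)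
    (u : Lp (Lp X 2 μ) 2 ν) : c * ‖u‖ ^ 2 ≤ inner ℝ (hq.mulL ν u) u := by
  have hslice : ∀ t (w : Lp X 2 μ), c * inner ℝ w w ≤ inner ℝ (hq.slice t w) w := by
    intro t w
    rw [L2.inner_def, L2.inner_def, ← integral_const_mul]
    refine integral_mono_ae ((L2.integrable_inner w w).const_mul c)
      (L2.integrable_inner _ w) ?_
    filter_upwards [hq.coeFn_slice t w] with x hx
    rw [hx, real_inner_smul_left]
    exact mul_le_mul_of_nonneg_right (hc _) real_inner_self_nonneg
  rw [← real_inner_self_eq_norm_sq, L2.inner_def, L2.inner_def, ← integral_const_mul]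
  refine integral_mono_ae ((L2.integrable_inner u u).const_mul c) (L2.integrable_inner _ u) ?_
  filter_upwards [hq.coeFn_mulL ν u] with t ht
  rw [ht]
  exact hslice t (u t)

end IsBoundedCoeff

/-- Multiplication operators converge strongly if the coefficients converge almost everywhere. -/
theorem tendsto_mulL [SecondCountableTopology ↥(Lp X 2 μ)] {M : ℝ} {q : ℕ → A × ℝ → ℝ}
    {q' : A × ℝ → ℝ} (hq : ∀ j, IsBoundedCoeff M (q j)) (hq' : IsBoundedCoeff M q') (ν : Measure ℝ)
    [SFinite ν] (h : ∀ᵐ p ∂(μ.prod ν), Tendsto (fun j => q j p) atTop (𝓝 (q' p)))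
    (u : Lp (Lp X 2 μ) 2 ν) :
    Tendsto (fun j => (hq j).mulL ν u) atTop (𝓝 (hq'.mulL ν u)) := by
  have hslice : ∀ t (w : Lp X 2 μ), (∀ᵐ x ∂μ, Tendsto (fun j => q j (x, t)) atTop (𝓝 (q' (x, t)))) →
      Tendsto (fun j => (hq j).slice t w) atTop (𝓝 (hq'.slice t w)) := by
    intro t w hx
    refine tendsto_L2_of_dominated (g := fun x => M * ‖w x‖) ((Lp.memLp w).norm.const_mul M)
      (fun n => ?_) ?_
    · filter_upwards [(hq n).coeFn_slice t w] with x hx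
      rw [hx, norm_smul]
      exact mul_le_mul_of_nonneg_right ((hq n).bound _) (norm_nonneg _)
    · have h1 : ∀ᵐ x ∂μ, ∀ n, (hq n).slice t w x = q n (x, t) • w x :=
        ae_all_iff.2 fun n => (hq n).coeFn_slice t w
      filter_upwards [h1, hq'.coeFn_slice t w, hx] with x h2 h3 h4
      simp only [h2, h3]
      exact h4.smul_const _
  refine tendsto_L2_of_dominated (g := fun t => M * ‖u t‖) ((Lp.memLp u).norm.const_mul M)
      (fun n => ?_) ?_
  · filter_upwards [(hq n).coeFn_mulL ν u] with t ht
    rw [ht]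
    exact (hq n).norm_slice_le t (u t)
  · have h1 : ∀ᵐ t ∂ν, ∀ n, (hq n).mulL ν u t = (hq n).slice t (u t) :=
      ae_all_iff.2 fun n => (hq n).coeFn_mulL ν u
    -- Fubini for null sets, after a swap because the time is the second coordinate. Dominated
    -- convergence is then used twice, in `x` and in `t`.
    have h2 : ∀ᵐ t ∂ν, ∀ᵐ x ∂μ, Tendsto (fun j => q j (x, t)) atTop (𝓝 (q' (x, t))) := by
      refine Measure.ae_ae_of_ae_prod (p := fun z : ℝ × A =>
        Tendsto (fun j => q j (z.2, z.1)) atTop (𝓝 (q' (z.2, z.1)))) ?_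
      exact (Measure.measurePreserving_swap (μ := ν) (ν := μ)).quasiMeasurePreserving.ae h
    filter_upwards [h1, hq'.coeFn_mulL ν u, h2] with t h3 h4 h5
    simp only [h3, h4]
    exact hslice t (u t) h5

end Multiplication

theorem intervalIntegral_congr_timeMeasure {X : Type*} [NormedAddCommGroup X] [NormedSpace ℝ X]
    {T : ℝ} {v w : ℝ → X} (h : v =ᵐ[timeMeasure T] w) {t : ℝ} (ht : t ∈ Ioo 0 T) (k : ℝ → ℝ) :
    ∫ s in (0 : ℝ)..t, k s • v s = ∫ s in (0 : ℝ)..t, k s • w s := by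
  rw [intervalIntegral.integral_of_le ht.1.le, intervalIntegral.integral_of_le ht.1.le,
    integral_Ioc_eq_integral_Ioo, integral_Ioc_eq_integral_Ioo]
  refine integral_congr_ae ?_
  have := ae_restrict_of_ae_restrict_of_subset (Ioo_subset_Ioo_right ht.2.le : Ioo 0 t ⊆ Ioo 0 T) h
  filter_upwards [this] with s hs
  rw [hs]

/-! ### Weak formulation as an operator equation; continuous dependence -/

section AbstractProblem

open ContinuousLinearMap (adjoint)

variable {V H A X : Type*} [NormedAddCommGroup V] [InnerProductSpace ℝ V] [CompleteSpace V]
  [NormedAddCommGroup H] [InnerProductSpace ℝ H] [CompleteSpace H] [MeasurableSpace A]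
  {μ : Measure A} [SFinite μ] [NormedAddCommGroup X] [InnerProductSpace ℝ X] [CompleteSpace X]
  [SecondCountableTopology ↥(Lp X 2 μ)] {T α M : ℝ} {q : A × ℝ → ℝ}

/-- The weak formulation of the fractional evolution equation in a Gelfand triple `V ⊆ H ⊆ V'`
with the diffusion form `(q(t)∇v, ∇φ)`. -/
def IsVariationalSolution (T α : ℝ) (val : V →L[ℝ] H) (grad : V →L[ℝ] Lp X 2 μ) (u₀ : H)
    (f : ℝ → V →L[ℝ] ℝ) (hq : IsBoundedCoeff M q) (u : ℝ → V) : Prop :=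
  MemLp u 2 (timeMeasure T) ∧ ∃ g : ℝ → V →L[ℝ] ℝ,
    HasZeroH1Deriv T
      (fun t => (innerSL ℝ (fracIntegral (1 - α) (fun s => val (u s) - u₀) t)).comp val) g ∧
    ∀ᵐ t ∂(timeMeasure T), ∀ φ, g t φ + inner ℝ (hq.slice t (grad (u t))) (grad φ) = f t φ

/-- The operator `u ↦ -∇·(q∇u)` on `L²(0,T;V)`, via the Riesz isomorphism. -/
noncomputable def diffOp (grad : V →L[ℝ] Lp X 2 μ) (hq : IsBoundedCoeff M q) (T : ℝ) :
    Lp V 2 (timeMeasure T) →L[ℝ] Lp V 2 (timeMeasure T) :=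
  adjoint (grad.compLpL 2 (timeMeasure T)) ∘L hq.mulL (timeMeasure T) ∘L
    grad.compLpL 2 (timeMeasure T)

theorem norm_sq_eq_compLpL_add_compLpL {val : V →L[ℝ] H} {grad : V →L[ℝ] Lp X 2 μ}
    (hnorm : ∀ v, ‖v‖ ^ 2 = ‖val v‖ ^ 2 + ‖grad v‖ ^ 2) (u : Lp V 2 (timeMeasure T)) :
    ‖u‖ ^ 2 = ‖val.compLpL 2 (timeMeasure T) u‖ ^ 2 +
      ‖grad.compLpL 2 (timeMeasure T) u‖ ^ 2 := by
  rw [← real_inner_self_eq_norm_sq, ← real_inner_self_eq_norm_sq, ← real_inner_self_eq_norm_sq,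
    L2.inner_def, L2.inner_def, L2.inner_def, ← integral_add (L2.integrable_inner (𝕜 := ℝ) _ _)
    (L2.integrable_inner (𝕜 := ℝ) _ _)]
  refine integral_congr_ae ?_
  filter_upwards [val.coeFn_compLpL u, grad.coeFn_compLpL u] with t h1 h2
  rw [h1, h2, real_inner_self_eq_norm_sq, real_inner_self_eq_norm_sq, real_inner_self_eq_norm_sq,
    hnorm]

theorem inner_diffOp_nonneg (grad : V →L[ℝ] Lp X 2 μ) (hq : IsBoundedCoeff M q)
    (hq0 : ∀ p, 0 ≤ q p) (u : Lp V 2 (timeMeasure T)) : 0 ≤ inner ℝ (diffOp grad hq T u) u := by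
  have := hq.inner_mulL (timeMeasure T) hq0 (grad.compLpL 2 (timeMeasure T) u)
  rw [zero_mul] at this
  rwa [diffOp, ContinuousLinearMap.comp_apply, ContinuousLinearMap.comp_apply,
    ContinuousLinearMap.adjoint_inner_left]

theorem inner_diffOp_coercive {val : V →L[ℝ] H} {grad : V →L[ℝ] Lp X 2 μ}
    (hnorm : ∀ v, ‖v‖ ^ 2 = ‖val v‖ ^ 2 + ‖grad v‖ ^ 2) (hq : IsBoundedCoeff M q) {c : ℝ}
    (hc : ∀ p, c ≤ q p) (u : Lp V 2 (timeMeasure T)) :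
    c * ‖u‖ ^ 2 ≤ inner ℝ (diffOp grad hq T u) u +
      c * ‖val.compLpL 2 (timeMeasure T) u‖ ^ 2 := by
  have := hq.inner_mulL (timeMeasure T) hc (grad.compLpL 2 (timeMeasure T) u)
  rw [diffOp, ContinuousLinearMap.comp_apply, ContinuousLinearMap.comp_apply,
    ContinuousLinearMap.adjoint_inner_left, norm_sq_eq_compLpL_add_compLpL hnorm]
  linarith

theorem inner_diffOp_ae (grad : V →L[ℝ] Lp X 2 μ) (hq : IsBoundedCoeff M q)
    (u : Lp V 2 (timeMeasure T)) :
    ∀ᵐ t ∂(timeMeasure T), ∀ φ,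
      inner ℝ (diffOp grad hq T u t) φ = inner ℝ (hq.slice t (grad (u t))) (grad φ) := by
  set y := hq.mulL (timeMeasure T) (grad.compLpL 2 (timeMeasure T) u)
  have h1 : diffOp grad hq T u = (adjoint grad).compLpL 2 (timeMeasure T) y := by
    rw [← adjoint_compLpL]
    rfl
  rw [h1]
  filter_upwards [(adjoint grad).coeFn_compLpL y, hq.coeFn_mulL (timeMeasure T)
    (grad.compLpL 2 (timeMeasure T) u), grad.coeFn_compLpL u] with t h2 h3 h4 φ
  rw [h2, h3, h4, ContinuousLinearMap.adjoint_inner_left]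

/-- The operator form of the fractional derivative `u ↦ ₀I_t^{1-α} (u - u₀)` with values in
`V ≅ V'`. -/
noncomputable def fracOp (hα1 : α < 1) (T : ℝ) (val : V →L[ℝ] H) (u₀ : H)
    (u : Lp V 2 (timeMeasure T)) : Lp V 2 (timeMeasure T) :=
  adjoint (val.compLpL 2 (timeMeasure T)) ((Real.Gamma (1 - α))⁻¹ •
    (isNilpotentSemigroup_shift T).conv (intervalIntegrable_rpow_neg hα1 T)
      (val.compLpL 2 (timeMeasure T) u - Lp.const 2 (timeMeasure T) u₀))

theorem inner_fracOp_ae (hT : 0 < T) (hα1 : α < 1) (val : V →L[ℝ] H) (u₀ : H) {u : ℝ → V}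
    (hu : MemLp u 2 (timeMeasure T)) :
    ∀ᵐ t ∂(timeMeasure T), ∀ φ, inner ℝ (fracOp hα1 T val u₀ (hu.toLp u) t) φ =
      inner ℝ (fracIntegral (1 - α) (fun s => val (u s) - u₀) t) (val φ) := by
  set w := val.compLpL 2 (timeMeasure T) (hu.toLp u) - Lp.const 2 (timeMeasure T) u₀ with hw
  set z := (isNilpotentSemigroup_shift T).conv (intervalIntegrable_rpow_neg hα1 T) w
  have hw' : w =ᵐ[timeMeasure T] fun s => val (u s) - u₀ := by
    filter_upwards [Lp.coeFn_sub (val.compLpL 2 (timeMeasure T) (hu.toLp u))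
      (Lp.const 2 (timeMeasure T) u₀), val.coeFn_compLpL (hu.toLp u), hu.coeFn_toLp,
      Lp.coeFn_const (p := 2) (μ := timeMeasure T) u₀] with s h1 h2 h3 h4
    rw [hw, h1, Pi.sub_apply, h4, Function.const_apply, h2, h3]
  have h1 : fracOp hα1 T val u₀ (hu.toLp u) =
      (adjoint val).compLpL 2 (timeMeasure T) ((Real.Gamma (1 - α))⁻¹ • z) := by
    rw [← adjoint_compLpL]
    rfl
  rw [h1]
  filter_upwards [(adjoint val).coeFn_compLpL ((Real.Gamma (1 - α))⁻¹ • z),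
    Lp.coeFn_smul (Real.Gamma (1 - α))⁻¹ z,
    coeFn_conv_shift hT (intervalIntegrable_rpow_neg hα1 T) w,
    ae_restrict_mem measurableSet_Ioo] with t h2 h3 h4 ht φ
  rw [h2, ContinuousLinearMap.adjoint_inner_left, h3, Pi.smul_apply, h4,
    intervalIntegral_congr_timeMeasure hw' ht]
  simp only [fracIntegral, show (1 : ℝ) - α - 1 = -α by ring]

theorem memLp_toDual_symm {f : ℝ → V →L[ℝ] ℝ} (hf : MemLp f 2 (timeMeasure T)) :
    MemLp (fun t => (InnerProductSpace.toDual ℝ V).symm (f t)) 2 (timeMeasure T) :=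
  hf.of_le ((InnerProductSpace.toDual ℝ V).symm.continuous.comp_aestronglyMeasurable hf.1)
    (Eventually.of_forall fun _ => (LinearIsometryEquiv.norm_map _ _).le)

/-- The Riesz representative of the right hand side. -/
noncomputable def rieszL {f : ℝ → V →L[ℝ] ℝ} (hf : MemLp f 2 (timeMeasure T)) :
    Lp V 2 (timeMeasure T) :=
  (memLp_toDual_symm hf).toLp _

theorem inner_rieszL_ae {f : ℝ → V →L[ℝ] ℝ} (hf : MemLp f 2 (timeMeasure T)) :
    ∀ᵐ t ∂(timeMeasure T), ∀ φ, inner ℝ (rieszL hf t) φ = f t φ := by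
  filter_upwards [(memLp_toDual_symm hf).coeFn_toLp] with t ht φ
  rw [rieszL, ht, InnerProductSpace.toDual_symm_apply]

/-- Weak solutions are the solutions of the operator equation. -/
theorem isVariationalSolution_iff (hT : 0 < T) (hα1 : α < 1) (val : V →L[ℝ] H)
    (grad : V →L[ℝ] Lp X 2 μ) (u₀ : H) {f : ℝ → V →L[ℝ] ℝ} (hf : MemLp f 2 (timeMeasure T))
    (hq : IsBoundedCoeff M q) {u : ℝ → V} (hu : MemLp u 2 (timeMeasure T)) :
    IsVariationalSolution T α val grad u₀ f hq u ↔ fracOp hα1 T val u₀ (hu.toLp u) =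
      (isNilpotentSemigroup_shift T).prim (rieszL hf - diffOp grad hq T (hu.toLp u)) := by
  set G := rieszL hf - diffOp grad hq T (hu.toLp u) with hG
  have hGae : ∀ᵐ t ∂(timeMeasure T), ∀ φ,
      inner ℝ (G t) φ = f t φ - inner ℝ (hq.slice t (grad (u t))) (grad φ) := by
    filter_upwards [Lp.coeFn_sub (rieszL hf) (diffOp grad hq T (hu.toLp u)), inner_rieszL_ae hf,
      inner_diffOp_ae grad hq (hu.toLp u), hu.coeFn_toLp] with t h1 h2 h3 h5 φ
    rw [hG, h1, Pi.sub_apply, inner_sub_left, h2, h3, h5]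
  have hGint : ∀ t ∈ Ioo 0 T, IntervalIntegrable G volume 0 t := by
    intro t ht
    rw [intervalIntegrable_iff_integrableOn_Ioo_of_le ht.1.le]
    exact IntegrableOn.mono_set ((Lp.memLp G).integrable (by norm_num))
      (Ioo_subset_Ioo_right ht.2.le)
  have hprim : ∀ᵐ t ∂(timeMeasure T), ∀ φ,
      inner ℝ ((isNilpotentSemigroup_shift T).prim G t) φ =
        ∫ s in (0 : ℝ)..t, inner ℝ (G s) φ := by
    filter_upwards [coeFn_prim_shift hT G, ae_restrict_mem measurableSet_Ioo] with t h1 ht φ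
    rw [h1, real_inner_comm]
    have := (innerSL ℝ φ).intervalIntegral_comp_comm (hGint t ht)
    simp only [innerSL_apply_apply] at this
    rw [← this]
    exact intervalIntegral.integral_congr fun s _ => real_inner_comm _ _
  constructor
  · rintro ⟨-, g, hg, hgf⟩
    refine Lp.ext ?_
    -- The equation determines the derivative: `g(t)` must be the functional represented by `G(t)`.
    -- In the converse direction this serves as the definition of `g`.
    have hgG : ∀ᵐ t ∂(timeMeasure T), ∀ φ, inner ℝ (G t) φ = g t φ := by
      filter_upwards [hGae, hgf] with t h1 h2 φ
      rw [h1, ← h2, add_sub_cancel_right]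
    filter_upwards [hprim, inner_fracOp_ae hT hα1 val u₀ hu, hg.eq_integral,
      ae_restrict_mem measurableSet_Ioo] with t h1 h2 h3 ht
    refine ext_inner_right ℝ fun φ => ?_
    have hgint : IntervalIntegrable g volume 0 t := by
      rw [intervalIntegrable_iff_integrableOn_Ioo_of_le ht.1.le]
      exact IntegrableOn.mono_set (hg.memLp_deriv.integrable (by norm_num))
        (Ioo_subset_Ioo_right ht.2.le)
    rw [h1, h2, ← innerSL_apply_apply ℝ, ← ContinuousLinearMap.comp_apply, h3,
      ContinuousLinearMap.intervalIntegral_apply hgint]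
    have := intervalIntegral_congr_timeMeasure (v := fun s => g s φ) (w := fun s => inner ℝ (G s) φ)
      (hgG.mono fun s hs => (hs φ).symm) ht (fun _ => 1)
    simpa using this
  · intro h
    refine ⟨hu, fun t => InnerProductSpace.toDual ℝ V (G t), ⟨?_, ?_⟩, ?_⟩
    · exact (Lp.memLp G).of_le ((InnerProductSpace.toDual ℝ
        V).continuous.comp_aestronglyMeasurable (Lp.memLp G).1)
        (Eventually.of_forall fun _ => (LinearIsometryEquiv.norm_map _ _).le)
    · filter_upwards [hprim, inner_fracOp_ae hT hα1 val u₀ hu, ae_restrict_mem measurableSet_Ioo]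
        with t h1 h2 ht
      ext φ
      have hgint : IntervalIntegrable (fun t => InnerProductSpace.toDual ℝ V (G t))
          volume 0 t := by
        have := hGint t ht
        rw [intervalIntegrable_iff_integrableOn_Ioo_of_le ht.1.le] at this ⊢
        exact Integrable.mono this ((InnerProductSpace.toDual ℝ
          V).continuous.comp_aestronglyMeasurable this.1)
          (Eventually.of_forall fun _ => (LinearIsometryEquiv.norm_map _ _).le)
      rw [ContinuousLinearMap.intervalIntegral_apply hgint, ContinuousLinearMap.comp_apply,
        innerSL_apply_apply, ← h2 φ, h, h1]
      simp only [InnerProductSpace.toDual_apply_apply]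
    · filter_upwards [hGae] with t h1 φ
      rw [InnerProductSpace.toDual_apply_apply, h1, sub_add_cancel]

theorem exists_isVariationalSolution (hT : 0 < T) (hα0 : 0 < α) (hα1 : α < 1)
    {val : V →L[ℝ] H} {grad : V →L[ℝ] Lp X 2 μ}
    (hnorm : ∀ v, ‖v‖ ^ 2 = ‖val v‖ ^ 2 + ‖grad v‖ ^ 2) (u₀ : H) {f : ℝ → V →L[ℝ] ℝ}
    (hf : MemLp f 2 (timeMeasure T)) (hq : IsBoundedCoeff M q) {c₀ : ℝ} (hc₀ : 0 < c₀)
    (hq0 : ∀ p, c₀ ≤ q p) : ∃ u, IsVariationalSolution T α val grad u₀ f hq u := by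
  obtain ⟨U, hU⟩ := exists_fractional_eq hT (isNilpotentSemigroup_shift T)
    (isNilpotentSemigroup_shift T) hα0 hα1 (val.compLpL 2 (timeMeasure T))
    (fun r _ x => by rw [adjoint_compLpL]; exact compLpL_shift _ r x)
    (inv_pos.2 (Real.Gamma_pos_of_pos (sub_pos.2 hα1))) hc₀
    (inner_diffOp_nonneg grad hq fun p => hc₀.le.trans (hq0 p))
    (inner_diffOp_coercive hnorm hq hq0)
    (rieszL hf) (sq_nonneg ‖u₀‖) (x := Lp.const 2 (timeMeasure T) u₀)
    (fun r hr y => inner_const_sub_shift hr.1 u₀ y)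
    (fun r hr => norm_const_sub_shift_sq_le hr.1 u₀)
  refine ⟨U, (isVariationalSolution_iff hT hα1 val grad u₀ hf hq (Lp.memLp U)).2 ?_⟩
  rw [Lp.toLp_coeFn]
  exact hU

/-- Variational solutions depend continuously on the coefficient. -/
theorem tendsto_variationalSolution (hT : 0 < T) (hα0 : 0 < α) (hα1 : α < 1)
    {val : V →L[ℝ] H} {grad : V →L[ℝ] Lp X 2 μ}
    (hnorm : ∀ v, ‖v‖ ^ 2 = ‖val v‖ ^ 2 + ‖grad v‖ ^ 2) (u₀ : H) {f : ℝ → V →L[ℝ] ℝ}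
    (hf : MemLp f 2 (timeMeasure T)) {c₀ : ℝ} (hc₀ : 0 < c₀) {qs : ℕ → A × ℝ → ℝ}
    (hqs : ∀ j, IsBoundedCoeff M (qs j)) (hqs0 : ∀ j p, c₀ ≤ qs j p) (hq : IsBoundedCoeff M q)
    (hlim : ∀ᵐ p ∂(μ.prod (timeMeasure T)), Tendsto (fun j => qs j p) atTop (𝓝 (q p)))
    {us : ℕ → ℝ → V} (hus : ∀ j, IsVariationalSolution T α val grad u₀ f (hqs j) (us j))
    {u : ℝ → V} (hu : IsVariationalSolution T α val grad u₀ f hq u) :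
    Tendsto (fun j => eLpNorm (us j - u) 2 (timeMeasure T)) atTop (𝓝 0) := by
  set U := hu.1.toLp u
  set Us := fun j => (hus j).1.toLp (us j)
  have hB : Tendsto (fun j => diffOp grad (hqs j) T U) atTop (𝓝 (diffOp grad hq T U)) :=
    ((adjoint (grad.compLpL 2 (timeMeasure T))).continuous.tendsto _).comp
      (tendsto_mulL hqs hq (timeMeasure T) hlim (grad.compLpL 2 (timeMeasure T) U))
  set c := min c₀ ((Real.Gamma (1 - α))⁻¹ * T ^ (-α))
  have hΓ : 0 < (Real.Gamma (1 - α))⁻¹ := inv_pos.2 (Real.Gamma_pos_of_pos (sub_pos.2 hα1))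
  have hcpos : 0 < c := lt_min hc₀ (mul_pos hΓ (Real.rpow_pos_of_pos hT _))
  -- The difference solves the equation with coefficient `qs j`, zero initial value and the error
  -- `(B - B_j) U` as right-hand side. The operators `B_j` share their coercivity constant and act
  -- here on the fixed `U`, so strong convergence suffices.
  have hstab : ∀ j, c * ‖Us j - U‖ ≤ ‖diffOp grad hq T U - diffOp grad (hqs j) T U‖ := by
    intro j
    refine norm_le_of_fractional_eq hT (isNilpotentSemigroup_shift T)
      (isNilpotentSemigroup_shift T) hα0 hα1 (val.compLpL 2 (timeMeasure T))
      (fun r _ v => compLpL_shift _ r v)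
      (fun r _ x => by rw [adjoint_compLpL]; exact compLpL_shift _ r x) hΓ hc₀
      (inner_diffOp_nonneg grad (hqs j) fun p => hc₀.le.trans (hqs0 j p))
      (inner_diffOp_coercive hnorm (hqs j) (hqs0 j)) ?_
    have e1 := (isVariationalSolution_iff hT hα1 val grad u₀ hf hq hu.1).1 hu
    have e2 := (isVariationalSolution_iff hT hα1 val grad u₀ hf (hqs j) (hus j).1).1 (hus j)
    have e3 : val.compLpL 2 (timeMeasure T) (Us j - U) =
        (val.compLpL 2 (timeMeasure T) (Us j) - Lp.const 2 (timeMeasure T) u₀) -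
        (val.compLpL 2 (timeMeasure T) U - Lp.const 2 (timeMeasure T) u₀) := by
      rw [map_sub]; abel
    rw [e3, map_sub, smul_sub, map_sub]
    change fracOp hα1 T val u₀ (Us j) - fracOp hα1 T val u₀ U = _
    rw [e1, e2, ← map_sub]
    congr 1
    rw [map_sub]
    abel
  have hUs : Tendsto (fun j => ‖Us j - U‖) atTop (𝓝 0) := by
    have h1 : Tendsto (fun j => c⁻¹ * ‖diffOp grad hq T U - diffOp grad (hqs j) T U‖) atTop
        (𝓝 (c⁻¹ * ‖diffOp grad hq T U - diffOp grad hq T U‖)) :=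
      ((tendsto_const_nhds.sub hB).norm).const_mul _
    rw [sub_self, norm_zero, mul_zero] at h1
    refine squeeze_zero (fun _ => norm_nonneg _) (fun j => ?_) h1
    rw [← div_eq_inv_mul, le_div_iff₀ hcpos, mul_comm]
    exact hstab _
  have h3 : ∀ j, ENNReal.ofReal ‖Us j - U‖ = eLpNorm (us j - u) 2 (timeMeasure T) := by
    intro j
    rw [← MemLp.toLp_sub, Lp.norm_toLp, ENNReal.ofReal_toReal ((hus j).1.sub hu.1).2.ne]
  simp only [← h3]
  simpa using ENNReal.tendsto_ofReal hUs

end AbstractProblem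

/-! ### The forward map on the admissible set -/

section Forward

variable {d : ℕ} {Ω : Set (E d)} {T α M : ℝ} {q : E d × ℝ → ℝ}

instance : CompleteSpace (H01 Ω) :=
  (Submodule.isClosed_topologicalClosure _).completeSpace_coe

instance : SecondCountableTopology (L2Vec Ω) :=
  haveI : Fact ((2 : ℝ≥0∞) ≠ ⊤) := ⟨by norm_num⟩
  Lp.SecondCountableTopology

theorem norm_sq_eq_val_add_grad (v : H01 Ω) : ‖v‖ ^ 2 = ‖H01.val v‖ ^ 2 + ‖H01.grad v‖ ^ 2 :=
  WithLp.prod_norm_sq_eq_of_L2 (v : WithLp 2 (L2 Ω × L2Vec Ω))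

theorem norm_val_le (v : H01 Ω) : ‖H01.val v‖ ≤ ‖v‖ := by
  refine le_of_sq_le_sq ?_ (norm_nonneg _)
  have := norm_sq_eq_val_add_grad v
  nlinarith [sq_nonneg ‖H01.grad v‖]

theorem diffusionForm_eq_inner (hq : IsBoundedCoeff M q) (t : ℝ) (v φ : H01 Ω) :
    diffusionForm q t v φ = inner ℝ (hq.slice t (H01.grad v : L2Vec Ω)) (H01.grad φ) := by
  rw [L2.inner_def, diffusionForm]
  refine integral_congr_ae ?_
  filter_upwards [hq.coeFn_slice t (H01.grad v : L2Vec Ω)] with x hx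
  rw [hx, real_inner_smul_left]

/-- An admissible coefficient has a representative that is bounded everywhere. -/
theorem exists_boundedCoeff {c₀ c₁ : ℝ} (hc₀ : 0 < c₀) (hc : c₀ < c₁)
    (hq : q ∈ admissibleSet Ω T c₀ c₁) :
    ∃ q' : E d × ℝ → ℝ, IsBoundedCoeff c₁ q' ∧ (∀ p, c₀ ≤ q' p) ∧ q =ᵐ[cylMeasure Ω T] q' := by
  -- Clipping a measurable version to `[c₀, c₁]` makes the bounds hold at every point.
  refine ⟨fun p => max c₀ (min c₁ (hq.1.mk q p)), ⟨?_, fun p => ?_⟩, fun p => le_max_left _ _, ?_⟩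
  · exact (stronglyMeasurable_const (b := c₀)).sup
      ((stronglyMeasurable_const (b := c₁)).inf hq.1.stronglyMeasurable_mk)
  · rw [abs_of_nonneg (hc₀.le.trans (le_max_left _ _))]
    exact max_le hc.le (min_le_left _ _)
  · filter_upwards [hq.1.ae_eq_mk, hq.2] with p h1 h2
    rw [← h1, min_eq_right h2.2, max_eq_right h2.1]

theorem cylMeasure_eq_prod (Ω : Set (E d)) (T : ℝ) :
    cylMeasure Ω T = (volume.restrict Ω).prod (timeMeasure T) := by
  rw [timeMeasure, Measure.prod_restrict]
  rfl

/-- For almost every `t` the slices agree almost everywhere, so the exceptional set of times does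
not depend on `v` and `φ`. -/
theorem diffusionForm_congr {q q' : E d × ℝ → ℝ} (h : q =ᵐ[cylMeasure Ω T] q') :
    ∀ᵐ t ∂(timeMeasure T), ∀ v φ : H01 Ω, diffusionForm q t v φ = diffusionForm q' t v φ := by
  rw [cylMeasure_eq_prod] at h
  have h2 : ∀ᵐ t ∂(timeMeasure T), ∀ᵐ x ∂(volume.restrict Ω), q (x, t) = q' (x, t) := by
    refine Measure.ae_ae_of_ae_prod (p := fun z : ℝ × E d => q (z.2, z.1) = q' (z.2, z.1)) ?_
    exact (Measure.measurePreserving_swap (μ := timeMeasure T)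
      (ν := volume.restrict Ω)).quasiMeasurePreserving.ae h
  filter_upwards [h2] with t ht v φ
  refine integral_congr_ae ?_
  filter_upwards [ht] with x hx
  rw [hx]

theorem isWeakSolution_iff (u₀ : L2 Ω) (f : ℝ → HMinusOne Ω) {q' : E d × ℝ → ℝ}
    (hq' : IsBoundedCoeff M q') (hqq' : q =ᵐ[cylMeasure Ω T] q') (u : ℝ → H01 Ω) :
    IsWeakSolution Ω T α u₀ f q u ↔
      IsVariationalSolution T α H01.val H01.grad u₀ f hq' u := by
  refine and_congr_right fun _ => exists_congr fun g => and_congr_right fun _ => ?_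
  have h := diffusionForm_congr hqq'
  constructor <;> intro h1
  · filter_upwards [h, h1] with t h2 h3 φ
    rw [← diffusionForm_eq_inner hq', ← h2]
    exact h3 φ
  · filter_upwards [h, h1] with t h2 h3 φ
    rw [h2, diffusionForm_eq_inner hq']
    exact h3 φ

/-- Existence rules out the default value `0` in `forwardMap`. Which solution is chosen does not
matter: the continuity estimate holds for arbitrary weak solutions. -/
theorem isWeakSolution_forwardMap (hT : 0 < T) (hα0 : 0 < α) (hα1 : α < 1) {c₀ c₁ : ℝ}
    (hc₀ : 0 < c₀) (hc : c₀ < c₁) (u₀ : L2 Ω) {f : ℝ → HMinusOne Ω}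
    (hf : MemLp f 2 (timeMeasure T)) (hq : q ∈ admissibleSet Ω T c₀ c₁) :
    IsWeakSolution Ω T α u₀ f q (forwardMap Ω T α u₀ f q) := by
  have h : ∃ u, IsWeakSolution Ω T α u₀ f q u := by
    obtain ⟨q', hq', hq'0, hqq'⟩ := exists_boundedCoeff hc₀ hc hq
    obtain ⟨u, hu⟩ := exists_isVariationalSolution hT hα0 hα1 norm_sq_eq_val_add_grad u₀ hf hq'
      hc₀ hq'0
    exact ⟨u, (isWeakSolution_iff u₀ f hq' hqq' u).2 hu⟩
  rw [forwardMap, dif_pos h]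
  exact h.choose_spec

theorem memLp_observation (hT : 0 < T) (hα0 : 0 < α) (hα1 : α < 1) {c₀ c₁ : ℝ}
    (hc₀ : 0 < c₀) (hc : c₀ < c₁) (u₀ : L2 Ω) {f : ℝ → HMinusOne Ω}
    (hf : MemLp f 2 (timeMeasure T)) (hq : q ∈ admissibleSet Ω T c₀ c₁) :
    MemLp (observation Ω T α u₀ f q) 2 (timeMeasure T) :=
  H01.val.comp_memLp' (isWeakSolution_forwardMap hT hα0 hα1 hc₀ hc u₀ hf hq).1

/-- The forward map is continuous from `L²(Ω × (0,T))` to `L²(0,T;L²(Ω))` on the admissible set. -/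
theorem tendsto_observation (hT : 0 < T) (hα0 : 0 < α) (hα1 : α < 1) {c₀ c₁ : ℝ}
    (hc₀ : 0 < c₀) (hc : c₀ < c₁) (u₀ : L2 Ω) {f : ℝ → HMinusOne Ω}
    (hf : MemLp f 2 (timeMeasure T)) {qs : ℕ → E d × ℝ → ℝ}
    (hqs : ∀ j, qs j ∈ admissibleSet Ω T c₀ c₁) (hq : q ∈ admissibleSet Ω T c₀ c₁)
    (h : Tendsto (fun j => eLpNorm (qs j - q) 2 (cylMeasure Ω T)) atTop (𝓝 0)) :
    Tendsto (fun j => eLpNorm (observation Ω T α u₀ f (qs j) - observation Ω T α u₀ f q) 2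
      (timeMeasure T)) atTop (𝓝 0) := by
  -- `L²` convergence gives almost everywhere convergence only along subsequences, which is enough
  -- because the limit is always the same.
  refine tendsto_of_subseq_tendsto fun ns hns => ?_
  have hm : TendstoInMeasure (cylMeasure Ω T) (fun n => qs (ns n)) atTop q :=
    tendstoInMeasure_of_tendsto_eLpNorm (by norm_num) (fun n => (hqs (ns n)).1) hq.1 (h.comp hns)
  obtain ⟨ms, -, hms⟩ := hm.exists_seq_tendsto_ae
  refine ⟨ms, ?_⟩
  choose qs' hqs' hqs'0 hqsqs' using fun j => exists_boundedCoeff hc₀ hc (hqs j)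
  obtain ⟨q', hq', hq'0, hqq'⟩ := exists_boundedCoeff hc₀ hc hq
  have hu := isWeakSolution_forwardMap hT hα0 hα1 hc₀ hc u₀ hf hq
  have hus := fun j => isWeakSolution_forwardMap hT hα0 hα1 hc₀ hc u₀ hf (hqs j)
  have hlim : ∀ᵐ p ∂((volume.restrict Ω).prod (timeMeasure T)),
      Tendsto (fun j => qs' (ns (ms j)) p) atTop (𝓝 (q' p)) := by
    rw [← cylMeasure_eq_prod]
    have h1 : ∀ᵐ p ∂(cylMeasure Ω T), ∀ j, qs j p = qs' j p := ae_all_iff.2 hqsqs'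
    filter_upwards [hms, h1, hqq'] with p h2 h3 h4
    simpa only [h3, h4] using h2
  have h1 := tendsto_variationalSolution hT hα0 hα1 norm_sq_eq_val_add_grad u₀ hf hc₀
    (fun j => hqs' (ns (ms j))) (fun j => hqs'0 _) hq' hlim
    (fun j => (isWeakSolution_iff u₀ f (hqs' (ns (ms j))) (hqsqs' _) _).1 (hus _))
    ((isWeakSolution_iff u₀ f hq' hqq' _).1 hu)
  refine tendsto_of_tendsto_of_tendsto_of_le_of_le tendsto_const_nhds h1 (fun _ => zero_le)
    (fun j => eLpNorm_mono fun t => ?_)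
  simp only [Pi.sub_apply, observation, ← map_sub]
  exact norm_val_le _

end Forward

/-! ### Local compactness by mollification -/

section CauchySchwarz

variable {A : Type*} [MeasurableSpace A] {μ : Measure A}

theorem abs_integral_mul_le {f g : A → ℝ} (hf : MemLp f 2 μ) (hg : MemLp g 2 μ) :
    |∫ x, f x * g x ∂μ| ≤ (eLpNorm f 2 μ).toReal * (eLpNorm g 2 μ).toReal := by
  have h : ∫ x, f x * g x ∂μ = inner ℝ (hf.toLp f) (hg.toLp g) := by
    rw [L2.inner_def]
    refine integral_congr_ae ?_
    filter_upwards [hf.coeFn_toLp, hg.coeFn_toLp] with x h1 h2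
    rw [h1, h2]
    simp [mul_comm]
  rw [h, ← Lp.norm_toLp f hf, ← Lp.norm_toLp g hg]
  exact abs_real_inner_le_norm _ _

end CauchySchwarz

section Mollification

variable {P : Type*} [NormedAddCommGroup P] [NormedSpace ℝ P] [FiniteDimensional ℝ P]
  [MeasurableSpace P] [BorelSpace P] {μ : Measure P} [μ.IsAddHaarMeasure]

/-- `|∫ W ∂_h φ| ≤ N ‖h‖ ‖φ‖` for all test functions `φ`. -/
def HasWeakDerivBound (μ : Measure P) (N : ℝ) (W : P → ℝ) : Prop :=
  ∀ φ : P → ℝ, ContDiff ℝ ∞ φ → HasCompactSupport φ → ∀ h : P,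
    |∫ p, W p * fderiv ℝ φ p h ∂μ| ≤ N * ‖h‖ * (eLpNorm φ 2 μ).toReal

/-- As a function of `z`, `∫ W(t) φ(t - z) dt` is a convolution with smooth `φ(-·)`. The hypothesis,
applied to translates of `φ`, bounds its derivative, and the mean value inequality between `0` and
`-s` concludes. -/
theorem HasWeakDerivBound.abs_sub_le {N : ℝ} {W : P → ℝ} (hN : HasWeakDerivBound μ N W)
    (hN0 : 0 ≤ N) (hW : LocallyIntegrable W μ) {φ : P → ℝ} (hφ : ContDiff ℝ ∞ φ)
    (hφc : HasCompactSupport φ) (s : P) :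
    |∫ t, W t * φ (t + s) ∂μ - ∫ t, W t * φ t ∂μ| ≤ N * (eLpNorm φ 2 μ).toReal * ‖s‖ := by
  set ψ : P → ℝ := fun x => φ (-x) with hψ
  have hψd : ContDiff ℝ ∞ ψ := hφ.comp contDiff_neg
  have hψc : HasCompactSupport ψ := hφc.comp_homeomorph (Homeomorph.neg P)
  set C : P → ℝ := convolution W ψ (ContinuousLinearMap.lsmul ℝ ℝ) μ with hC
  have hCv : ∀ z, C z = ∫ t, W t * φ (t - z) ∂μ := fun z => by
    simp [hC, hψ, convolution_def]
  have hder : ∀ z, HasFDerivAt C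
      ((convolution W (fderiv ℝ ψ) ((ContinuousLinearMap.lsmul ℝ ℝ).precompR P) μ) z) z := fun z =>
    hψc.hasFDerivAt_convolution_right _ hW (hψd.of_le (by exact_mod_cast le_top)) z
  have hbound : ∀ z, ‖(convolution W (fderiv ℝ ψ)
      ((ContinuousLinearMap.lsmul ℝ ℝ).precompR P) μ) z‖ ≤ N * (eLpNorm φ 2 μ).toReal := by
    intro z
    refine ContinuousLinearMap.opNorm_le_bound _ (by positivity) fun h => ?_
    rw [convolution_precompR_apply _ hW (hψc.fderiv ℝ)
      (hψd.continuous_fderiv (by simp))]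
    have e1 : ∀ t, fderiv ℝ ψ (z - t) h = - fderiv ℝ (fun y => φ (y - z)) t h := by
      intro t
      have e0 : HasFDerivAt ψ ((fderiv ℝ φ (-(z - t))).comp (-ContinuousLinearMap.id ℝ P))
          (z - t) :=
        ((hφ.differentiable (by simp)) _).hasFDerivAt.comp (z - t) (hasFDerivAt_id _).neg
      rw [fderiv_comp_sub, e0.fderiv]
      simp
    have h1 := hN (fun y => φ (y - z)) (hφ.comp (contDiff_id.sub contDiff_const))
      (hφc.comp_homeomorph (Homeomorph.subRight z)) h
    have e2 : eLpNorm (fun y => φ (y - z)) 2 μ = eLpNorm φ 2 μ :=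
      eLpNorm_comp_measurePreserving hφ.continuous.aestronglyMeasurable
        (measurePreserving_sub_right μ z)
    rw [e2] at h1
    rw [convolution_def]
    simp only [e1, ContinuousLinearMap.lsmul_apply, smul_eq_mul, mul_neg, integral_neg, norm_neg,
      Real.norm_eq_abs]
    linarith
  have h2 := Convex.norm_image_sub_le_of_norm_hasFDerivWithin_le
    (fun z _ => (hder z).hasFDerivWithinAt) (fun z _ => hbound z) convex_univ
    (mem_univ (0 : P)) (mem_univ (-s))
  rw [hCv, hCv] at h2
  simpa using h2

/-- The mollification of `W` by the kernel `ρ`. -/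
noncomputable def mollify (μ : Measure P) (ρ W : P → ℝ) (x : P) : ℝ :=
  ∫ t, W t * ρ (x - t) ∂μ

theorem mollify_eq (ρ W : P → ℝ) :
    mollify μ ρ W = convolution W ρ (ContinuousLinearMap.lsmul ℝ ℝ) μ := by
  ext x
  simp [mollify, convolution_def]

theorem continuous_mollify {ρ W : P → ℝ} (hρ : Continuous ρ) (hρc : HasCompactSupport ρ)
    (hW : LocallyIntegrable W μ) : Continuous (mollify μ ρ W) := by
  rw [mollify_eq]
  exact hρc.continuous_convolution_right _ hW hρ

theorem hasCompactSupport_mollify {ρ W : P → ℝ} (hρc : HasCompactSupport ρ)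
    (hWc : HasCompactSupport W) : HasCompactSupport (mollify μ ρ W) := by
  rw [mollify_eq]
  exact hWc.convolution _ hρc

/-- By duality: tested with `φ`, the difference is the `ρ`-average of `∫ W φ - ∫ W φ(· + s)` over
`‖s‖ ≤ ε`. Each of these is at most `N ε ‖φ‖` by the translation estimate. -/
theorem HasWeakDerivBound.eLpNorm_sub_mollify_le {N ε : ℝ} {W ρ : P → ℝ}
    (hN : HasWeakDerivBound μ N W) (hN0 : 0 ≤ N) (hε : 0 ≤ ε) (hW : MemLp W 2 μ)
    (hWc : HasCompactSupport W)
    (hρ : Continuous ρ) (hρc : HasCompactSupport ρ) (hρ0 : ∀ x, 0 ≤ ρ x) (hρ1 : ∫ x, ρ x ∂μ = 1)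
    (hρs : ∀ x, ρ x ≠ 0 → ‖x‖ ≤ ε) :
    eLpNorm (W - mollify μ ρ W) 2 μ ≤ ENNReal.ofReal (N * ε) := by
  have hWl : LocallyIntegrable W μ := hW.locallyIntegrable (by norm_num)
  have hWi : Integrable W μ := by
    rw [← integrableOn_iff_integrable_of_support_subset (subset_tsupport W)]
    exact hWl.integrableOn_isCompact hWc
  have hρi : Integrable ρ μ := hρ.integrable_of_hasCompactSupport hρc
  have hmc := continuous_mollify hρ hρc hWl
  have hmL : MemLp (mollify μ ρ W) 2 μ :=
    hmc.memLp_of_hasCompactSupport (hasCompactSupport_mollify hρc hWc)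
  have hdL := hW.sub hmL
  have key : ∀ φ : P → ℝ, ContDiff ℝ ∞ φ → HasCompactSupport φ →
      |∫ x, (W x - mollify μ ρ W x) * φ x ∂μ| ≤ N * ε * (eLpNorm φ 2 μ).toReal := by
    intro φ hφ hφc
    have hφL : MemLp φ 2 μ := hφ.continuous.memLp_of_hasCompactSupport hφc
    have hm : ∀ x, mollify μ ρ W x = ∫ s, W (x - s) * ρ s ∂μ := by
      intro x
      rw [mollify_eq, convolution_lsmul_swap]
      rfl
    obtain ⟨B, hB⟩ := hφc.exists_bound_of_continuous hφ.continuous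
    have hint : Integrable (fun p : P × P => ρ p.2 * W (p.1 - p.2) * φ p.1) (μ.prod μ) := by
      refine Integrable.mul_bdd (c := B)
        (hρi.convolution_integrand (ContinuousLinearMap.mul ℝ ℝ) hWi) ?_ ?_
      · exact (hφ.continuous.comp continuous_fst).aestronglyMeasurable
      · exact Eventually.of_forall fun p => hB p.1
    have e1 : ∫ x, mollify μ ρ W x * φ x ∂μ = ∫ s, ρ s * ∫ t, W t * φ (t + s) ∂μ ∂μ := by
      calc ∫ x, mollify μ ρ W x * φ x ∂μ
          = ∫ x, ∫ s, ρ s * W (x - s) * φ x ∂μ ∂μ := by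
            refine integral_congr_ae (Eventually.of_forall fun x => ?_)
            simp only [hm, ← integral_mul_const, mul_comm (ρ _)]
        _ = ∫ s, ∫ x, ρ s * W (x - s) * φ x ∂μ ∂μ := integral_integral_swap hint
        _ = ∫ s, ρ s * ∫ t, W t * φ (t + s) ∂μ ∂μ := by
            refine integral_congr_ae (Eventually.of_forall fun s => ?_)
            simp only [mul_assoc, integral_const_mul]
            congr 1
            rw [← integral_sub_right_eq_self (fun t => W t * φ (t + s)) s]
            simp
    have e2 : ∫ x, W x * φ x ∂μ = ∫ s, ρ s * ∫ t, W t * φ t ∂μ ∂μ := by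
      rw [integral_mul_const, hρ1, one_mul]
    have hi1 : Integrable (fun s => ρ s * ∫ t, W t * φ (t + s) ∂μ) μ := by
      refine (hint.swap.integral_prod_left).congr (Eventually.of_forall fun s => ?_)
      simp only [Function.comp, Prod.swap, mul_assoc, integral_const_mul]
      congr 1
      rw [← integral_sub_right_eq_self (fun t => W t * φ (t + s)) s]
      simp
    simp only [sub_mul]
    rw [integral_sub (hφL.integrable_mul hW |>.congr (Eventually.of_forall fun x => mul_comm _ _))
      (hφL.integrable_mul hmL |>.congr (Eventually.of_forall fun x => mul_comm _ _)), e1, e2,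
      ← integral_sub (hρi.mul_const _) hi1]
    have h3 : ∫ s, ρ s * (N * ε * (eLpNorm φ 2 μ).toReal) ∂μ = N * ε * (eLpNorm φ 2 μ).toReal := by
      rw [integral_mul_const, hρ1, one_mul]
    rw [← h3, ← Real.norm_eq_abs]
    refine norm_integral_le_of_norm_le (hρi.mul_const _) (Eventually.of_forall fun s => ?_)
    rw [← mul_sub, norm_mul, Real.norm_of_nonneg (hρ0 s)]
    by_cases hs : ρ s = 0
    · simp [hs]
    refine mul_le_mul_of_nonneg_left ?_ (hρ0 s)
    rw [norm_sub_rev, Real.norm_eq_abs]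
    refine (hN.abs_sub_le hN0 hWl hφ hφc s).trans ?_
    have := hρs s hs
    have h4 : 0 ≤ N * (eLpNorm φ 2 μ).toReal := by positivity
    nlinarith
  set v := hdL.toLp _ with hv
  -- Test functions are dense in `L²`; taking `w = v` afterwards gives the norm bound.
  have hle : ∀ w : Lp ℝ 2 μ, |inner ℝ v w| ≤ N * ε * ‖w‖ := by
    intro w
    refine (Lp.dense_hasCompactSupport_contDiff (E := P) (F := ℝ) (μ := μ)
      (p := 2) (by norm_num)).induction (P := fun w => |inner ℝ v w| ≤ N * ε * ‖w‖) ?_ ?_ w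
    · rintro w ⟨φ, hw, hφc, hφ⟩
      have h1 := key φ hφ hφc
      rw [Lp.norm_def, eLpNorm_congr_ae hw, L2.inner_def]
      refine le_of_eq_of_le ?_ h1
      congr 1
      refine integral_congr_ae ?_
      filter_upwards [hdL.coeFn_toLp, hw] with x h1 h2
      rw [hv, h1, h2]
      simp [mul_comm]
    · exact isClosed_le (by fun_prop) (by fun_prop)
  have h5 : ‖v‖ ≤ N * ε := by
    have h6 := hle v
    rw [real_inner_self_eq_norm_sq, abs_of_nonneg (sq_nonneg _)] at h6
    by_contra h7
    push Not at h7
    have : 0 ≤ N * ε := by positivity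
    nlinarith
  rw [hv, Lp.norm_toLp] at h5
  exact (ENNReal.le_ofReal_iff_toReal_le hdL.eLpNorm_ne_top (by positivity)).2 h5

/-- At each `x` the mollification is the pairing of `W j` with the fixed function `ρ(x - ·)`, so
weak convergence gives pointwise convergence. Cauchy-Schwarz bounds it uniformly, and it is
supported in the compact set `K + tsupport ρ`. -/
theorem tendsto_mollify {ρ : P → ℝ} (hρ : Continuous ρ) (hρc : HasCompactSupport ρ)
    {K : Set P} (hK : IsCompact K) {W : ℕ → P → ℝ} (hW : ∀ j, MemLp (W j) 2 μ)
    (hWK : ∀ j, ∀ x ∉ K, W j x = 0) {M : ℝ} (hM : ∀ j, (eLpNorm (W j) 2 μ).toReal ≤ M)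
    (hlim : ∀ y : P → ℝ, MemLp y 2 μ → Tendsto (fun j => ∫ p, W j p * y p ∂μ) atTop (𝓝 0)) :
    Tendsto (fun j => eLpNorm (mollify μ ρ (W j)) 2 μ) atTop (𝓝 0) := by
  have hWl : ∀ j, LocallyIntegrable (W j) μ := fun j => (hW j).locallyIntegrable (by norm_num)
  have hmL : ∀ j, MemLp (mollify μ ρ (W j)) 2 μ := fun j =>
    (continuous_mollify hρ hρc (hWl j)).memLp_of_hasCompactSupport
      (hasCompactSupport_mollify hρc (HasCompactSupport.intro hK (hWK j)))
  have hρL : MemLp ρ 2 μ := hρ.memLp_of_hasCompactSupport hρc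
  have hρx : ∀ x, MemLp (fun t => ρ (x - t)) 2 μ := fun x =>
    hρL.comp_measurePreserving (Measure.measurePreserving_sub_left μ x)
  have hρn : ∀ x, eLpNorm (fun t => ρ (x - t)) 2 μ = eLpNorm ρ 2 μ := fun x =>
    eLpNorm_comp_measurePreserving hρ.aestronglyMeasurable
      (Measure.measurePreserving_sub_left μ x)
  set K' := (fun p : P × P => p.1 + p.2) '' (K ×ˢ tsupport ρ) with hK'
  have hK'c : IsCompact K' := (hK.prod hρc).image continuous_add
  set b := M * (eLpNorm ρ 2 μ).toReal with hb
  have hbd : ∀ j x, ‖mollify μ ρ (W j) x‖ ≤ K'.indicator (fun _ => b) x := by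
    intro j x
    by_cases hx : x ∈ K'
    · rw [indicator_of_mem hx, Real.norm_eq_abs]
      refine (abs_integral_mul_le (hW j) (hρx x)).trans ?_
      rw [hρn]
      exact mul_le_mul_of_nonneg_right (hM j) ENNReal.toReal_nonneg
    · rw [indicator_of_notMem hx, mollify, integral_eq_zero_of_ae, norm_zero]
      refine Eventually.of_forall fun t => ?_
      by_cases ht : t ∈ K
      · have : x - t ∉ tsupport ρ := fun h => hx ⟨(t, x - t), ⟨ht, h⟩, by simp⟩
        simp [image_eq_zero_of_notMem_tsupport this]
      · simp [hWK j t ht]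
  have h1 : Tendsto (fun j => (hmL j).toLp _) atTop (𝓝 (0 : Lp ℝ 2 μ)) := by
    refine tendsto_L2_of_dominated (g := K'.indicator fun _ => b) ?_ (fun j => ?_) ?_
    · exact memLp_indicator_const 2 hK'c.measurableSet b (Or.inr hK'c.measure_lt_top.ne)
    · filter_upwards [(hmL j).coeFn_toLp] with x hx
      rw [hx]
      exact hbd j x
    · filter_upwards [ae_all_iff.2 fun j => (hmL j).coeFn_toLp, Lp.coeFn_zero ℝ 2 μ] with x hx h0
      simp only [hx, h0]
      exact hlim _ (hρx x)
  have h2 := (tendsto_iff_norm_sub_tendsto_zero.1 h1)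
  simp only [sub_zero, Lp.norm_toLp] at h2
  rwa [← ENNReal.toReal_zero, ENNReal.tendsto_toReal_iff
    (fun j => (hmL j).eLpNorm_ne_top) (by simp)] at h2

/-- Weakly null sequences with bounded weak derivatives and supports in a fixed compact set
converge to `0` in `L²`. -/
theorem tendsto_eLpNorm_of_hasWeakDerivBound {K : Set P} (hK : IsCompact K) {W : ℕ → P → ℝ}
    (hW : ∀ j, MemLp (W j) 2 μ) (hWK : ∀ j, ∀ x ∉ K, W j x = 0)
    {M : ℝ} (hM : ∀ j, (eLpNorm (W j) 2 μ).toReal ≤ M)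
    {N : ℝ} (hN0 : 0 ≤ N) (hN : ∀ j, HasWeakDerivBound μ N (W j))
    (hlim : ∀ y : P → ℝ, MemLp y 2 μ → Tendsto (fun j => ∫ p, W j p * y p ∂μ) atTop (𝓝 0)) :
    Tendsto (fun j => eLpNorm (W j) 2 μ) atTop (𝓝 0) := by
  rw [ENNReal.tendsto_nhds_zero]
  intro η hη
  obtain ⟨r, hr0, hr⟩ : ∃ r : ℝ, 0 < r ∧ ENNReal.ofReal r ≤ η := by
    by_cases h : η = ⊤
    · exact ⟨1, one_pos, by simp [h]⟩
    · exact ⟨η.toReal, ENNReal.toReal_pos hη.ne' h, by rw [ENNReal.ofReal_toReal h]⟩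
  -- This gives `N ε ≤ r / 2` uniformly in `j`; `N + 1` avoids dividing by zero.
  set ε := r / (2 * (N + 1)) with hε
  have hε0 : 0 < ε := by positivity
  have hNε : N * ε ≤ r / 2 := by
    rw [hε, mul_div_assoc', div_le_div_iff₀ (by positivity) (by norm_num)]
    nlinarith
  let bump : ContDiffBump (0 : P) := ⟨ε / 2, ε, by positivity, by linarith⟩
  set ρ := bump.normed μ with hρ
  have hρc : Continuous ρ := bump.continuous_normed
  have hρs : HasCompactSupport ρ := bump.hasCompactSupport_normed
  have hlim' := tendsto_mollify hρc hρs hK hW hWK hM hlim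
  rw [ENNReal.tendsto_nhds_zero] at hlim'
  filter_upwards [hlim' (ENNReal.ofReal (r / 2)) (by simpa using hr0)] with j hj
  have hWc : HasCompactSupport (W j) := HasCompactSupport.intro hK (hWK j)
  have h1 := (hN j).eLpNorm_sub_mollify_le hN0 hε0.le (hW j) hWc hρc hρs
    (fun x => bump.nonneg_normed x) bump.integral_normed (fun x hx => by
      have : x ∈ Function.support (bump.normed μ) := hx
      rw [bump.support_normed_eq, mem_ball_zero_iff] at this
      exact this.le)
  have hm := (continuous_mollify hρc hρs
    ((hW j).locallyIntegrable (by norm_num))).aestronglyMeasurable (μ := μ)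
  calc eLpNorm (W j) 2 μ = eLpNorm ((W j - mollify μ ρ (W j)) + mollify μ ρ (W j)) 2 μ := by simp
    _ ≤ eLpNorm (W j - mollify μ ρ (W j)) 2 μ + eLpNorm (mollify μ ρ (W j)) 2 μ :=
        eLpNorm_add_le ((hW j).aestronglyMeasurable.sub hm) hm (by norm_num)
    _ ≤ ENNReal.ofReal (N * ε) + ENNReal.ofReal (r / 2) := add_le_add h1 hj
    _ ≤ ENNReal.ofReal (r / 2) + ENNReal.ofReal (r / 2) := by gcongr
    _ = ENNReal.ofReal r := by rw [← ENNReal.ofReal_add (by positivity) (by positivity)]; simp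
    _ ≤ η := hr

end Mollification

/-! ### Weak convergence in `L²` -/

section WeakConvergence

theorem exists_weakly_convergent_subseq {H : Type*} [NormedAddCommGroup H] [InnerProductSpace ℝ H]
    [CompleteSpace H] [SecondCountableTopology H] {x : ℕ → H} {C : ℝ} (hx : ∀ j, ‖x j‖ ≤ C) :
    ∃ k : ℕ → ℕ, StrictMono k ∧ ∃ x' : H, ∀ y : H,
      Tendsto (fun j => (inner ℝ (x (k j)) y : ℝ)) atTop (𝓝 (inner ℝ x' y)) := by
  have h1 := WeakDual.isSeqCompact_closedBall ℝ H 0 C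
  have h2 : ∀ j, StrongDual.toWeakDual (InnerProductSpace.toDual ℝ H (x j)) ∈
      WeakDual.toStrongDual ⁻¹' Metric.closedBall (0 : StrongDual ℝ H) C := by
    intro j
    simpa using hx j
  obtain ⟨l, -, k, hk, hl⟩ := h1 h2
  refine ⟨k, hk, (InnerProductSpace.toDual ℝ H).symm (WeakDual.toStrongDual l), fun y => ?_⟩
  rw [InnerProductSpace.toDual_symm_apply]
  exact ((WeakDual.eval_continuous y).tendsto l).comp hl

variable {A X : Type*} [MeasurableSpace A] [NormedAddCommGroup X] [InnerProductSpace ℝ X]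

/-- Weak convergence in `L²(ν; X)`. -/
def WeakTendsto (ν : Measure A) (w : ℕ → A → X) (w' : A → X) : Prop :=
  ∀ y : A → X, MemLp y 2 ν →
    Tendsto (fun j => ∫ x, inner ℝ (w j x) (y x) ∂ν) atTop (𝓝 (∫ x, inner ℝ (w' x) (y x) ∂ν))

theorem inner_toLp {ν : Measure A} {f g : A → X} (hf : MemLp f 2 ν) (hg : MemLp g 2 ν) :
    inner ℝ (hf.toLp f) (hg.toLp g) = ∫ x, inner ℝ (f x) (g x) ∂ν := by
  rw [L2.inner_def]
  refine integral_congr_ae ?_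
  filter_upwards [hf.coeFn_toLp, hg.coeFn_toLp] with x h1 h2
  rw [h1, h2]

theorem exists_weakTendsto_subseq [CompleteSpace X] [SecondCountableTopology X]
    [MeasurableSpace.CountablyGenerated A] {ν : Measure A} [SigmaFinite ν] {w : ℕ → A → X}
    (hw : ∀ j, MemLp (w j) 2 ν) {C : ℝ} (hC : ∀ j, (eLpNorm (w j) 2 ν).toReal ≤ C) :
    ∃ k : ℕ → ℕ, StrictMono k ∧ ∃ w' : A → X, MemLp w' 2 ν ∧
      WeakTendsto ν (fun j => w (k j)) w' := by
  have : Fact ((2 : ℝ≥0∞) ≠ ⊤) := ⟨by norm_num⟩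
  obtain ⟨k, hk, v, hv⟩ := exists_weakly_convergent_subseq (x := fun j => (hw j).toLp (w j))
    (fun j => by rw [Lp.norm_toLp]; exact hC j)
  refine ⟨k, hk, v, Lp.memLp v, fun y hy => ?_⟩
  have h1 := hv (hy.toLp y)
  simp only [inner_toLp] at h1
  rwa [← inner_toLp (Lp.memLp v) hy, Lp.toLp_coeFn]

theorem WeakTendsto.comp {ν : Measure A} {w : ℕ → A → X} {w' : A → X} (h : WeakTendsto ν w w')
    {k : ℕ → ℕ} (hk : StrictMono k) : WeakTendsto ν (fun j => w (k j)) w' := fun y hy =>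
  (h y hy).comp hk.tendsto_atTop

/-- Weak limits do not increase norms, and convergence of the norms implies strong convergence. -/
theorem WeakTendsto.norm_le_and_tendsto {ν : Measure A} {w : ℕ → A → X} {w' : A → X}
    (h : WeakTendsto ν w w') (hw : ∀ j, MemLp (w j) 2 ν) (hw' : MemLp w' 2 ν)
    {a : ℕ → ℝ} {b : ℝ} (hab : Tendsto a atTop (𝓝 b))
    (ha : ∀ j, (eLpNorm (w j) 2 ν).toReal ^ 2 ≤ a j) :
    (eLpNorm w' 2 ν).toReal ^ 2 ≤ b ∧ ((eLpNorm w' 2 ν).toReal ^ 2 = b →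
      Tendsto (fun j => eLpNorm (w j - w') 2 ν) atTop (𝓝 0)) := by
  -- The right-hand side tends to `b - ‖w'‖²`. Nonnegativity of the left gives the first claim, and
  -- equality gives strong convergence.
  have h1 : ∀ j, (eLpNorm (w j - w') 2 ν).toReal ^ 2 ≤
      a j - 2 * ∫ x, inner ℝ (w j x) (w' x) ∂ν + (eLpNorm w' 2 ν).toReal ^ 2 := by
    intro j
    have e := norm_sub_sq_real ((hw j).toLp _) (hw'.toLp _)
    rw [← MemLp.toLp_sub (hw j) hw', Lp.norm_toLp, Lp.norm_toLp, Lp.norm_toLp, inner_toLp] at e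
    linarith [ha j]
  have h2 : Tendsto (fun j => a j - 2 * ∫ x, inner ℝ (w j x) (w' x) ∂ν +
      (eLpNorm w' 2 ν).toReal ^ 2) atTop (𝓝 (b - (eLpNorm w' 2 ν).toReal ^ 2)) := by
    have h3 := ((hab.sub ((h w' hw').const_mul 2)).add_const ((eLpNorm w' 2 ν).toReal ^ 2))
    rw [← inner_toLp hw' hw', real_inner_self_eq_norm_sq, Lp.norm_toLp] at h3
    convert h3 using 2
    ring
  refine ⟨?_, fun hb => ?_⟩
  · have := ge_of_tendsto' h2 fun j => (sq_nonneg _).trans (h1 j)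
    linarith
  · rw [← hb, sub_self] at h2
    have h3 := (squeeze_zero (fun j => sq_nonneg _) h1 h2).sqrt
    simp only [Real.sqrt_zero, Real.sqrt_sq ENNReal.toReal_nonneg] at h3
    rwa [← ENNReal.toReal_zero, ENNReal.tendsto_toReal_iff
      (fun j => ((hw j).sub hw').eLpNorm_ne_top) (by simp)] at h3

/-- Testing with indicators shows that integrals over measurable sets converge, and these detect
pointwise bounds. -/
theorem WeakTendsto.ae_mem_Icc {ν : Measure A} [IsFiniteMeasure ν] {w : ℕ → A → ℝ} {w' : A → ℝ}
    (h : WeakTendsto ν w w') (hw : ∀ j, MemLp (w j) 2 ν) (hw' : MemLp w' 2 ν) {c₀ c₁ : ℝ}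
    (hc : ∀ j, ∀ᵐ x ∂ν, c₀ ≤ w j x ∧ w j x ≤ c₁) : ∀ᵐ x ∂ν, c₀ ≤ w' x ∧ w' x ≤ c₁ := by
  have hi : ∀ j, Integrable (w j) ν := fun j => (hw j).integrable (by norm_num)
  have hi' : Integrable w' ν := hw'.integrable (by norm_num)
  have key : ∀ s, MeasurableSet s →
      Tendsto (fun j => ∫ x in s, w j x ∂ν) atTop (𝓝 (∫ x in s, w' x ∂ν)) := by
    intro s hs
    have h1 := h (s.indicator fun _ => (1 : ℝ))
      (memLp_indicator_const 2 hs 1 (Or.inr (measure_ne_top _ _)))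
    have h2 : ∀ v : A → ℝ, ∫ x, inner ℝ (v x) (s.indicator (fun _ => (1 : ℝ)) x) ∂ν =
        ∫ x in s, v x ∂ν := by
      intro v
      rw [← integral_indicator hs]
      refine integral_congr_ae (Eventually.of_forall fun x => ?_)
      by_cases hx : x ∈ s <;> simp [hx]
    simpa only [h2] using h1
  have hl : (fun _ => c₀) ≤ᵐ[ν] w' :=
    ae_le_of_forall_setIntegral_le (integrable_const _) hi' fun s hs _ =>
      ge_of_tendsto' (key s hs) fun j => integral_mono_ae (integrable_const _).integrableOn
        (hi j).integrableOn (ae_restrict_of_ae ((hc j).mono fun x hx => hx.1))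
  have hr : w' ≤ᵐ[ν] fun _ => c₁ :=
    ae_le_of_forall_setIntegral_le hi' (integrable_const _) fun s hs _ =>
      le_of_tendsto' (key s hs) fun j => integral_mono_ae (hi j).integrableOn
        (integrable_const _).integrableOn (ae_restrict_of_ae ((hc j).mono fun x hx => hx.2))
  filter_upwards [hl, hr] with x h1 h2 using ⟨h1, h2⟩

end WeakConvergence

/-! ### Weak gradients on an open set -/

section WeakGradient

variable {P X : Type*} [NormedAddCommGroup P] [NormedSpace ℝ P] [FiniteDimensional ℝ P]
  [MeasurableSpace P] [BorelSpace P] {μ : Measure P} [μ.IsAddHaarMeasure]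
  [NormedAddCommGroup X] [InnerProductSpace ℝ X] {D : Set P} {ι : P →L[ℝ] X}

/-- `G` is the weak gradient of `q ∈ H¹(D)`, where the dual space of `P` is represented by means of
the inner product of `X` and the map `ι : P → X`. -/
structure HasGrad (μ : Measure P) (D : Set P) (ι : P →L[ℝ] X) (q : P → ℝ) (G : P → X) : Prop where
  memLp : MemLp q 2 (μ.restrict D)
  memLp_grad : MemLp G 2 (μ.restrict D)
  integral_eq : ∀ φ : P → ℝ, IsTestFunction D φ → ∀ h : P,
    ∫ p, q p * fderiv ℝ φ p h ∂(μ.restrict D) = -∫ p, inner ℝ (G p) (ι h) * φ p ∂(μ.restrict D)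

theorem IsTestFunction.memLp {φ : P → ℝ} (hφ : IsTestFunction D φ) {ν : Measure P}
    [IsFiniteMeasureOnCompacts ν] : MemLp φ 2 ν :=
  hφ.smooth.continuous.memLp_of_hasCompactSupport hφ.compact

theorem IsTestFunction.memLp_fderiv {φ : P → ℝ} (hφ : IsTestFunction D φ) (h : P) {ν : Measure P}
    [IsFiniteMeasureOnCompacts ν] : MemLp (fun p => fderiv ℝ φ p h) 2 ν := by
  have h1 : Continuous fun p => fderiv ℝ φ p h :=
    (hφ.smooth.continuous_fderiv (by simp)).clm_apply continuous_const
  exact h1.memLp_of_hasCompactSupport (hφ.compact.fderiv_apply ℝ h)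

namespace HasGrad

variable {q q₁ q₂ : P → ℝ} {G G₁ G₂ : P → X}

theorem integrable_fderiv (h : HasGrad μ D ι q G) {φ : P → ℝ} (hφ : IsTestFunction D φ) (v : P) :
    Integrable (fun p => q p * fderiv ℝ φ p v) (μ.restrict D) :=
  h.memLp.integrable_mul (hφ.memLp_fderiv v)

theorem integrable_inner (h : HasGrad μ D ι q G) {φ : P → ℝ} (hφ : IsTestFunction D φ) (x : X) :
    Integrable (fun p => inner ℝ (G p) x * φ p) (μ.restrict D) :=
  (h.memLp_grad.inner_const x).integrable_mul hφ.memLp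

theorem sub (h₁ : HasGrad μ D ι q₁ G₁) (h₂ : HasGrad μ D ι q₂ G₂) :
    HasGrad μ D ι (q₁ - q₂) (G₁ - G₂) where
  memLp := h₁.memLp.sub h₂.memLp
  memLp_grad := h₁.memLp_grad.sub h₂.memLp_grad
  integral_eq φ hφ v := by
    simp only [Pi.sub_apply, sub_mul, inner_sub_left]
    rw [integral_sub (h₁.integrable_fderiv hφ v) (h₂.integrable_fderiv hφ v),
      integral_sub (h₁.integrable_inner hφ _) (h₂.integrable_inner hφ _), h₁.integral_eq φ hφ,
      h₂.integral_eq φ hφ]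
    ring

theorem const [IsFiniteMeasure (μ.restrict D)] (c : ℝ) :
    HasGrad μ D ι (fun _ => c) (fun _ => (0 : X)) where
  memLp := memLp_const c
  memLp_grad := memLp_const 0
  integral_eq φ hφ v := by
    have h1 : ∫ p, fderiv ℝ φ p v ∂μ = 0 := by
      have h2 : Continuous fun p => fderiv ℝ φ p v :=
        (hφ.smooth.continuous_fderiv (by simp)).clm_apply continuous_const
      have h3 : Integrable (fun p => fderiv ℝ φ p v) μ :=
        h2.integrable_of_hasCompactSupport (hφ.compact.fderiv_apply ℝ v)
      have h4 : Integrable φ μ := hφ.smooth.continuous.integrable_of_hasCompactSupport hφ.compact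
      simpa using integral_mul_fderiv_eq_neg_fderiv_mul_of_integrable (μ := μ)
        (f := fun _ : P => (1 : ℝ)) (g := φ) (v := v) (by simp) (by simpa using h3)
        (by simpa using h4) (fun x _ => differentiableAt_const _)
        (fun x _ => hφ.smooth.differentiable (by simp) x)
    have h5 : ∫ p, fderiv ℝ φ p v ∂(μ.restrict D) = ∫ p, fderiv ℝ φ p v ∂μ := by
      refine setIntegral_eq_integral_of_forall_compl_eq_zero fun p hp => ?_
      have : p ∉ tsupport φ := fun h => hp (hφ.support h)
      rw [image_eq_zero_of_notMem_tsupport fun h => this (tsupport_fderiv_subset ℝ h)]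
      simp
    rw [integral_const_mul, h5, h1]
    simp

/-- The fundamental lemma of the calculus of variations. Surjectivity of `ι` ensures that the weak
formulation tests all directions of `X`. -/
theorem ae_eq [CompleteSpace X] (hD : IsOpen D) (hι : Function.Surjective ι)
    (h₁ : HasGrad μ D ι q G₁) (h₂ : HasGrad μ D ι q G₂) : G₁ =ᵐ[μ.restrict D] G₂ := by
  have hG := h₁.memLp_grad.sub h₂.memLp_grad
  have hl : LocallyIntegrableOn (G₁ - G₂) D μ :=
    locallyIntegrableOn_of_locallyIntegrable_restrict (hG.locallyIntegrable (by norm_num))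
  have h := hD.ae_eq_zero_of_integral_contDiff_smul_eq_zero hl fun φ hφ hφc hφs => by
    have ht : IsTestFunction D φ := ⟨hφ, hφc, hφs⟩
    have e1 : ∫ p, φ p • (G₁ - G₂) p ∂μ = ∫ p, φ p • (G₁ - G₂) p ∂(μ.restrict D) := by
      refine (setIntegral_eq_integral_of_forall_compl_eq_zero fun p hp => ?_).symm
      rw [image_eq_zero_of_notMem_tsupport fun h => hp (hφs h), zero_smul]
    rw [e1]
    have hint : Integrable (fun p => φ p • (G₁ - G₂) p) (μ.restrict D) :=
      memLp_one_iff_integrable.1 (hG.smul (p := 2) (q := 2) (r := 1) ht.memLp)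
    refine ext_inner_right ℝ fun x => ?_
    obtain ⟨v, rfl⟩ := hι x
    rw [inner_zero_left, real_inner_comm, ← integral_inner hint]
    have e2 := (h₁.sub h₂).integral_eq φ ht v
    rw [sub_self] at e2
    simp only [Pi.zero_apply, zero_mul, integral_zero] at e2
    rw [← neg_eq_zero, e2]
    congr 1
    refine integral_congr_ae (Eventually.of_forall fun p => ?_)
    simp only [inner_smul_right, real_inner_comm (ι v), mul_comm]
  filter_upwards [ae_restrict_of_ae h, ae_restrict_mem hD.measurableSet] with p hp hpD
  exact sub_eq_zero.1 (hp hpD)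

/-- Weak limits of weakly differentiable functions. -/
theorem of_weakTendsto {q : ℕ → P → ℝ} {G : ℕ → P → X} {q' : P → ℝ} {G' : P → X}
    (h : ∀ j, HasGrad μ D ι (q j) (G j)) (hq' : MemLp q' 2 (μ.restrict D))
    (hG' : MemLp G' 2 (μ.restrict D)) (hq : WeakTendsto (μ.restrict D) q q')
    (hG : WeakTendsto (μ.restrict D) G G') : HasGrad μ D ι q' G' where
  memLp := hq'
  memLp_grad := hG'
  integral_eq φ hφ v := by
    have h1 := hq _ (hφ.memLp_fderiv v)
    have h2 : MemLp (fun p => φ p • ι v) 2 (μ.restrict D) := by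
      have h3 : Continuous fun p => φ p • ι v := hφ.smooth.continuous.smul continuous_const
      exact h3.memLp_of_hasCompactSupport hφ.compact.smul_right
    have h4 := (hG _ h2).neg
    have e1 : ∀ f : P → ℝ, ∫ p, inner ℝ (f p) (fderiv ℝ φ p v) ∂(μ.restrict D) =
        ∫ p, f p * fderiv ℝ φ p v ∂(μ.restrict D) := by
      intro f
      simp [mul_comm]
    have e2 : ∀ f : P → X, ∫ p, inner ℝ (f p) (φ p • ι v) ∂(μ.restrict D) =
        ∫ p, inner ℝ (f p) (ι v) * φ p ∂(μ.restrict D) := by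
      intro f
      simp [inner_smul_right, mul_comm]
    simp only [e1, e2, (h _).integral_eq φ hφ] at h1 h4
    exact tendsto_nhds_unique h1 h4

end HasGrad

end WeakGradient

/-! ### Compactness in `L²` of bounded sequences in `H¹` -/

section Compactness

variable {P X : Type*} [NormedAddCommGroup P] [NormedSpace ℝ P] [FiniteDimensional ℝ P]
  [MeasurableSpace P] [BorelSpace P] {μ : Measure P} [μ.IsAddHaarMeasure]
  [NormedAddCommGroup X] [InnerProductSpace ℝ X] {D : Set P} {ι : P →L[ℝ] X}

theorem toReal_eLpNorm_le_mul {A Y Z : Type*} [MeasurableSpace A] [NormedAddCommGroup Y]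
    [NormedAddCommGroup Z] {ν : Measure A} {f : A → Y} {g : A → Z} (hg : MemLp g 2 ν) {c : ℝ}
    (hc : 0 ≤ c) (h : ∀ x, ‖f x‖ ≤ c * ‖g x‖) :
    (eLpNorm f 2 ν).toReal ≤ c * (eLpNorm g 2 ν).toReal := by
  have h1 := eLpNorm_le_mul_eLpNorm_of_ae_le_mul (μ := ν) (Eventually.of_forall h) 2
  refine (ENNReal.toReal_mono (ENNReal.mul_ne_top ENNReal.ofReal_ne_top hg.eLpNorm_ne_top)
    h1).trans ?_
  rw [ENNReal.toReal_mul, ENNReal.toReal_ofReal hc]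

theorem IsTestFunction.setIntegral_eq {χ : P → ℝ} (hχ : IsTestFunction D χ) (f : P → ℝ) :
    ∫ p, χ p * f p ∂(μ.restrict D) = ∫ p, χ p * f p ∂μ :=
  setIntegral_eq_integral_of_forall_compl_eq_zero fun p hp => by
    rw [image_eq_zero_of_notMem_tsupport fun h => hp (hχ.support h), zero_mul]

theorem IsTestFunction.memLp_mul {χ : P → ℝ} (hχ : IsTestFunction D χ) (hD : MeasurableSet D)
    {w : P → ℝ} (hw : MemLp w 2 (μ.restrict D)) : MemLp (fun p => χ p * w p) 2 μ := by
  obtain ⟨B, hB⟩ := hχ.compact.exists_bound_of_continuous hχ.smooth.continuous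
  have h1 : MemLp (fun p => χ p * w p) 2 (μ.restrict D) :=
    hw.of_le_mul (c := B) (hχ.smooth.continuous.aestronglyMeasurable.mul hw.1)
      (Eventually.of_forall fun p => by
        rw [norm_mul]
        exact mul_le_mul_of_nonneg_right (hB p) (norm_nonneg _))
  rw [← memLp_indicator_iff_restrict hD] at h1
  convert h1 using 1
  ext p
  by_cases hp : p ∈ D
  · rw [indicator_of_mem hp]
  · rw [indicator_of_notMem hp,
      image_eq_zero_of_notMem_tsupport fun h => hp (hχ.support h), zero_mul]

/-- The product `χ φ` is an admissible test function on `D` for every `φ` on the whole space. The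
Leibniz rule moves the derivative of `φ` onto `G` and `χ`. -/
theorem HasGrad.hasWeakDerivBound_mul {w χ : P → ℝ} {G : P → X} (h : HasGrad μ D ι w G)
    (hχ : IsTestFunction D χ) {B B' : ℝ} (hB : ∀ p, ‖χ p‖ ≤ B) (hB' : ∀ p, ‖fderiv ℝ χ p‖ ≤ B') :
    HasWeakDerivBound μ (B * ‖ι‖ * (eLpNorm G 2 (μ.restrict D)).toReal +
      B' * (eLpNorm w 2 (μ.restrict D)).toReal) (fun p => χ p * w p) := by
  intro φ hφ hφc v
  set ν := μ.restrict D with hν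
  have hB0 : 0 ≤ B := (norm_nonneg _).trans (hB 0)
  have hB0' : 0 ≤ B' := (norm_nonneg _).trans (hB' 0)
  have hχφ : IsTestFunction D (fun p => χ p * φ p) :=
    ⟨hχ.smooth.mul hφ, hχ.compact.mul_right, (tsupport_mul_subset_left).trans hχ.support⟩
  have hφL : MemLp φ 2 ν := hφ.continuous.memLp_of_hasCompactSupport hφc
  have hφle : (eLpNorm φ 2 ν).toReal ≤ (eLpNorm φ 2 μ).toReal :=
    ENNReal.toReal_mono (hφ.continuous.memLp_of_hasCompactSupport hφc).eLpNorm_ne_top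
      (eLpNorm_mono_measure _ Measure.restrict_le_self)
  have hχv : Continuous fun p => fderiv ℝ χ p v :=
    (hχ.smooth.continuous_fderiv (by simp)).clm_apply continuous_const
  have hχvL : MemLp (fun p => fderiv ℝ χ p v * w p) 2 ν :=
    h.memLp.of_le_mul (c := B' * ‖v‖) (hχv.aestronglyMeasurable.mul h.memLp.1)
      (Eventually.of_forall fun p => by
        rw [norm_mul]
        refine mul_le_mul_of_nonneg_right (((fderiv ℝ χ p).le_opNorm v).trans ?_) (norm_nonneg _)
        exact mul_le_mul_of_nonneg_right (hB' p) (norm_nonneg _))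
  have hGi : MemLp (fun p => inner ℝ (G p) (ι v)) 2 ν := h.memLp_grad.inner_const (ι v)
  have hGL : MemLp (fun p => χ p * inner ℝ (G p) (ι v)) 2 ν :=
    hGi.of_le_mul (c := B) (hχ.smooth.continuous.aestronglyMeasurable.mul hGi.1)
      (Eventually.of_forall fun p => by
        rw [norm_mul]
        exact mul_le_mul_of_nonneg_right (hB p) (norm_nonneg _))
  have e1 : ∀ p, fderiv ℝ (fun p => χ p * φ p) p v =
      χ p * fderiv ℝ φ p v + φ p * fderiv ℝ χ p v := by
    intro p
    rw [fderiv_fun_mul (hχ.smooth.differentiable (by simp) p) (hφ.differentiable (by simp) p)]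
    simp
  have e2 : ∫ p, χ p * w p * fderiv ℝ φ p v ∂μ =
      -∫ p, χ p * inner ℝ (G p) (ι v) * φ p ∂ν - ∫ p, fderiv ℝ χ p v * w p * φ p ∂ν := by
    have h2 := h.integral_eq _ hχφ v
    have h3 : ∫ p, χ p * w p * fderiv ℝ φ p v ∂μ = ∫ p, χ p * w p * fderiv ℝ φ p v ∂ν := by
      simp only [mul_assoc]
      exact (hχ.setIntegral_eq _).symm
    have h4 : ∫ p, χ p * inner ℝ (G p) (ι v) * φ p ∂ν =
        ∫ p, inner ℝ (G p) (ι v) * (χ p * φ p) ∂ν := by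
      congr 1 with p
      ring
    have h5 : Integrable (fun p => fderiv ℝ χ p v * w p * φ p) ν := hχvL.integrable_mul hφL
    rw [h3, h4, ← h2, ← integral_sub (h.integrable_fderiv hχφ v) h5]
    congr 1 with p
    rw [e1]
    ring
  rw [e2]
  have h5 := abs_integral_mul_le hGL hφL
  have h6 := abs_integral_mul_le hχvL hφL
  have h7 : (eLpNorm (fun p => χ p * inner ℝ (G p) (ι v)) 2 ν).toReal ≤
      B * (‖ι‖ * ‖v‖) * (eLpNorm G 2 ν).toReal := by
    refine toReal_eLpNorm_le_mul h.memLp_grad (by positivity) fun p => ?_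
    rw [norm_mul, mul_assoc]
    refine mul_le_mul (hB p) ((norm_inner_le_norm _ _).trans ?_) (norm_nonneg _) hB0
    rw [mul_comm]
    exact mul_le_mul_of_nonneg_right (ι.le_opNorm v) (norm_nonneg _)
  have h8 : (eLpNorm (fun p => fderiv ℝ χ p v * w p) 2 ν).toReal ≤
      B' * ‖v‖ * (eLpNorm w 2 ν).toReal := by
    refine toReal_eLpNorm_le_mul h.memLp (by positivity) fun p => ?_
    rw [norm_mul]
    refine mul_le_mul_of_nonneg_right (((fderiv ℝ χ p).le_opNorm v).trans ?_) (norm_nonneg _)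
    exact mul_le_mul_of_nonneg_right (hB' p) (norm_nonneg _)
  calc |-∫ p, χ p * inner ℝ (G p) (ι v) * φ p ∂ν - ∫ p, fderiv ℝ χ p v * w p * φ p ∂ν|
      ≤ |∫ p, χ p * inner ℝ (G p) (ι v) * φ p ∂ν| + |∫ p, fderiv ℝ χ p v * w p * φ p ∂ν| := by
        rw [← abs_neg (∫ p, χ p * inner ℝ (G p) (ι v) * φ p ∂ν)]
        exact abs_sub _ _
    _ ≤ B * (‖ι‖ * ‖v‖) * (eLpNorm G 2 ν).toReal * (eLpNorm φ 2 μ).toReal +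
        B' * ‖v‖ * (eLpNorm w 2 ν).toReal * (eLpNorm φ 2 μ).toReal :=
        add_le_add (h5.trans (by gcongr)) (h6.trans (by gcongr))
    _ = _ := by ring

theorem exists_isTestFunction_eqOn_one (hD : IsOpen D) {K : Set P} (hK : IsCompact K)
    (hKD : K ⊆ D) : ∃ χ : P → ℝ, IsTestFunction D χ ∧ EqOn χ 1 K ∧ ∀ p, χ p ∈ Icc (0 : ℝ) 1 := by
  obtain ⟨K', hK', hKK', hK'D⟩ := exists_compact_between hK hD hKD
  obtain ⟨χ, h0, h1, h2⟩ := exists_contMDiffMap_zero_one_of_isClosed (n := (⊤ : ℕ∞))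
    (modelWithCornersSelf ℝ P) (isOpen_interior (s := K')).isClosed_compl hK.isClosed
    (disjoint_left.2 fun p hp hpK => hp (hKK' hpK))
  have hs : tsupport χ ⊆ K' := by
    refine closure_minimal (fun p hp => ?_) hK'.isClosed
    by_contra hpK
    exact hp (h0 fun h => hpK (interior_subset h))
  exact ⟨χ, ⟨χ.contMDiff.contDiff, hK'.of_isClosed_subset (isClosed_tsupport _) hs,
    hs.trans hK'D⟩, h1, h2⟩

/-- A bounded sequence in `H¹(D)` that is uniformly bounded and converges weakly to `0` in `L²(D)`
converges strongly to `0` in `L²(D)`. -/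
theorem tendsto_eLpNorm_of_weakTendsto_zero (hD : IsOpen D) (hDfin : μ D ≠ ⊤) {w : ℕ → P → ℝ}
    {G : ℕ → P → X} (h : ∀ j, HasGrad μ D ι (w j) (G j)) {C b : ℝ}
    (hwC : ∀ j, (eLpNorm (w j) 2 (μ.restrict D)).toReal ≤ C)
    (hGC : ∀ j, (eLpNorm (G j) 2 (μ.restrict D)).toReal ≤ C)
    (hb : ∀ j, ∀ᵐ p ∂(μ.restrict D), ‖w j p‖ ≤ b)
    (hw : WeakTendsto (μ.restrict D) w (fun _ => 0)) :
    Tendsto (fun j => eLpNorm (w j) 2 (μ.restrict D)) atTop (𝓝 0) := by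
  have hC0 : 0 ≤ C := ENNReal.toReal_nonneg.trans (hwC 0)
  -- Interior part: after multiplication by a cutoff, the functions live on all of `P` with support
  -- in a fixed compact set.
  have hloc : ∀ χ : P → ℝ, IsTestFunction D χ →
      Tendsto (fun j => eLpNorm (fun p => χ p * w j p) 2 μ) atTop (𝓝 0) := by
    intro χ hχ
    obtain ⟨B, hB⟩ := hχ.compact.exists_bound_of_continuous hχ.smooth.continuous
    obtain ⟨B', hB'⟩ := (hχ.compact.fderiv ℝ).exists_bound_of_continuous
      (hχ.smooth.continuous_fderiv (by simp))
    have hB0 : 0 ≤ B := (norm_nonneg _).trans (hB 0)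
    have hB0' : 0 ≤ B' := (norm_nonneg _).trans (hB' 0)
    have hL : ∀ j, MemLp (fun p => χ p * w j p) 2 μ := fun j =>
      hχ.memLp_mul hD.measurableSet (h j).memLp
    have hnu : ∀ j, eLpNorm (fun p => χ p * w j p) 2 μ =
        eLpNorm (fun p => χ p * w j p) 2 (μ.restrict D) := by
      intro j
      rw [← eLpNorm_indicator_eq_eLpNorm_restrict hD.measurableSet]
      congr 1
      ext p
      by_cases hp : p ∈ D
      · rw [indicator_of_mem hp]
      · rw [indicator_of_notMem hp,
          image_eq_zero_of_notMem_tsupport fun h => hp (hχ.support h), zero_mul]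
    refine tendsto_eLpNorm_of_hasWeakDerivBound (K := tsupport χ) hχ.compact hL
      (fun j p hp => by rw [image_eq_zero_of_notMem_tsupport hp, zero_mul])
      (M := B * C) (fun j => ?_) (N := B * ‖ι‖ * C + B' * C) (by positivity) (fun j => ?_) ?_
    · rw [hnu]
      refine (toReal_eLpNorm_le_mul (h j).memLp hB0 fun p => ?_).trans
        (mul_le_mul_of_nonneg_left (hwC j) hB0)
      rw [norm_mul]
      exact mul_le_mul_of_nonneg_right (hB p) (norm_nonneg _)
    · intro φ hφ hφc v
      refine ((h j).hasWeakDerivBound_mul hχ hB hB' φ hφ hφc v).trans ?_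
      have h1 := hwC j
      have h2 := hGC j
      gcongr
    · intro y hy
      have hy' : MemLp (fun p => χ p * y p) 2 (μ.restrict D) :=
        (hχ.memLp_mul hD.measurableSet (hy.restrict D)).restrict D
      have h1 := hw _ hy'
      simp only [inner_zero_left, integral_zero] at h1
      refine h1.congr fun j => ?_
      simp only [mul_assoc]
      rw [← hχ.setIntegral_eq (fun p => w j p * y p)]
      congr 1 with p
      simp only [RCLike.inner_apply, conj_trivial]
      ring
  rw [ENNReal.tendsto_nhds_zero]
  intro η hη
  -- Boundary part: off a compact `K` the norm is at most `|b| μ(D \ K)^(1/2)`, small uniformly in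
  -- `j` by inner regularity.
  have hcont : Tendsto (fun r : ℝ≥0∞ => ‖b‖ₑ * r ^ (1 / (2 : ℝ≥0∞).toReal)) (𝓝 0) (𝓝 0) := by
    have h1 : Tendsto (fun r : ℝ≥0∞ => r ^ (1 / (2 : ℝ≥0∞).toReal)) (𝓝 0) (𝓝 0) := by
      have := (ENNReal.continuous_rpow_const (y := 1 / (2 : ℝ≥0∞).toReal)).tendsto 0
      rwa [ENNReal.zero_rpow_of_pos (by simp)] at this
    simpa using ENNReal.Tendsto.const_mul h1 (Or.inr enorm_ne_top)
  obtain ⟨ε, hε, hε'⟩ := (ENNReal.nhds_zero_basis_Iic).eventually_iff.1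
    (ENNReal.tendsto_nhds_zero.1 hcont (η / 2) (ENNReal.half_pos hη.ne'))
  obtain ⟨K, hKD, hK, hKε⟩ := hD.measurableSet.exists_isCompact_sdiff_lt hDfin hε.ne'
  obtain ⟨χ, hχ, hχ1, hχ01⟩ := exists_isTestFunction_eqOn_one hD hK hKD
  filter_upwards [ENNReal.tendsto_nhds_zero.1 (hloc χ hχ) (η / 2) (ENNReal.half_pos hη.ne')]
    with j hj
  have hm1 : AEStronglyMeasurable (fun p => χ p * w j p) (μ.restrict D) :=
    hχ.smooth.continuous.aestronglyMeasurable.mul (h j).memLp.1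
  have hm2 : AEStronglyMeasurable (fun p => (1 - χ p) * w j p) (μ.restrict D) :=
    (continuous_const.sub hχ.smooth.continuous).aestronglyMeasurable.mul (h j).memLp.1
  have h2 : eLpNorm (fun p => (1 - χ p) * w j p) 2 (μ.restrict D) ≤ η / 2 := by
    have h3 : eLpNorm (fun p => (1 - χ p) * w j p) 2 (μ.restrict D) ≤
        eLpNorm (Kᶜ.indicator fun _ => b) 2 (μ.restrict D) := by
      refine eLpNorm_mono_ae ?_
      filter_upwards [hb j] with p hp
      by_cases hpK : p ∈ K
      · rw [hχ1 hpK]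
        simp
      · rw [indicator_of_mem (show p ∈ Kᶜ from hpK), norm_mul]
        have h4 : ‖1 - χ p‖ ≤ 1 := by
          have := hχ01 p
          rw [Real.norm_eq_abs, abs_le]
          constructor <;> linarith [this.1, this.2]
        have h5 := norm_nonneg (w j p)
        have h6 := le_abs_self b
        rw [Real.norm_eq_abs b]
        nlinarith
    refine h3.trans ?_
    rw [eLpNorm_indicator_const hK.isClosed.isOpen_compl.measurableSet (by norm_num) (by norm_num),
      Measure.restrict_apply hK.isClosed.isOpen_compl.measurableSet]
    refine hε' ?_
    rw [inter_comm, ← sdiff_eq]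
    exact hKε.le
  calc eLpNorm (w j) 2 (μ.restrict D)
      = eLpNorm ((fun p => χ p * w j p) + fun p => (1 - χ p) * w j p) 2 (μ.restrict D) := by
        congr 1
        ext p
        simp only [Pi.add_apply]
        ring
    _ ≤ eLpNorm (fun p => χ p * w j p) 2 (μ.restrict D) +
        eLpNorm (fun p => (1 - χ p) * w j p) 2 (μ.restrict D) :=
        eLpNorm_add_le hm1 hm2 (by norm_num)
    _ ≤ η / 2 + η / 2 :=
        add_le_add ((eLpNorm_mono_measure _ Measure.restrict_le_self).trans hj) h2
    _ = η := ENNReal.add_halves η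

/-- Compactness of bounded sequences in `H¹(D) ∩ {c₀ ≤ q ≤ c₁}`. -/
theorem exists_subseq_tendsto_of_hasGrad [CompleteSpace X] [SecondCountableTopology X]
    (hD : IsOpen D) (hDfin : μ D ≠ ⊤) {q : ℕ → P → ℝ} {G : ℕ → P → X}
    (h : ∀ j, HasGrad μ D ι (q j) (G j)) {C c₀ c₁ : ℝ}
    (hGC : ∀ j, (eLpNorm (G j) 2 (μ.restrict D)).toReal ≤ C)
    (hc : ∀ j, ∀ᵐ p ∂(μ.restrict D), c₀ ≤ q j p ∧ q j p ≤ c₁) :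
    ∃ k : ℕ → ℕ, StrictMono k ∧ ∃ q' G', HasGrad μ D ι q' G' ∧
      (∀ᵐ p ∂(μ.restrict D), c₀ ≤ q' p ∧ q' p ≤ c₁) ∧
      Tendsto (fun j => eLpNorm (q (k j) - q') 2 (μ.restrict D)) atTop (𝓝 0) ∧
      WeakTendsto (μ.restrict D) (fun j => G (k j)) G' := by
  have : IsFiniteMeasure (μ.restrict D) := isFiniteMeasure_restrict.2 hDfin
  set ν := μ.restrict D with hν
  set b := max |c₀| |c₁| with hb
  have hbd : ∀ f : P → ℝ, (∀ᵐ p ∂ν, c₀ ≤ f p ∧ f p ≤ c₁) → ∀ᵐ p ∂ν, ‖f p‖ ≤ b := fun f hf =>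
    hf.mono fun p hp => abs_le_max_abs_abs hp.1 hp.2
  have hbn : ∀ (f : P → ℝ) (c : ℝ), (∀ᵐ p ∂ν, ‖f p‖ ≤ c) →
      (eLpNorm f 2 ν).toReal ≤ (eLpNorm (fun _ => c) 2 ν).toReal := fun f c hf =>
    ENNReal.toReal_mono (memLp_const c).eLpNorm_ne_top
      (eLpNorm_mono_ae (hf.mono fun p hp => hp.trans (le_abs_self _)))
  obtain ⟨k₁, hk₁, q', hq', hqw⟩ := exists_weakTendsto_subseq (fun j => (h j).memLp)
    (fun j => hbn _ _ (hbd _ (hc j)))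
  obtain ⟨k₂, hk₂, G', hG', hGw⟩ := exists_weakTendsto_subseq
    (fun j => (h (k₁ j)).memLp_grad) (fun j => hGC (k₁ j))
  have hqw' := hqw.comp hk₂
  have hg : HasGrad μ D ι q' G' :=
    HasGrad.of_weakTendsto (fun j => h (k₁ (k₂ j))) hq' hG' hqw' hGw
  have hc' := hqw'.ae_mem_Icc (fun j => (h (k₁ (k₂ j))).memLp) hq' (fun j => hc _)
  refine ⟨fun j => k₁ (k₂ j), hk₁.comp hk₂, q', G', hg, hc', ?_, hGw⟩
  have hbd2 : ∀ j, ∀ᵐ p ∂ν, ‖(q (k₁ (k₂ j)) - q') p‖ ≤ b + b := fun j => by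
    filter_upwards [hbd _ (hc (k₁ (k₂ j))), hbd _ hc'] with p h1 h2
    exact (norm_sub_le _ _).trans (add_le_add h1 h2)
  refine tendsto_eLpNorm_of_weakTendsto_zero hD hDfin (fun j => (h (k₁ (k₂ j))).sub hg)
    (C := max (eLpNorm (fun _ : P => b + b) 2 ν).toReal (C + (eLpNorm G' 2 ν).toReal))
    (fun j => (hbn _ _ (hbd2 j)).trans (le_max_left _ _)) (fun j => ?_) hbd2 ?_
  · refine le_trans ?_ (le_max_right _ _)
    have h1 := (h (k₁ (k₂ j))).memLp_grad
    rw [← Lp.norm_toLp _ (h1.sub hG'), MemLp.toLp_sub h1 hG']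
    refine (norm_sub_le _ _).trans ?_
    rw [Lp.norm_toLp, Lp.norm_toLp]
    exact add_le_add (hGC _) le_rfl
  · intro y hy
    have h1 := (hqw' y hy).sub_const (∫ x, inner ℝ (q' x) (y x) ∂ν)
    rw [sub_self] at h1
    simp only [inner_zero_left, integral_zero]
    refine h1.congr fun j => ?_
    rw [← inner_toLp (h (k₁ (k₂ j))).memLp hy, ← inner_toLp hq' hy, ← inner_sub_left,
      ← MemLp.toLp_sub, inner_toLp ((h (k₁ (k₂ j))).memLp.sub hq') hy]

end Compactness

/-! ### The space-time gradient and convergence in `H¹(Ω × (0,T))` -/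

section SpaceTimeGradient

variable {d : ℕ} {Ω : Set (E d)} {T : ℝ} {q : E d × ℝ → ℝ}

instance : (volume : Measure (E d × ℝ)).IsAddHaarMeasure := by
  rw [Measure.volume_eq_prod]
  infer_instance

/-- The identification of `ℝ^d × ℝ` with the Hilbert space of space-time gradients. -/
noncomputable def gradEmb (d : ℕ) : E d × ℝ →L[ℝ] WithLp 2 (E d × ℝ) :=
  (WithLp.prodContinuousLinearEquiv 2 ℝ (E d) ℝ).symm

theorem gradEmb_surjective : Function.Surjective (gradEmb d) :=
  (WithLp.prodContinuousLinearEquiv 2 ℝ (E d) ℝ).symm.surjective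

theorem HasWeakGradient.hasGrad {Gx : E d × ℝ → E d} {Gt : E d × ℝ → ℝ}
    (h : HasWeakGradient Ω T q Gx Gt) :
    HasGrad volume (Ω ×ˢ Ioo 0 T) (gradEmb d) q (fun p => gradEmb d (Gx p, Gt p)) where
  memLp := h.memLp
  memLp_grad := by
    have h1 := ((gradEmb d).comp (ContinuousLinearMap.inl ℝ (E d) ℝ)).comp_memLp' h.memLp_x
    have h2 := ((gradEmb d).comp (ContinuousLinearMap.inr ℝ (E d) ℝ)).comp_memLp' h.memLp_t
    refine (h1.add h2).ae_eq (Eventually.of_forall fun p => ?_)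
    simp [← map_add]
  integral_eq φ hφ v := by
    have e1 : ∀ p, q p * fderiv ℝ φ p v =
        q p * fderiv ℝ φ p (v.1, 0) + v.2 * (q p * fderiv ℝ φ p (0, 1)) := by
      intro p
      have : v = (v.1, 0) + v.2 • ((0 : E d), (1 : ℝ)) := by ext <;> simp
      conv_lhs => rw [this, map_add, map_smul, smul_eq_mul]
      ring
    have e2 : ∀ p, inner ℝ (gradEmb d (Gx p, Gt p)) (gradEmb d v) * φ p =
        inner ℝ (Gx p) v.1 * φ p + v.2 * (Gt p * φ p) := by
      intro p
      have : (inner ℝ (gradEmb d (Gx p, Gt p)) (gradEmb d v) : ℝ) =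
        inner ℝ (Gx p) v.1 + inner ℝ (Gt p) v.2 := rfl
      rw [this, RCLike.inner_apply, conj_trivial]
      ring
    have i1 : ∀ w, Integrable (fun p => q p * fderiv ℝ φ p w) (cylMeasure Ω T) := fun w =>
      h.memLp.integrable_mul (hφ.memLp_fderiv w)
    have i2 : Integrable (fun p => inner ℝ (Gx p) v.1 * φ p) (cylMeasure Ω T) :=
      (h.memLp_x.inner_const v.1).integrable_mul hφ.memLp
    have i3 : Integrable (fun p => Gt p * φ p) (cylMeasure Ω T) :=
      h.memLp_t.integrable_mul hφ.memLp
    simp only [e1, e2]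
    rw [integral_add (i1 _) ((i1 _).const_mul _), integral_const_mul, h.deriv_x φ hφ,
      h.deriv_t φ hφ, integral_add i2 (i3.const_mul _), integral_const_mul]
    ring

theorem HasGrad.hasWeakGradient {G : E d × ℝ → WithLp 2 (E d × ℝ)}
    (h : HasGrad volume (Ω ×ˢ Ioo 0 T) (gradEmb d) q G) :
    HasWeakGradient Ω T q (fun p => (G p).fst) (fun p => (G p).snd) where
  memLp := h.memLp
  memLp_x := (WithLp.fstL 2 ℝ (E d) ℝ).comp_memLp' h.memLp_grad
  memLp_t := (WithLp.sndL 2 ℝ (E d) ℝ).comp_memLp' h.memLp_grad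
  deriv_x φ hφ v := by
    rw [h.integral_eq φ hφ]
    congr 1
    refine integral_congr_ae (Eventually.of_forall fun p => ?_)
    have : (inner ℝ (G p) (gradEmb d (v, 0)) : ℝ) =
        inner ℝ (G p).fst v + inner ℝ (G p).snd (0 : ℝ) := rfl
    simp only [this, inner_zero_right, add_zero]
  deriv_t φ hφ := by
    rw [h.integral_eq φ hφ]
    congr 1
    refine integral_congr_ae (Eventually.of_forall fun p => ?_)
    have : (inner ℝ (G p) (gradEmb d (0, 1)) : ℝ) =
        inner ℝ (G p).fst (0 : E d) + inner ℝ (G p).snd (1 : ℝ) := rfl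
    simp only [this, inner_zero_right, zero_add, RCLike.inner_apply, conj_trivial, one_mul]

theorem memH1_iff : MemH1 Ω T q ↔
    ∃ G, HasGrad volume (Ω ×ˢ Ioo 0 T) (gradEmb d) q G :=
  ⟨fun ⟨_, _, h⟩ => ⟨_, h.hasGrad⟩, fun ⟨_, h⟩ => ⟨_, _, h.hasWeakGradient⟩⟩

theorem lintegral_enorm_sq_add {ν : Measure (E d × ℝ)} (Gx : E d × ℝ → E d) (Gt : E d × ℝ → ℝ) :
    ∫⁻ p, (‖Gx p‖ₑ ^ 2 + ‖Gt p‖ₑ ^ 2) ∂ν = eLpNorm (fun p => gradEmb d (Gx p, Gt p)) 2 ν ^ 2 := by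
  have h1 := eLpNorm_nnreal_pow_eq_lintegral (μ := ν) (p := 2)
    (f := fun p => gradEmb d (Gx p, Gt p)) (by norm_num)
  have h2 : ((2 : NNReal) : ℝ) = ((2 : ℕ) : ℝ) := by norm_num
  simp only [h2, ENNReal.rpow_natCast] at h1
  have h3 : ((2 : NNReal) : ℝ≥0∞) = 2 := by norm_num
  rw [h3] at h1
  rw [h1]
  refine lintegral_congr fun p => ?_
  have h4 : ‖gradEmb d (Gx p, Gt p)‖ ^ 2 = ‖Gx p‖ ^ 2 + ‖Gt p‖ ^ 2 :=
    WithLp.prod_norm_sq_eq_of_L2 _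
  simp only [← ofReal_norm, ← ENNReal.ofReal_pow (norm_nonneg _)]
  rw [h4, ENNReal.ofReal_add (by positivity) (by positivity)]

/-- Uniqueness of the weak gradient reduces the infimum to a single value. -/
theorem h1SeminormSq_eq (hΩ : IsOpen Ω) {G : E d × ℝ → WithLp 2 (E d × ℝ)}
    (h : HasGrad volume (Ω ×ˢ Ioo 0 T) (gradEmb d) q G) :
    h1SeminormSq Ω T q = eLpNorm G 2 (cylMeasure Ω T) ^ 2 := by
  refine le_antisymm ?_ ?_
  · refine (iInf₂_le_of_le _ _ (iInf_le_of_le h.hasWeakGradient le_rfl)).trans ?_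
    rw [lintegral_enorm_sq_add]
    exact le_rfl
  · refine le_iInf₂ fun Gx Gt => le_iInf fun h' => ?_
    rw [lintegral_enorm_sq_add,
      eLpNorm_congr_ae (h.ae_eq (hΩ.prod isOpen_Ioo) gradEmb_surjective h'.hasGrad)]

theorem h1SeminormSq_eq_top (h : ¬ MemH1 Ω T q) : h1SeminormSq Ω T q = ⊤ := by
  refine iInf₂_eq_top.2 fun Gx Gt => iInf_eq_top.2 fun h' => ?_
  exact absurd ⟨Gx, Gt, h'⟩ h

theorem MemH1.h1SeminormSq_ne_top (hΩ : IsOpen Ω) (h : MemH1 Ω T q) :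
    h1SeminormSq Ω T q ≠ ⊤ := by
  obtain ⟨G, hG⟩ := memH1_iff.1 h
  rw [h1SeminormSq_eq hΩ hG]
  exact ENNReal.pow_ne_top hG.memLp_grad.eLpNorm_ne_top

theorem MemH1.memLp (h : MemH1 Ω T q) : MemLp q 2 (cylMeasure Ω T) := by
  obtain ⟨_, _, h⟩ := h
  exact h.memLp

theorem tendsto_toReal_eLpNorm_sub {A Y : Type*} [MeasurableSpace A] [NormedAddCommGroup Y]
    {ν : Measure A} {f g : ℕ → A → Y} {f' g' : A → Y} (hf : ∀ j, MemLp (f j) 2 ν)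
    (hf' : MemLp f' 2 ν) (hg : ∀ j, MemLp (g j) 2 ν) (hg' : MemLp g' 2 ν)
    (h : Tendsto (fun j => eLpNorm (f j - f') 2 ν) atTop (𝓝 0))
    (h' : Tendsto (fun j => eLpNorm (g j - g') 2 ν) atTop (𝓝 0)) :
    Tendsto (fun j => (eLpNorm (f j - g j) 2 ν).toReal) atTop
      (𝓝 (eLpNorm (f' - g') 2 ν).toReal) := by
  have h1 := (Lp.tendsto_Lp_iff_tendsto_eLpNorm'' _ hf _ hf').2 h
  have h2 := (Lp.tendsto_Lp_iff_tendsto_eLpNorm'' _ hg _ hg').2 h'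
  have h3 := (h1.sub h2).norm
  rw [← MemLp.toLp_sub hf' hg', Lp.norm_toLp] at h3
  refine h3.congr fun j => ?_
  rw [← MemLp.toLp_sub (hf j) (hg j), Lp.norm_toLp]

namespace TendstoH1

variable {qs : ℕ → E d × ℝ → ℝ}

theorem tendsto_eLpNorm (h : TendstoH1 Ω T qs q) :
    Tendsto (fun j => eLpNorm (qs j - q) 2 (cylMeasure Ω T)) atTop (𝓝 0) := by
  have h1 : Tendsto (fun j => eLpNorm (qs j - q) 2 (cylMeasure Ω T) ^ 2) atTop (𝓝 0) :=
    tendsto_of_tendsto_of_tendsto_of_le_of_le tendsto_const_nhds h.2.2 (fun j => zero_le)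
      fun j => le_self_add
  have h2 := (ENNReal.continuous_rpow_const (y := (1 / 2 : ℝ))).tendsto 0 |>.comp h1
  rw [ENNReal.zero_rpow_of_pos (by norm_num)] at h2
  refine h2.congr fun j => ?_
  rw [Function.comp, ← ENNReal.rpow_natCast, ← ENNReal.rpow_mul]
  norm_num

theorem tendsto_h1SeminormSq (hΩ : IsOpen Ω) (h : TendstoH1 Ω T qs q) :
    Tendsto (fun j => (h1SeminormSq Ω T (qs j)).toReal) atTop
      (𝓝 (h1SeminormSq Ω T q).toReal) := by
  obtain ⟨G', hG'⟩ := memH1_iff.1 h.2.1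
  choose G hG using fun j => memH1_iff.1 (h.1 j)
  have h1 : Tendsto (fun j => eLpNorm (G j - G') 2 (cylMeasure Ω T) ^ 2) atTop (𝓝 0) :=
    tendsto_of_tendsto_of_tendsto_of_le_of_le tendsto_const_nhds h.2.2 (fun j => zero_le)
      fun j => by
        simp only
        rw [h1SeminormSq_eq hΩ ((hG j).sub hG')]
        exact le_add_self
  have h2 := (ENNReal.continuous_rpow_const (y := (1 / 2 : ℝ))).tendsto 0 |>.comp h1
  rw [ENNReal.zero_rpow_of_pos (by norm_num)] at h2
  have h3 : Tendsto (fun j => eLpNorm (G j - G') 2 (cylMeasure Ω T)) atTop (𝓝 0) := by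
    refine h2.congr fun j => ?_
    rw [Function.comp, ← ENNReal.rpow_natCast, ← ENNReal.rpow_mul]
    norm_num
  have h4 := tendsto_toReal_eLpNorm_sub (fun j => (hG j).memLp_grad) hG'.memLp_grad
    (g := fun _ => 0) (g' := 0) (fun j => MemLp.zero) MemLp.zero h3 (by simp)
  simp only [sub_zero] at h4
  rw [h1SeminormSq_eq hΩ hG', ENNReal.toReal_pow]
  refine (h4.pow 2).congr fun j => ?_
  rw [h1SeminormSq_eq hΩ (hG j), ENNReal.toReal_pow]

theorem mem_admissibleSet {c₀ c₁ : ℝ} (h : TendstoH1 Ω T qs q)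
    (hq : ∀ j, qs j ∈ admissibleSet Ω T c₀ c₁) : q ∈ admissibleSet Ω T c₀ c₁ := by
  have h1 := tendstoInMeasure_of_tendsto_eLpNorm (by norm_num)
    (fun j => (h.1 j).memLp.1) h.2.1.memLp.1 h.tendsto_eLpNorm
  obtain ⟨k, -, hk⟩ := h1.exists_seq_tendsto_ae
  refine ⟨h.2.1.memLp.1, ?_⟩
  filter_upwards [hk, ae_all_iff.2 fun j => (hq j).2] with p h2 h3
  exact ⟨ge_of_tendsto' h2 fun j => (h3 _).1, le_of_tendsto' h2 fun j => (h3 _).2⟩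

end TendstoH1

theorem IsConvexPolyhedralDomain.isOpen (hΩ : IsConvexPolyhedralDomain Ω) : IsOpen Ω := by
  obtain ⟨-, S, rfl⟩ := hΩ
  exact isOpen_interior

theorem IsConvexPolyhedralDomain.volume_ne_top (hΩ : IsConvexPolyhedralDomain Ω) (T : ℝ) :
    volume (Ω ×ˢ Ioo 0 T) ≠ ⊤ := by
  obtain ⟨-, S, rfl⟩ := hΩ
  have h1 : Bornology.IsBounded (interior (convexHull ℝ (S : Set (E d)))) :=
    ((isBounded_convexHull.2 S.finite_toSet.isBounded)).subset interior_subset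
  exact (h1.prod (Metric.isBounded_Ioo 0 T)).measure_lt_top.ne

theorem memH1_const (hΩ : volume (Ω ×ˢ Ioo 0 T) ≠ ⊤) (c : ℝ) : MemH1 Ω T (fun _ => c) := by
  have : IsFiniteMeasure (cylMeasure Ω T) := isFiniteMeasure_restrict.2 hΩ
  exact memH1_iff.2 ⟨_, HasGrad.const c⟩

theorem const_mem_admissibleSet {c₀ c₁ : ℝ} (hc : c₀ ≤ c₁) :
    (fun _ => c₀) ∈ admissibleSet Ω T c₀ c₁ :=
  ⟨aestronglyMeasurable_const, Eventually.of_forall fun _ => ⟨le_rfl, hc⟩⟩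

/-- Compactness of sequences of admissible coefficients with bounded `H¹`-seminorms. -/
theorem exists_subseq_tendstoH1 (hΩ : IsConvexPolyhedralDomain Ω) {c₀ c₁ : ℝ}
    {qs : ℕ → E d × ℝ → ℝ} (hq : ∀ j, qs j ∈ admissibleSet Ω T c₀ c₁)
    (hq' : ∀ j, MemH1 Ω T (qs j)) {C : ℝ} (hC : ∀ j, (h1SeminormSq Ω T (qs j)).toReal ≤ C) :
    ∃ k : ℕ → ℕ, StrictMono k ∧ ∃ q ∈ admissibleSet Ω T c₀ c₁, MemH1 Ω T q ∧
      Tendsto (fun j => eLpNorm (qs (k j) - q) 2 (cylMeasure Ω T)) atTop (𝓝 0) ∧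
      ∀ (a : ℕ → ℝ) (b : ℝ), Tendsto a atTop (𝓝 b) →
        (∀ j, (h1SeminormSq Ω T (qs (k j))).toReal ≤ a j) →
        (h1SeminormSq Ω T q).toReal ≤ b ∧
        ((h1SeminormSq Ω T q).toReal = b → TendstoH1 Ω T (fun j => qs (k j)) q) := by
  have hO := hΩ.isOpen
  choose G hG using fun j => memH1_iff.1 (hq' j)
  have hS : ∀ j, (h1SeminormSq Ω T (qs j)).toReal =
      (eLpNorm (G j) 2 (cylMeasure Ω T)).toReal ^ 2 := fun j => by
    rw [h1SeminormSq_eq hO (hG j), ENNReal.toReal_pow]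
  obtain ⟨k, hk, q, G', hg, hc, hl, hw⟩ := exists_subseq_tendsto_of_hasGrad
    (hO.prod isOpen_Ioo) (hΩ.volume_ne_top T) hG (C := Real.sqrt C)
    (fun j => Real.le_sqrt_of_sq_le ((hS j).symm.le.trans (hC j))) (fun j => (hq j).2)
  refine ⟨k, hk, q, ⟨hg.memLp.1, hc⟩, memH1_iff.2 ⟨G', hg⟩, hl, fun a b hab ha => ?_⟩
  obtain ⟨h1, h2⟩ := hw.norm_le_and_tendsto (fun j => (hG (k j)).memLp_grad) hg.memLp_grad hab
    (fun j => (hS (k j)).symm.le.trans (ha j))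
  rw [h1SeminormSq_eq hO hg, ENNReal.toReal_pow]
  refine ⟨h1, fun hb => ⟨fun j => hq' _, memH1_iff.2 ⟨G', hg⟩, ?_⟩⟩
  have h3 := (ENNReal.Tendsto.pow (n := 2) hl).add (ENNReal.Tendsto.pow (n := 2) (h2 hb))
  simp only [ne_eq, OfNat.ofNat_ne_zero, not_false_eq_true, zero_pow, add_zero] at h3
  refine h3.congr fun j => ?_
  rw [h1SeminormSq_eq hO ((hG (k j)).sub hg)]

end SpaceTimeGradient

/-! ### Minimizers, stability and vanishing noise -/

section Minimizers

variable {d : ℕ} {Ω : Set (E d)} {T α c₀ c₁ : ℝ} {u₀ : L2 Ω} {f : ℝ → HMinusOne Ω}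

/-- The misfit `‖u(q) - z‖`. -/
noncomputable def misfit (Ω : Set (E d)) (T α : ℝ) (u₀ : L2 Ω) (f : ℝ → HMinusOne Ω)
    (z : ℝ → L2 Ω) (q : E d × ℝ → ℝ) : ℝ :=
  (eLpNorm (observation Ω T α u₀ f q - z) 2 (timeMeasure T)).toReal

theorem J_eq_top {γ : ℝ} (hγ : 0 < γ) {z : ℝ → L2 Ω} {q : E d × ℝ → ℝ} (h : ¬ MemH1 Ω T q) :
    J Ω T α u₀ f γ z q = ⊤ := by
  rw [J, h1SeminormSq_eq_top h, ENNReal.mul_top (by simpa using hγ), add_top]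

theorem J_eq_ofReal (hT : 0 < T) (hα0 : 0 < α) (hα1 : α < 1) (hc₀ : 0 < c₀) (hc : c₀ < c₁)
    (hf : MemLp f 2 (timeMeasure T)) (hΩ : IsOpen Ω) {γ : ℝ} (hγ : 0 < γ) {z : ℝ → L2 Ω}
    (hz : MemLp z 2 (timeMeasure T)) {q : E d × ℝ → ℝ} (hq : q ∈ admissibleSet Ω T c₀ c₁)
    (h : MemH1 Ω T q) :
    J Ω T α u₀ f γ z q = ENNReal.ofReal
      (2⁻¹ * misfit Ω T α u₀ f z q ^ 2 + γ / 2 * (h1SeminormSq Ω T q).toReal) := by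
  have h1 := ((memLp_observation hT hα0 hα1 hc₀ hc u₀ hf hq).sub hz).eLpNorm_ne_top
  rw [J, ENNReal.ofReal_add (by positivity) (by positivity), ENNReal.ofReal_mul (by positivity),
    ENNReal.ofReal_mul (by positivity), ENNReal.ofReal_toReal (h.h1SeminormSq_ne_top hΩ), misfit,
    ENNReal.ofReal_pow ENNReal.toReal_nonneg, ENNReal.ofReal_toReal h1,
    ENNReal.ofReal_inv_of_pos (by norm_num)]
  norm_num

/-- The constant `c₀` is admissible with finite functional, so a minimizer lies in `H¹`. All
comparisons can then be made in `ℝ`, with the factor `1/2` removed. -/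
theorem isMinimizer_iff (hT : 0 < T) (hα0 : 0 < α) (hα1 : α < 1) (hc₀ : 0 < c₀) (hc : c₀ < c₁)
    (hf : MemLp f 2 (timeMeasure T)) (hΩ : IsConvexPolyhedralDomain Ω) {γ : ℝ} (hγ : 0 < γ)
    {z : ℝ → L2 Ω} (hz : MemLp z 2 (timeMeasure T)) {q : E d × ℝ → ℝ} :
    IsMinimizer Ω T α c₀ c₁ u₀ f γ z q ↔ q ∈ admissibleSet Ω T c₀ c₁ ∧ MemH1 Ω T q ∧
      ∀ p ∈ admissibleSet Ω T c₀ c₁, MemH1 Ω T p →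
        misfit Ω T α u₀ f z q ^ 2 + γ * (h1SeminormSq Ω T q).toReal ≤
          misfit Ω T α u₀ f z p ^ 2 + γ * (h1SeminormSq Ω T p).toReal := by
  have hO := hΩ.isOpen
  have key : ∀ q ∈ admissibleSet Ω T c₀ c₁, MemH1 Ω T q → ∀ p ∈ admissibleSet Ω T c₀ c₁,
      MemH1 Ω T p → (J Ω T α u₀ f γ z q ≤ J Ω T α u₀ f γ z p ↔
        misfit Ω T α u₀ f z q ^ 2 + γ * (h1SeminormSq Ω T q).toReal ≤
          misfit Ω T α u₀ f z p ^ 2 + γ * (h1SeminormSq Ω T p).toReal) := by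
    intro q hq hq1 p hp hp1
    rw [J_eq_ofReal hT hα0 hα1 hc₀ hc hf hO hγ hz hq hq1,
      J_eq_ofReal hT hα0 hα1 hc₀ hc hf hO hγ hz hp hp1,
      ENNReal.ofReal_le_ofReal_iff (by positivity)]
    constructor <;> intro h <;> linarith
  constructor
  · rintro ⟨hq, hmin⟩
    have hq1 : MemH1 Ω T q := by
      by_contra hn
      have h1 := hmin (const_mem_admissibleSet (Ω := Ω) (T := T) hc.le)
      have h2 : J Ω T α u₀ f γ z q ≤ J Ω T α u₀ f γ z (fun _ => c₀) := h1
      rw [J_eq_top hγ hn, J_eq_ofReal hT hα0 hα1 hc₀ hc hf hO hγ hz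
        (const_mem_admissibleSet hc.le) (memH1_const (hΩ.volume_ne_top T) c₀)] at h2
      exact ENNReal.ofReal_ne_top (top_le_iff.1 h2)
    exact ⟨hq, hq1, fun p hp hp1 => (key q hq hq1 p hp hp1).1 (hmin hp)⟩
  · rintro ⟨hq, hq1, hmin⟩
    refine ⟨hq, fun p hp => ?_⟩
    by_cases hp1 : MemH1 Ω T p
    · exact (key q hq hq1 p hp hp1).2 (hmin p hp hp1)
    · change J Ω T α u₀ f γ z q ≤ J Ω T α u₀ f γ z p
      rw [J_eq_top hγ hp1]
      exact le_top

theorem tendsto_misfit (hT : 0 < T) (hα0 : 0 < α) (hα1 : α < 1) (hc₀ : 0 < c₀) (hc : c₀ < c₁)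
    (hf : MemLp f 2 (timeMeasure T)) {z : ℕ → ℝ → L2 Ω} {z' : ℝ → L2 Ω}
    (hz : ∀ j, MemLp (z j) 2 (timeMeasure T)) (hz' : MemLp z' 2 (timeMeasure T))
    (hzz : Tendsto (fun j => eLpNorm (z j - z') 2 (timeMeasure T)) atTop (𝓝 0))
    {qs : ℕ → E d × ℝ → ℝ} {q : E d × ℝ → ℝ} (hqs : ∀ j, qs j ∈ admissibleSet Ω T c₀ c₁)
    (hq : q ∈ admissibleSet Ω T c₀ c₁)
    (h : Tendsto (fun j => eLpNorm (qs j - q) 2 (cylMeasure Ω T)) atTop (𝓝 0)) :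
    Tendsto (fun j => misfit Ω T α u₀ f (z j) (qs j)) atTop (𝓝 (misfit Ω T α u₀ f z' q)) :=
  tendsto_toReal_eLpNorm_sub (fun j => memLp_observation hT hα0 hα1 hc₀ hc u₀ hf (hqs j))
    (memLp_observation hT hα0 hα1 hc₀ hc u₀ hf hq) hz hz'
    (tendsto_observation hT hα0 hα1 hc₀ hc u₀ hf hqs hq h) hzz

/-- Stability of the minimizers with respect to the data. -/
theorem exists_subseq_tendsto_minimizer (hT : 0 < T) (hα0 : 0 < α) (hα1 : α < 1) (hc₀ : 0 < c₀)
    (hc : c₀ < c₁) (hf : MemLp f 2 (timeMeasure T)) (hΩ : IsConvexPolyhedralDomain Ω) {γ : ℝ}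
    (hγ : 0 < γ) {z : ℕ → ℝ → L2 Ω} {z' : ℝ → L2 Ω} (hz : ∀ j, MemLp (z j) 2 (timeMeasure T))
    (hz' : MemLp z' 2 (timeMeasure T))
    (hzz : Tendsto (fun j => eLpNorm (z j - z') 2 (timeMeasure T)) atTop (𝓝 0))
    {qs : ℕ → E d × ℝ → ℝ} (hqs : ∀ j, IsMinimizer Ω T α c₀ c₁ u₀ f γ (z j) (qs j)) :
    ∃ k : ℕ → ℕ, StrictMono k ∧ ∃ q : E d × ℝ → ℝ,
      IsMinimizer Ω T α c₀ c₁ u₀ f γ z' q ∧ TendstoH1 Ω T (fun j => qs (k j)) q := by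
  have hm := fun j => (isMinimizer_iff hT hα0 hα1 hc₀ hc hf hΩ hγ (hz j)).1 (hqs j)
  have hle : ∀ p ∈ admissibleSet Ω T c₀ c₁, MemH1 Ω T p → ∀ j,
      (h1SeminormSq Ω T (qs j)).toReal ≤ (misfit Ω T α u₀ f (z j) p ^ 2 -
        misfit Ω T α u₀ f (z j) (qs j) ^ 2) / γ + (h1SeminormSq Ω T p).toReal := by
    intro p hp hp1 j
    have h1 := (hm j).2.2 p hp hp1
    rw [← sub_le_iff_le_add, le_div_iff₀ hγ]
    linarith
  have hmp : ∀ p ∈ admissibleSet Ω T c₀ c₁,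
      Tendsto (fun j => misfit Ω T α u₀ f (z j) p) atTop (𝓝 (misfit Ω T α u₀ f z' p)) :=
    fun p hp => tendsto_misfit hT hα0 hα1 hc₀ hc hf hz hz' hzz (fun _ => hp) hp (by simp)
  have hp0 := const_mem_admissibleSet (Ω := Ω) (T := T) hc.le
  have hp1 := memH1_const (hΩ.volume_ne_top T) c₀
  obtain ⟨B, hB⟩ := ((hmp _ hp0).pow 2).bddAbove_range
  obtain ⟨k, hk, q, hq, hq1, hql, hS⟩ := exists_subseq_tendstoH1 hΩ (fun j => (hm j).1)
    (fun j => (hm j).2.1) (C := B / γ + (h1SeminormSq Ω T fun _ : E d × ℝ => c₀).toReal)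
    fun j => (hle _ hp0 hp1 j).trans (by
      have h1 : misfit Ω T α u₀ f (z j) (fun _ => c₀) ^ 2 ≤ B := hB ⟨j, rfl⟩
      gcongr
      nlinarith [sq_nonneg (misfit Ω T α u₀ f (z j) (qs j))])
  have hml := tendsto_misfit (α := α) (u₀ := u₀) hT hα0 hα1 hc₀ hc hf (fun j => hz (k j)) hz'
    (hzz.comp hk.tendsto_atTop) (fun j => (hm (k j)).1) hq hql
  have hlim : ∀ p ∈ admissibleSet Ω T c₀ c₁,
      Tendsto (fun j => (misfit Ω T α u₀ f (z (k j)) p ^ 2 -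
        misfit Ω T α u₀ f (z (k j)) (qs (k j)) ^ 2) / γ + (h1SeminormSq Ω T p).toReal) atTop
        (𝓝 ((misfit Ω T α u₀ f z' p ^ 2 - misfit Ω T α u₀ f z' q ^ 2) / γ +
          (h1SeminormSq Ω T p).toReal)) := fun p hp =>
    (((((hmp p hp).comp hk.tendsto_atTop).pow 2).sub (hml.pow 2)).div_const γ).add_const _
  refine ⟨k, hk, q, (isMinimizer_iff hT hα0 hα1 hc₀ hc hf hΩ hγ hz').2
    ⟨hq, hq1, fun p hp hp1 => ?_⟩, ?_⟩
  -- Lower semicontinuity against an arbitrary competitor `p` is, after rearranging, minimality of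
  -- `q`.
  · have h1 := (hS _ _ (hlim p hp) fun j => hle p hp hp1 (k j)).1
    rw [← sub_le_iff_le_add, le_div_iff₀ hγ] at h1
    linarith
  -- With `q` itself as competitor the misfits cancel in the limit, so the upper bounds tend to
  -- `‖∇q‖²` and convergence is strong.
  · refine (hS _ _ (hlim q hq) fun j => hle q hq hq1 (k j)).2 ?_
    simp

theorem misfit_eq_zero_iff (hT : 0 < T) (hα0 : 0 < α) (hα1 : α < 1) (hc₀ : 0 < c₀) (hc : c₀ < c₁)
    (hf : MemLp f 2 (timeMeasure T)) {z : ℝ → L2 Ω} (hz : MemLp z 2 (timeMeasure T))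
    {q : E d × ℝ → ℝ} (hq : q ∈ admissibleSet Ω T c₀ c₁) :
    misfit Ω T α u₀ f z q = 0 ↔ observation Ω T α u₀ f q =ᵐ[timeMeasure T] z := by
  have h1 := (memLp_observation hT hα0 hα1 hc₀ hc u₀ hf hq).sub hz
  rw [misfit, ENNReal.toReal_eq_zero_iff, or_iff_left h1.eLpNorm_ne_top,
    eLpNorm_eq_zero_iff h1.1 (by norm_num)]
  exact ⟨fun h => h.mono fun t ht => sub_eq_zero.1 ht, fun h => h.mono fun t ht => sub_eq_zero.2 ht⟩

section VanishingNoise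

variable {δ γ : ℕ → ℝ} {z : ℕ → ℝ → L2 Ω} {z' : ℝ → L2 Ω} {qs : ℕ → E d × ℝ → ℝ}

/-- An exact solution is a competitor whose misfit equals the noise level `δ j`. -/
theorem misfit_sq_add_le (hT : 0 < T) (hα0 : 0 < α) (hα1 : α < 1) (hc₀ : 0 < c₀)
    (hc : c₀ < c₁) (hf : MemLp f 2 (timeMeasure T)) (hΩ : IsConvexPolyhedralDomain Ω)
    (hδ0 : ∀ j, 0 ≤ δ j) (hγ0 : ∀ j, 0 < γ j) (hz : ∀ j, MemLp (z j) 2 (timeMeasure T))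
    (hzδ : ∀ j, eLpNorm (z j - z') 2 (timeMeasure T) = ENNReal.ofReal (δ j))
    (hqs : ∀ j, IsMinimizer Ω T α c₀ c₁ u₀ f (γ j) (z j) (qs j)) {p : E d × ℝ → ℝ}
    (hp : IsSolution Ω T α c₀ c₁ u₀ f z' p) (hp1 : MemH1 Ω T p) (j : ℕ) :
    misfit Ω T α u₀ f (z j) (qs j) ^ 2 + γ j * (h1SeminormSq Ω T (qs j)).toReal ≤
      δ j ^ 2 + γ j * (h1SeminormSq Ω T p).toReal := by
  have h1 := ((isMinimizer_iff hT hα0 hα1 hc₀ hc hf hΩ (hγ0 j) (hz j)).1 (hqs j)).2.2 p hp.1 hp1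
  have h2 : misfit Ω T α u₀ f (z j) p = δ j := by
    have h3 : observation Ω T α u₀ f p - z j =ᵐ[timeMeasure T] z' - z j :=
      hp.2.sub (EventuallyEq.refl _ _)
    rw [misfit, eLpNorm_congr_ae h3, eLpNorm_sub_comm, hzδ, ENNReal.toReal_ofReal (hδ0 j)]
  rwa [h2] at h1

/-- `L²`-limits of minimizers solve the inverse problem as the noise level vanishes. -/
theorem isSolution_of_tendsto (hT : 0 < T) (hα0 : 0 < α) (hα1 : α < 1) (hc₀ : 0 < c₀)
    (hc : c₀ < c₁) (hf : MemLp f 2 (timeMeasure T)) (hΩ : IsConvexPolyhedralDomain Ω)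
    (hδ0 : ∀ j, 0 ≤ δ j) (hγ0 : ∀ j, 0 < γ j) (hδ : Tendsto δ atTop (𝓝 0))
    (hγ : Tendsto γ atTop (𝓝 0)) (hz : ∀ j, MemLp (z j) 2 (timeMeasure T))
    (hzδ : ∀ j, eLpNorm (z j - z') 2 (timeMeasure T) = ENNReal.ofReal (δ j))
    (hqs : ∀ j, IsMinimizer Ω T α c₀ c₁ u₀ f (γ j) (z j) (qs j))
    (hdag : ∃ p, IsSolution Ω T α c₀ c₁ u₀ f z' p ∧ MemH1 Ω T p)
    {k : ℕ → ℕ} (hk : StrictMono k) {q : E d × ℝ → ℝ} (hq : q ∈ admissibleSet Ω T c₀ c₁)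
    (hql : Tendsto (fun j => eLpNorm (qs (k j) - q) 2 (cylMeasure Ω T)) atTop (𝓝 0)) :
    IsSolution Ω T α c₀ c₁ u₀ f z' q := by
  obtain ⟨p, hp, hp1⟩ := hdag
  have hz' : MemLp z' 2 (timeMeasure T) :=
    (memLp_congr_ae hp.2).1 (memLp_observation hT hα0 hα1 hc₀ hc u₀ hf hp.1)
  have hzz : Tendsto (fun j => eLpNorm (z j - z') 2 (timeMeasure T)) atTop (𝓝 0) := by
    simp only [hzδ]
    simpa using ENNReal.tendsto_ofReal hδ
  have h1 := tendsto_misfit (α := α) (u₀ := u₀) hT hα0 hα1 hc₀ hc hf (fun j => hz (k j)) hz'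
    (hzz.comp hk.tendsto_atTop) (fun j => (hqs (k j)).1) hq hql
  have h2 : Tendsto (fun j => misfit Ω T α u₀ f (z j) (qs j) ^ 2) atTop (𝓝 0) := by
    refine squeeze_zero (fun j => sq_nonneg _) (fun j => ?_)
      (g := fun j => δ j ^ 2 + γ j * (h1SeminormSq Ω T p).toReal) ?_
    · have h3 := misfit_sq_add_le hT hα0 hα1 hc₀ hc hf hΩ hδ0 hγ0 hz hzδ hqs hp hp1 j
      have h4 : 0 ≤ γ j * (h1SeminormSq Ω T (qs j)).toReal :=
        mul_nonneg (hγ0 j).le ENNReal.toReal_nonneg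
      linarith
    · simpa using (hδ.pow 2).add (hγ.mul_const (h1SeminormSq Ω T p).toReal)
  have h5 := tendsto_nhds_unique (h1.pow 2) (h2.comp hk.tendsto_atTop)
  exact ⟨hq, (misfit_eq_zero_iff hT hα0 hα1 hc₀ hc hf hz' hq).1 (pow_eq_zero_iff two_ne_zero |>.1 h5)⟩

theorem h1SeminormSq_le_add (hT : 0 < T) (hα0 : 0 < α) (hα1 : α < 1) (hc₀ : 0 < c₀)
    (hc : c₀ < c₁) (hf : MemLp f 2 (timeMeasure T)) (hΩ : IsConvexPolyhedralDomain Ω)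
    (hδ0 : ∀ j, 0 ≤ δ j) (hγ0 : ∀ j, 0 < γ j) (hz : ∀ j, MemLp (z j) 2 (timeMeasure T))
    (hzδ : ∀ j, eLpNorm (z j - z') 2 (timeMeasure T) = ENNReal.ofReal (δ j))
    (hqs : ∀ j, IsMinimizer Ω T α c₀ c₁ u₀ f (γ j) (z j) (qs j)) {p : E d × ℝ → ℝ}
    (hp : IsSolution Ω T α c₀ c₁ u₀ f z' p) (hp1 : MemH1 Ω T p) (j : ℕ) :
    (h1SeminormSq Ω T (qs j)).toReal ≤ δ j ^ 2 / γ j + (h1SeminormSq Ω T p).toReal := by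
  have h1 := misfit_sq_add_le hT hα0 hα1 hc₀ hc hf hΩ hδ0 hγ0 hz hzδ hqs hp hp1 j
  rw [← sub_le_iff_le_add, le_div_iff₀ (hγ0 j)]
  nlinarith [sq_nonneg (misfit Ω T α u₀ f (z j) (qs j))]

end VanishingNoise

end Minimizers

end Subdiffusion

theorem mainTheorem9 (d : ℕ) (hd1 : 1 ≤ d) (hd3 : d ≤ 3)
    (Ω : Set (Subdiffusion.E d)) (hΩ : Subdiffusion.IsConvexPolyhedralDomain Ω)
    (T : ℝ) (hT : 0 < T) (α : ℝ) (hα0 : 0 < α) (hα1 : α < 1)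
    (c₀ c₁ : ℝ) (hc₀ : 0 < c₀) (hc : c₀ < c₁)
    (u₀ : Subdiffusion.L2 Ω) (f : ℝ → Subdiffusion.HMinusOne Ω)
    (hf : MemLp f 2 (Subdiffusion.timeMeasure T)) :
    -- (i)
    (∀ (γ : ℝ), 0 < γ →
      ∀ (z : ℕ → ℝ → Subdiffusion.L2 Ω) (zstar : ℝ → Subdiffusion.L2 Ω),
      (∀ j, MemLp (z j) 2 (Subdiffusion.timeMeasure T)) →
      MemLp zstar 2 (Subdiffusion.timeMeasure T) →
      Tendsto (fun j => eLpNorm (z j - zstar) 2 (Subdiffusion.timeMeasure T)) atTop (𝓝 0) →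
      ∀ (qs : ℕ → Subdiffusion.E d × ℝ → ℝ),
      (∀ j, Subdiffusion.IsMinimizer Ω T α c₀ c₁ u₀ f γ (z j) (qs j)) →
      ∃ k : ℕ → ℕ, StrictMono k ∧ ∃ q : Subdiffusion.E d × ℝ → ℝ,
        Subdiffusion.IsMinimizer Ω T α c₀ c₁ u₀ f γ zstar q ∧
        Subdiffusion.TendstoH1 Ω T (fun j => qs (k j)) q) ∧
    -- (ii)
    (∀ (δ γ : ℕ → ℝ), (∀ j, 0 ≤ δ j) → (∀ j, 0 < γ j) →
      Tendsto δ atTop (𝓝 0) → Tendsto γ atTop (𝓝 0) →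
      Tendsto (fun j => δ j ^ 2 / γ j) atTop (𝓝 0) →
      ∀ (z : ℕ → ℝ → Subdiffusion.L2 Ω) (zstar : ℝ → Subdiffusion.L2 Ω),
      (∃ qdag, Subdiffusion.IsSolution Ω T α c₀ c₁ u₀ f zstar qdag ∧
        Subdiffusion.MemH1 Ω T qdag) →
      (∀ j, MemLp (z j) 2 (Subdiffusion.timeMeasure T)) →
      (∀ j, eLpNorm (z j - zstar) 2 (Subdiffusion.timeMeasure T) = ENNReal.ofReal (δ j)) →
      ∀ (qs : ℕ → Subdiffusion.E d × ℝ → ℝ),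
      (∀ j, Subdiffusion.IsMinimizer Ω T α c₀ c₁ u₀ f (γ j) (z j) (qs j)) →
      (∃ k : ℕ → ℕ, StrictMono k ∧ ∃ q : Subdiffusion.E d × ℝ → ℝ,
        Subdiffusion.TendstoH1 Ω T (fun j => qs (k j)) q) ∧
      (∀ k : ℕ → ℕ, StrictMono k → ∀ q : Subdiffusion.E d × ℝ → ℝ,
        Subdiffusion.TendstoH1 Ω T (fun j => qs (k j)) q →
        Subdiffusion.IsMinSeminormSolution Ω T α c₀ c₁ u₀ f zstar q)) := by
  have hO := hΩ.isOpen
  refine ⟨fun γ hγ z zstar hz hzstar hzz qs hqs =>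
    Subdiffusion.exists_subseq_tendsto_minimizer hT hα0 hα1 hc₀ hc hf hΩ hγ hz hzstar hzz hqs, ?_⟩
  intro δ γ hδ0 hγ0 hδ hγ hδγ z zstar hdag hz hzδ qs hqs
  have hm := fun j => (Subdiffusion.isMinimizer_iff hT hα0 hα1 hc₀ hc hf hΩ (hγ0 j) (hz j)).1
    (hqs j)
  have hle := fun p hp hp1 j => Subdiffusion.h1SeminormSq_le_add (p := p) hT hα0 hα1 hc₀ hc hf hΩ
    hδ0 hγ0 hz hzδ hqs hp hp1 j
  have hlim : ∀ k : ℕ → ℕ, StrictMono k → ∀ s : ℝ,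
      Tendsto (fun j => δ (k j) ^ 2 / γ (k j) + s) atTop (𝓝 s) := fun k hk s => by
    simpa using (hδγ.comp hk.tendsto_atTop).add_const s
  constructor
  · obtain ⟨p, hp, hp1⟩ := hdag
    obtain ⟨B, hB⟩ := hδγ.bddAbove_range
    obtain ⟨k, hk, q, hq, hq1, hql, hS⟩ := Subdiffusion.exists_subseq_tendstoH1 hΩ
      (fun j => (hm j).1) (fun j => (hm j).2.1)
      (C := B + (Subdiffusion.h1SeminormSq Ω T p).toReal)
      fun j => (hle p hp hp1 j).trans (add_le_add (hB ⟨j, rfl⟩) le_rfl)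
    have hsol := Subdiffusion.isSolution_of_tendsto hT hα0 hα1 hc₀ hc hf hΩ hδ0 hγ0 hδ hγ hz hzδ
      hqs ⟨p, hp, hp1⟩ hk hq hql
    -- The limit is itself an exact solution, hence a legitimate competitor; the bounds `δ²/γ +
    -- ‖∇q‖²` tend to `‖∇q‖²`.
    exact ⟨k, hk, q, (hS _ _ (hlim k hk _) fun j => hle q hsol hq1 (k j)).2 rfl⟩
  · intro k hk q hkq
    have hq := hkq.mem_admissibleSet fun j => (hm (k j)).1
    refine ⟨Subdiffusion.isSolution_of_tendsto hT hα0 hα1 hc₀ hc hf hΩ hδ0 hγ0 hδ hγ hz hzδ hqs hdag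
      hk hq hkq.tendsto_eLpNorm, hkq.2.1, fun q' hq' => ?_⟩
    by_cases hq1 : Subdiffusion.MemH1 Ω T q'
    · rw [← ENNReal.toReal_le_toReal (hkq.2.1.h1SeminormSq_ne_top hO) (hq1.h1SeminormSq_ne_top hO)]
      -- Along a strongly convergent subsequence the seminorms converge, so the bound by `δ²/γ +
      -- ‖∇q'‖²` passes to the limit.
      exact le_of_tendsto_of_tendsto' (hkq.tendsto_h1SeminormSq hO) (hlim k hk _)
        fun j => hle q' hq' hq1 (k j)
    · rw [Subdiffusion.h1SeminormSq_eq_top hq1]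
      exact le_top
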